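/- Let $K$ be a number field with algebraic closure $\bar K$. A \emph{tower of curves} $\mathcal C=(\{C_n\}_{n\ge 0},\{\varphi_n\}_{n\ge 1})$ over $K$ consists of smooth projective geometrically connected curves $C_n$ over $K$ and nonconstant $K$-morphisms $\varphi_n:C_n\to C_{n-1}$ of degree $>1$. Its genus is $g(\mathcal C)=\limsup_n g(C_n)$, where $g(C_n)=\dim_K H^1(C_n,\mathcal O_{C_n})$. For $m\ge n$ let $\varphi_{m,n}:C_m\to C_n$ be the composite of the maps of the tower (the identity if $m=n$). The set $\mathcal C(K)_0$ of $K$-trivial points of level $0$ consists of the $P\in C_0(K)$ such that for every $m\ge 0$ there is $P_m\in C_m(K)$ with $\varphi_{m,0}(P_m)=P$. For a field $F$ and a sequence $\mathcal F=(f_n)_{n\ge1}$ of rational functions $f_n\in F(x)$ of degree $>1$, let $\mathcal C_{\mathcal F}$ be the tower over $F$ with $C_n=\mathbb P^1_F$ for all $n\ge 0$ and $\varphi_n=f_n$ for all $n\ge 1$. An isomorphism of towers over $F$ is a family of $F$-isomorphisms of the curves at each level that commutes with the maps of the towers. Let $\mathcal C$ be a tower of curves over $K$ of genus $g(\mathcal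 C)=0$. Then: 1. If $\mathcal C(K)_0\neq\emptyset$, there exist a sequence $\mathcal F=(f_n)_{n\ge1}$ of rational functions $f_n\in K(x)$ of degree $>1$ and an isomorphism $\mathcal C\cong\mathcal C_{\mathcal F}$ over $K$. 2. There are infinitely many fields $L$ with $K\subset L\subset\bar K$ and $[L:K]=2$ for which there exist a sequence $\mathcal F=(f_n)_{n\ge1}$ of rational functions $f_n\in L(x)$ of degree $>1$ and an isomorphism $\mathcal C_L\cong\mathcal C_{\mathcal F}$ over $L$, where $\mathcal C_L$ is the base change of $\mathcal C$ to $L$. -/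

import Mathlib

open CategoryTheory AlgebraicGeometry Opposite

universe u

attribute [local instance] MvPolynomial.gradedAlgebra

noncomputable section

/-! ### Cohomology of the structure sheaf and the genus -/

/-- The structure sheaf of a scheme, as a sheaf of abelian groups. -/
def structureSheafAb (X : Scheme.{u}) :
    Sheaf (Opens.grothendieckTopology X) AddCommGrpCat.{u} :=
  (sheafCompose _ (forget₂ RingCat.{u} AddCommGrpCat.{u})).obj X.ringCatSheaf

/-- The structure map `K → Γ(X, U)` of a `K`-scheme `X`, for `U` open in `X`. -/
def scalarsToSections {K : Type u} [Field K] (X : Over (Spec (.of K)))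
    (U : X.left.Opens) : K →+* Γ(X.left, U) :=
  ((Scheme.ΓSpecIso (.of K)).inv ≫ X.hom.appTop ≫
    X.left.presheaf.map (homOfLE (le_top : U ≤ ⊤)).op).hom

lemma map_scalarsToSections {K : Type u} [Field K] (X : Over (Spec (.of K)))
    {U V : X.left.Opens} (i : V ⟶ U) (a : K) :
    X.left.presheaf.map i.op (scalarsToSections X U a) = scalarsToSections X V a := by
  change X.left.presheaf.map i.op (X.left.presheaf.map (homOfLE (le_top : U ≤ ⊤)).op _) = _
  rw [← ConcreteCategory.comp_apply, ← Functor.map_comp]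
  rfl

/-- Multiplication by a scalar `a : K`, as an endomorphism of the structure sheaf. -/
def scalarEndo {K : Type u} [Field K] (X : Over (Spec (.of K))) (a : K) :
    structureSheafAb X.left ⟶ structureSheafAb X.left where
  hom :=
    { app := fun U => AddCommGrpCat.ofHom
        (AddMonoidHom.mulLeft (scalarsToSections X U.unop a) :
          Γ(X.left, U.unop) →+ Γ(X.left, U.unop))
      naturality := by
        intro U V i
        ext (x : Γ(X.left, U.unop))
        have h := map_scalarsToSections X i.unop a
        change scalarsToSections X V.unop a * X.left.presheaf.map i x =
          X.left.presheaf.map i (scalarsToSections X U.unop a * x)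
        rw [map_mul, ← h]
        rfl }

/-- The cohomology group `Hⁿ(X, 𝒪_X)` of a `K`-scheme. -/
def structureCohomology {K : Type u} [Field K] (X : Over (Spec (.of K))) (n : ℕ) : Type u :=
  Sheaf.H (structureSheafAb X.left) n

instance {K : Type u} [Field K] (X : Over (Spec (.of K))) (n : ℕ) :
    AddCommGroup (structureCohomology X n) :=
  inferInstanceAs (AddCommGroup (Sheaf.H (structureSheafAb X.left) n))

/-- The action of scalars on `Hⁿ(X, 𝒪_X)`, induced by their action on `𝒪_X`. -/
def scalarAction {K : Type u} [Field K] (X : Over (Spec (.of K))) (n : ℕ) :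
    K →+* AddMonoid.End (structureCohomology X n) where
  toFun a := Sheaf.H.map (scalarEndo X a) n
  map_one' := by
    have h : scalarEndo X 1 = 𝟙 _ := by
      ext U (x : Γ(X.left, U.unop))
      change scalarsToSections X U.unop 1 * x = x
      rw [map_one, one_mul]
    ext x
    rw [h]
    exact Sheaf.H.map_id_apply x
  map_mul' a b := by
    have h : scalarEndo X (a * b) = scalarEndo X b ≫ scalarEndo X a := by
      ext U (x : Γ(X.left, U.unop))
      change scalarsToSections X U.unop (a * b) * x =
        scalarsToSections X U.unop a * (scalarsToSections X U.unop b * x)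
      rw [map_mul, mul_assoc]
    rw [h]
    refine AddMonoidHom.ext fun x => ?_
    change Sheaf.H.map (scalarEndo X b ≫ scalarEndo X a) n x =
      Sheaf.H.map (scalarEndo X a) n (Sheaf.H.map (scalarEndo X b) n x)
    simp only [Sheaf.H.map_apply, Abelian.Ext.comp_assoc_of_third_deg_zero,
      Abelian.Ext.mk₀_comp_mk₀]
  map_zero' := by
    have h : scalarEndo X 0 = 0 := by
      ext U (x : Γ(X.left, U.unop))
      change scalarsToSections X U.unop 0 * x = 0
      rw [map_zero, zero_mul]
    rw [h]
    refine AddMonoidHom.ext fun x => ?_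
    change Sheaf.H.map 0 n x = 0
    rw [Sheaf.H.map_apply, Abelian.Ext.mk₀_zero, Abelian.Ext.comp_zero]
  map_add' a b := by
    have h : scalarEndo X (a + b) = scalarEndo X a + scalarEndo X b := by
      ext U (x : Γ(X.left, U.unop))
      change scalarsToSections X U.unop (a + b) * x =
        scalarsToSections X U.unop a * x + scalarsToSections X U.unop b * x
      rw [map_add, add_mul]
    rw [h]
    refine AddMonoidHom.ext fun x => ?_
    change Sheaf.H.map (scalarEndo X a + scalarEndo X b) n x =
      Sheaf.H.map (scalarEndo X a) n x + Sheaf.H.map (scalarEndo X b) n x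
    simp only [Sheaf.H.map_apply, Abelian.Ext.mk₀_add, Abelian.Ext.comp_add]

instance {K : Type u} [Field K] (X : Over (Spec (.of K))) (n : ℕ) :
    Module K (structureCohomology X n) :=
  Module.compHom _ (scalarAction X n)

/-- The genus `dim_K H¹(C, 𝒪_C)` of a curve `C` over `K`. -/
def curveGenus {K : Type u} [Field K] (C : Over (Spec (.of K))) : ℕ∞ :=
  Cardinal.toENat (Module.rank K (structureCohomology C 1))

/-! ### Projective space and curves -/

/-- The standard grading of `K[X₀, …, Xₙ]`. -/
abbrev polyGrading (K : Type u) [Field K] (n : ℕ) : ℕ → Submodule K (MvPolynomial (Fin (n + 1)) K) :=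
  MvPolynomial.homogeneousSubmodule (Fin (n + 1)) K

/-- Projective space `ℙⁿ = Proj K[X₀, …, Xₙ]` over `K`. -/
def projSpace (K : Type u) [Field K] (n : ℕ) : Over (Spec (.of K)) :=
  Over.mk (Y := Proj (polyGrading K n)) (Proj.toSpecZero (polyGrading K n) ≫
    Spec.map (CommRingCat.ofHom (algebraMap K (polyGrading K n 0))))

/-- Smooth projective geometrically connected curves over `K`. -/
structure IsSmoothProjectiveCurve {K : Type u} [Field K] (C : Over (Spec (.of K))) : Prop where
  smooth : SmoothOfRelativeDimension 1 C.hom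
  projective : ∃ (n : ℕ) (i : C ⟶ projSpace K n), IsClosedImmersion i.left
  geometricallyConnected : GeometricallyConnected C.hom

open Classical in
/-- The degree of a morphism `f : X ⟶ Y` of integral schemes: the degree of the residue field of
the generic point `ξ` of `X` over the residue field of `f ξ`. When `f` is a nonconstant morphism of
curves, `f ξ` is the generic point of `Y`, and this is the degree `[K(X) : K(Y)]` of the extension
of function fields. -/
def morphismDegree {X Y : Scheme.{u}} (f : X ⟶ Y) : ℕ :=
  if h : ∃ ξ : X, IsGenericPoint ξ Set.univ then
    letI := (f.residueFieldMap h.choose).hom.toAlgebra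
    Module.finrank (Y.residueField (f h.choose)) (X.residueField h.choose)
  else 0

/-! ### Towers of curves -/

/-- A tower of curves over `K`; `φ n : C (n + 1) ⟶ C n` is the `(n + 1)`-st map of the tower. -/
structure TowerOfCurves (K : Type u) [Field K] where
  C : ℕ → Over (Spec (.of K))
  φ : ∀ n, C (n + 1) ⟶ C n
  isCurve : ∀ n, IsSmoothProjectiveCurve (C n)
  nonconstant : ∀ n, ¬ (Set.range (φ n).left).Subsingleton
  one_lt_degree : ∀ n, 1 < morphismDegree (φ n).left

namespace TowerOfCurves

variable {K : Type u} [Field K] (T : TowerOfCurves K)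

/-- A tower as an inverse system of `K`-schemes. The transition map from level `m` to level `n ≤ m`
is the composite of the maps of the tower. Two towers are isomorphic when their inverse systems
are. -/
def toFunctor : ℕᵒᵖ ⥤ Over (Spec (.of K)) := Functor.ofOpSequence T.φ

/-- The composite map from level `m` to level `n`, for `n ≤ m`. -/
def transition {n m : ℕ} (h : n ≤ m) : T.C m ⟶ T.C n := T.toFunctor.map (homOfLE h).op

/-- The genus of a tower: the limsup of the genera of its curves. -/
def genus : ℕ∞ := Filter.limsup (fun n => curveGenus (T.C n)) Filter.atTop

/-- The `K`-trivial points in level `n`: the points of `C n` over `K` that lift to a point over `K`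
of every higher level. -/
def trivialPoints (n : ℕ) : Set (Over.mk (𝟙 (Spec (.of K))) ⟶ T.C n) :=
  {P | ∀ (m : ℕ) (h : n ≤ m), ∃ Q : Over.mk (𝟙 (Spec (.of K))) ⟶ T.C m, Q ≫ T.transition h = P}

/-- The base change of a tower to an extension `L` of `K`, as an inverse system of `L`-schemes. -/
def baseChange (L : Type u) [Field L] [Algebra K L] : ℕᵒᵖ ⥤ Over (Spec (.of L)) :=
  T.toFunctor ⋙ Over.pullback (Spec.map (CommRingCat.ofHom (algebraMap K L)))

end TowerOfCurves

/-! ### Towers of projective lines given by rational functions -/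

/-- For an element `a` of an extension `L` of `K`, the evaluation `X₀ / X₁ ↦ a` of
the elements of degree `0` of `K[X₀, X₁][1 / X₁]`. -/
def evalAway (K : Type u) [Field K] {L : Type u} [Field L] [Algebra K L] (a : L) :
    HomogeneousLocalization.Away (polyGrading K 1) (MvPolynomial.X 1) →+* L :=
  (IsLocalization.Away.lift (S := Localization.Away (MvPolynomial.X 1 : MvPolynomial (Fin 2) K))
    (MvPolynomial.X 1)
    (g := (MvPolynomial.aeval ![a, 1] : MvPolynomial (Fin 2) K →ₐ[K] L).toRingHom)
    (by simp)).comp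
  (algebraMap (HomogeneousLocalization.Away (polyGrading K 1) (MvPolynomial.X 1))
    (Localization.Away (MvPolynomial.X 1 : MvPolynomial (Fin 2) K)))

/-- The point `[a : 1]` of `ℙ¹` with values in an extension `L` of `K`. -/
def affinePoint (K : Type u) [Field K] {L : Type u} [Field L] [Algebra K L] (a : L) :
    Spec (.of L) ⟶ (projSpace K 1).left :=
  Spec.map (CommRingCat.ofHom (evalAway K a)) ≫
    Proj.awayι (polyGrading K 1) (MvPolynomial.X 1) (MvPolynomial.isHomogeneous_X K 1) one_pos

/-- The `K`-morphism `g : ℙ¹ ⟶ ℙ¹` is given by the rational function `f ∈ K(x)`: it sends the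
generic point `[x : 1]`, with values in `K(x)`, to `[f(x) : 1]`. -/
def IsGivenBy {K : Type u} [Field K] (g : projSpace K 1 ⟶ projSpace K 1) (f : RatFunc K) : Prop :=
  affinePoint K (RatFunc.X : RatFunc K) ≫ g.left = affinePoint K f

/-- The degree of a rational function. -/
def ratFuncDegree {K : Type u} [Field K] (f : RatFunc K) : ℕ :=
  max f.num.natDegree f.denom.natDegree

/-- The inverse system `S` is isomorphic over `K` to the tower all of whose curves are `ℙ¹` and
whose `(n + 1)`-st map is given by the rational function `f n` of degree `> 1`. -/
def IsIsoToRationalTower {K : Type u} [Field K] (S : ℕᵒᵖ ⥤ Over (Spec (.of K)))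
    (f : ℕ → RatFunc K) : Prop :=
  (∀ n, 1 < ratFuncDegree (f n)) ∧
  ∃ g : ℕ → (projSpace K 1 ⟶ projSpace K 1), (∀ n, IsGivenBy (g n) (f n)) ∧
    Nonempty (S ≅ Functor.ofOpSequence (X := fun _ => projSpace K 1) g)

end

/-! ### Local algebra: one-dimensional smooth local rings in characteristic zero -/

noncomputable section

open IsLocalRing KaehlerDifferential TensorProduct

/-! Genera lie in `ℕ∞`, so a limsup equal to zero means genus zero at every large level. By Lüroth's
theorem a curve dominated by a rational curve is rational. Hence rationality is needed only at large
levels and then spreads downwards (`IsSimpleTranscendental.of_surjective`). Proper curves whose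
local rings are valuation rings are governed by their function fields, so a rational curve is
isomorphic to ℙ¹. Choosing such an isomorphism at each level separately turns the tower into a tower
of rational functions (`IsCurveSystem.exists_isIsoToRationalTower`).

The function field F of a genus zero curve is studied through a closed point p, the ring S of
functions regular off p, and the local ring O at p. Vanishing of H¹ and Mayer–Vietoris give S + O =
F: every principal part at p is realised. Properness and geometric connectedness give S ∩ O = k.
After a finite extension M of k over which the residue field of p splits, there is a function with
one simple pole, and it generates M ⊗ F over M (`exists_transcendental_adjoin_eq_top`). If p is
rational, M = k suffices and the curve is ℙ¹; this is the first assertion, since a trivial point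
lifts to a rational point of every level. In general F is a form of M(x). Galois descent applied to
the global vector fields on the line then presents F as rational or as the function field of a conic
w² = a v² + b (`exists_sq_eq_of_isSimpleTranscendental`,
`isSimpleTranscendental_or_isConicFunctionField`).

For the second assertion, suppose that some large level is not rational. Then no higher level is
rational, and all of them are conics without rational points. Let the lowest one be given by (a, b)
and a higher one by (a', b'). The embedding of function fields makes the polynomial g = a'X² + b' a
value over k(X) of the ternary form ⟨a, b, -ab⟩, the form of pure quaternions. The Cassels–Pfister
argument makes it a value over k[X], by linear polynomials; so a' and b' are values of ⟨a, b, -ab⟩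
at two orthogonal vectors. A Gram determinant then converts any point of the first conic over an
extension L into a point of the second (`IsConicFunctionField.conicHasPoint_of_algHom`). One conic
therefore controls all levels from some point on (`IsCurveSystem.exists_conic`). It acquires the
point (t : 1) over K(√(at² + b)), and a suitable prime valuation shows that the values at² + b meet
infinitely many square classes (`infinite_setOf_conicHasPoint`). -/

/-- In a formally smooth local algebra over a field, elements of the maximal ideal whose differential
vanishes modulo the maximal ideal lie in the square of the maximal ideal. -/
lemma mem_maximalIdeal_sq_of_one_tmul_D_eq_zero {k O : Type*} [Field k] [CharZero k] [CommRing O] [IsLocalRing O]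
    [Algebra k O] [Algebra.FormallySmooth k O] [Algebra.EssFiniteType k O] {s : O}
    (hs : s ∈ maximalIdeal O) (h : (1 : ResidueField O) ⊗ₜ[O] D k O s = 0) :
    s ∈ maximalIdeal O ^ 2 := by
  have hsurj : Function.Surjective (algebraMap O (ResidueField O)) := residue_surjective
  have : Algebra.EssFiniteType k (ResidueField O) := Algebra.EssFiniteType.comp k O _
  -- In characteristic zero the residue field is formally smooth over k as well, so the conormal map
  -- 𝔪/𝔪² → κ ⊗ Ω has a retraction l. It recovers the class of s from its differential.
  obtain ⟨l, hl⟩ := (Algebra.FormallySmooth.iff_split_injection (R := k) (P := O)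
    (A := ResidueField O) hsurj).mp inferInstance
  have hker : RingHom.ker (algebraMap O (ResidueField O)) = maximalIdeal O := ker_residue
  have hs' : s ∈ RingHom.ker (algebraMap O (ResidueField O)) := hker ▸ hs
  have h1 := LinearMap.congr_fun hl (Ideal.toCotangent _ ⟨s, hs'⟩)
  rw [LinearMap.comp_apply, kerCotangentToTensor_toCotangent, h, map_zero, LinearMap.id_apply,
    eq_comm, Ideal.toCotangent_eq_zero] at h1
  exact hker ▸ h1

/-- Unless 𝔪 = 𝔪², where Nakayama gives a field, pick t in 𝔪 but not in 𝔪². Its differential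
generates the cyclic module Ω. Subtracting from s ∈ 𝔪 a multiple of t with the same differential
modulo 𝔪 lands in 𝔪², so 𝔪 = (t) by Nakayama. Since Ω is free, dt has no annihilator; thus t^(n+1) =
0 would give (n+1) t^n = 0, and descending in n shows that t is not nilpotent. By Krull's
intersection theorem each nonzero element is a power of t times a unit, so there are no zero
divisors. -/
lemma isPrincipal_maximalIdeal_and_isDomain_of_formallySmooth
    {k O : Type*} [Field k] [CharZero k] [CommRing O] [IsLocalRing O] [IsNoetherianRing O]
    [Algebra k O] [Algebra.FormallySmooth k O] [Algebra.EssFiniteType k O] (ω : Ω[O⁄k])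
    (hω : Submodule.span O {ω} = ⊤) :
    (maximalIdeal O).IsPrincipal ∧ IsDomain O := by
  by_cases hm : maximalIdeal O ≤ maximalIdeal O ^ 2
  · have h0 : maximalIdeal O = ⊥ := by
      refine Submodule.eq_bot_of_le_smul_of_le_jacobson_bot (maximalIdeal O) _
        (IsNoetherian.noetherian _) (by rwa [smul_eq_mul, ← sq]) (maximalIdeal_le_jacobson _)
    have hf : IsField O := isField_iff_maximalIdeal_eq.mpr h0
    exact ⟨h0 ▸ inferInstance, hf.isDomain⟩
  obtain ⟨t, ht, ht2⟩ := SetLike.not_le_iff_exists.mp hm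
  have hspan (x : Ω[O⁄k]) : ∃ a : O, a • ω = x :=
    Submodule.mem_span_singleton.mp (hω ▸ Submodule.mem_top)
  obtain ⟨b, hb⟩ := hspan (D k O t)
  have hbu : IsUnit b := by
    by_contra hbn
    refine ht2 (mem_maximalIdeal_sq_of_one_tmul_D_eq_zero (k := k) ht ?_)
    have : (b • (1 : ResidueField O)) = 0 := by
      rw [Algebra.smul_def, mul_one]
      exact (residue_eq_zero_iff b).mpr hbn
    rw [← hb, ← smul_tmul, this, zero_tmul]
  have hspan2 : maximalIdeal O = Ideal.span {t} := by
    refine le_antisymm ?_ ((Ideal.span_singleton_le_iff_mem _).mpr ht)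
    refine Submodule.le_of_le_smul_of_le_jacobson_bot (I := maximalIdeal O)
      (IsNoetherian.noetherian _) (maximalIdeal_le_jacobson _) ?_
    intro s hs
    obtain ⟨a, ha⟩ := hspan (D k O s)
    obtain ⟨c, hc⟩ := hbu.exists_right_inv
    have hst : s - a * c * t ∈ maximalIdeal O ^ 2 := by
      refine mem_maximalIdeal_sq_of_one_tmul_D_eq_zero (k := k)
        (Ideal.sub_mem _ hs (Ideal.mul_mem_left _ _ ht)) ?_
      have : D k O (s - a * c * t) = - (t • D k O (a * c)) := by
        rw [map_sub, Derivation.leibniz, ← ha, ← hb, smul_smul,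
          show a * c * b = a by linear_combination a * hc]
        abel
      have ht0 : (t • (1 : ResidueField O)) = 0 := by
        rw [Algebra.smul_def, mul_one]
        exact (residue_eq_zero_iff t).mpr ht
      rw [this, tmul_neg, ← smul_tmul, ht0, zero_tmul, neg_zero]
    have : s = a * c * t + (s - a * c * t) := by ring
    rw [this]
    refine Submodule.add_mem_sup (Ideal.mul_mem_left _ _ (Ideal.mem_span_singleton_self t)) ?_
    rwa [smul_eq_mul, ← sq]
  refine ⟨⟨t, hspan2⟩, ?_⟩
  -- `t` is not nilpotent
  have : Module.Projective O Ω[O⁄k] := Algebra.FormallySmooth.projective_kaehlerDifferential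
  have : Module.Finite O Ω[O⁄k] := ⟨⟨{ω}, by simpa using hω⟩⟩
  have : Module.Free O Ω[O⁄k] := Module.free_of_flat_of_isLocalRing
  have hne : D k O t ≠ 0 := by
    intro h
    exact ht2 (mem_maximalIdeal_sq_of_one_tmul_D_eq_zero (k := k) ht (by rw [h, tmul_zero]))
  have hann (x : O) (hx : x • D k O t = 0) : x = 0 := by
    have hall (y : Ω[O⁄k]) : x • y = 0 := by
      obtain ⟨a, rfl⟩ := hspan y
      obtain ⟨c, hc⟩ := hbu.exists_right_inv
      rw [show a • ω = (a * c) • D k O t by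
        rw [← hb, smul_smul, show a * c * b = a by linear_combination a * hc],
        smul_comm, hx, smul_zero]
    have : Nontrivial Ω[O⁄k] := ⟨⟨_, _, hne⟩⟩
    let B := Module.Free.chooseBasis O Ω[O⁄k]
    have : Nonempty (Module.Free.ChooseBasisIndex O Ω[O⁄k]) := B.index_nonempty
    let i : Module.Free.ChooseBasisIndex O Ω[O⁄k] := Classical.arbitrary _
    have h2 := congrArg (fun z => B.repr z i) (hall (B i))
    simpa using h2
  have hnil (n : ℕ) : t ^ n ≠ 0 := by
    have : Nontrivial O := inferInstance
    induction n with
    | zero => simp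
    | succ n ih =>
      intro h
      apply ih
      have h2 := congrArg (D k O) h
      rw [map_zero, Derivation.leibniz_pow, ← Nat.cast_smul_eq_nsmul O, smul_smul] at h2
      have h3 := hann _ h2
      simp only [add_tsub_cancel_right] at h3
      have hu : IsUnit (((n + 1 : ℕ) : O)) := by
        have := (IsUnit.mk0 ((n + 1 : ℕ) : k) (by exact_mod_cast n.succ_ne_zero)).map
          (algebraMap k O)
        rwa [map_natCast] at this
      exact (hu.mul_right_eq_zero).mp h3
  have hpow (x : O) (hx : x ≠ 0) : ∃ n u, IsUnit u ∧ x = t ^ n * u := by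
    have hx' : ∃ n, x ∉ maximalIdeal O ^ n := by
      by_contra! h
      apply hx
      have := Ideal.iInf_pow_eq_bot_of_isLocalRing (maximalIdeal O) (Ideal.IsPrime.ne_top inferInstance)
      rw [← Ideal.mem_bot, ← this, Ideal.mem_iInf]
      exact h
    classical
    let n := Nat.find hx'
    have hn : x ∉ maximalIdeal O ^ n := Nat.find_spec hx'
    have hn0 : n ≠ 0 := by
      intro h
      rw [h] at hn
      simp at hn
    obtain ⟨m, hm⟩ := Nat.exists_eq_succ_of_ne_zero hn0
    have hxm : x ∈ maximalIdeal O ^ m := by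
      by_contra h
      exact Nat.find_min hx' (m := m) (by omega) h
    rw [hspan2, Ideal.span_singleton_pow, Ideal.mem_span_singleton] at hxm
    obtain ⟨u, hu⟩ := hxm
    refine ⟨m, u, ?_, hu⟩
    by_contra hun
    have hum : u ∈ maximalIdeal O := hun
    apply hn
    rw [hm, hu, pow_succ]
    exact Ideal.mul_mem_mul (Ideal.pow_mem_pow ht _) hum
  have : NoZeroDivisors O := by
    refine ⟨fun {x y} hxy => ?_⟩
    by_contra! h
    obtain ⟨n, u, hu, rfl⟩ := hpow x h.1
    obtain ⟨m, v, hv, rfl⟩ := hpow y h.2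
    apply hnil (n + m)
    have : t ^ (n + m) * (u * v) = 0 := by rw [← hxy]; ring
    exact (hu.mul hv).mul_left_eq_zero.mp this
  exact NoZeroDivisors.to_isDomain O

/-- Local rings of smooth curves over a field of characteristic zero are valuation rings. -/
lemma isDomain_and_valuationRing_of_formallySmooth
    {k O : Type*} [Field k] [CharZero k] [CommRing O] [IsLocalRing O] [IsNoetherianRing O]
    [Algebra k O] [Algebra.FormallySmooth k O] [Algebra.EssFiniteType k O] (ω : Ω[O⁄k])
    (hω : Submodule.span O {ω} = ⊤) : ∃ _ : IsDomain O, IsPrincipalIdealRing O := by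
  obtain ⟨h1, h2⟩ := isPrincipal_maximalIdeal_and_isDomain_of_formallySmooth ω hω
  exact ⟨h2, ((tfae_of_isNoetherianRing_of_isLocalRing_of_isDomain O).out 4 0).mp h1⟩

end

/-! ### Smooth connected curves are integral with principal local rings -/

noncomputable section

open TopologicalSpace

/-- Around every point a smooth scheme of relative dimension one over a field has an affine neighbourhood that is
standard smooth of relative dimension one. -/
lemma exists_isStandardSmooth_scalarsToSections {k : Type u} [Field k] (X : Over (Spec (.of k)))
    (hX : SmoothOfRelativeDimension 1 X.hom) (x : X.left) :
    ∃ V : X.left.Opens, IsAffineOpen V ∧ x ∈ V ∧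
      (scalarsToSections X V).IsStandardSmoothOfRelativeDimension 1 := by
  obtain ⟨U, hU, V, hV, hx, e, h⟩ := hX.exists_isStandardSmoothOfRelativeDimension x
  have hUt : U = ⊤ := by
    refine top_le_iff.mp fun y _ => ?_
    have : X.hom x ∈ U := e hx
    rwa [Subsingleton.elim y (X.hom x)]
  subst hUt
  refine ⟨V, hV, hx, ?_⟩
  have h2 := (RingHom.isStandardSmoothOfRelativeDimension_respectsIso (n := 1)).2
    (X.hom.appLE ⊤ V e).hom (Scheme.ΓSpecIso (.of k)).symm.commRingCatIsoToRingEquiv h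
  exact h2

/-- On a standard smooth chart Ω is free of rank one. Formal smoothness and a generator of Ω both
survive localization at the point, so the local criterion above applies to the stalk. -/
lemma exists_isDomain_and_isPrincipalIdealRing_stalk {k : Type u} [Field k] [CharZero k] (X : Over (Spec (.of k)))
    (hX : SmoothOfRelativeDimension 1 X.hom) (x : X.left) :
    ∃ _ : IsDomain (X.left.presheaf.stalk x), IsPrincipalIdealRing (X.left.presheaf.stalk x) := by
  obtain ⟨V, hV, hx, h⟩ := exists_isStandardSmooth_scalarsToSections X hX x
  let : Algebra k Γ(X.left, V) := (scalarsToSections X V).toAlgebra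
  have hst : Algebra.IsStandardSmoothOfRelativeDimension 1 k Γ(X.left, V) := h
  have hss : Algebra.IsStandardSmooth k Γ(X.left, V) := hst.isStandardSmooth
  let : Algebra Γ(X.left, V) (X.left.presheaf.stalk x) :=
    TopCat.Presheaf.algebra_section_stalk X.left.presheaf ⟨x, hx⟩
  let : Algebra k (X.left.presheaf.stalk x) :=
    ((algebraMap Γ(X.left, V) (X.left.presheaf.stalk x)).comp (algebraMap k _)).toAlgebra
  have : IsScalarTower k Γ(X.left, V) (X.left.presheaf.stalk x) := .of_algebraMap_eq fun _ => rfl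
  have hloc : IsLocalization.AtPrime (X.left.presheaf.stalk x) (hV.primeIdealOf ⟨x, hx⟩).asIdeal :=
    hV.isLocalization_stalk ⟨x, hx⟩
  have : Nontrivial Γ(X.left, V) := (algebraMap Γ(X.left, V) (X.left.presheaf.stalk x)).domain_nontrivial
  have : Algebra.FormallyEtale Γ(X.left, V) (X.left.presheaf.stalk x) :=
    Algebra.FormallyEtale.of_isLocalization (hV.primeIdealOf ⟨x, hx⟩).asIdeal.primeCompl
  have : Algebra.Smooth k Γ(X.left, V) := inferInstance
  have : Algebra.FormallySmooth k (X.left.presheaf.stalk x) :=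
    Algebra.FormallySmooth.comp k Γ(X.left, V) _
  have : Algebra.EssFiniteType Γ(X.left, V) (X.left.presheaf.stalk x) :=
    Algebra.EssFiniteType.of_isLocalization _ (hV.primeIdealOf ⟨x, hx⟩).asIdeal.primeCompl
  have : Algebra.EssFiniteType k (X.left.presheaf.stalk x) :=
    Algebra.EssFiniteType.comp k Γ(X.left, V) _
  have : IsNoetherianRing Γ(X.left, V) := Algebra.FiniteType.isNoetherianRing k _
  have : IsNoetherianRing (X.left.presheaf.stalk x) :=
    IsLocalization.isNoetherianRing (hV.primeIdealOf ⟨x, hx⟩).asIdeal.primeCompl _ ‹_›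
  have hr : Module.rank Γ(X.left, V) (Ω[Γ(X.left, V)⁄k]) = 1 := by
    simpa using Algebra.IsStandardSmoothOfRelativeDimension.rank_kaehlerDifferential
      (R := k) (S := Γ(X.left, V)) 1
  obtain ⟨ω, hω⟩ : ∃ ω : Ω[Γ(X.left, V)⁄k], Submodule.span Γ(X.left, V) {ω} = ⊤ := by
    let B := Module.Free.chooseBasis Γ(X.left, V) (Ω[Γ(X.left, V)⁄k])
    have h1 : Cardinal.mk (Module.Free.ChooseBasisIndex Γ(X.left, V) (Ω[Γ(X.left, V)⁄k])) = 1 := by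
      rw [← hr, Module.Free.rank_eq_card_chooseBasisIndex]
    obtain ⟨h2, ⟨i⟩⟩ := Cardinal.eq_one_iff_unique.mp h1
    refine ⟨B i, ?_⟩
    rw [← B.span_eq]
    congr 1
    ext y
    constructor
    · rintro rfl
      exact ⟨i, rfl⟩
    · rintro ⟨j, rfl⟩
      rw [Subsingleton.elim j i]
      rfl
  refine isDomain_and_valuationRing_of_formallySmooth (k := k)
    (KaehlerDifferential.map k k Γ(X.left, V) (X.left.presheaf.stalk x) ω) ?_
  have h3 := KaehlerDifferential.span_range_map_derivation_of_isLocalization k Γ(X.left, V)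
    (X.left.presheaf.stalk x) (hV.primeIdealOf ⟨x, hx⟩).asIdeal.primeCompl
  rw [eq_top_iff, ← h3, Submodule.span_le]
  rintro _ ⟨y, rfl⟩
  obtain ⟨a, ha⟩ := Submodule.mem_span_singleton.mp (hω ▸ Submodule.mem_top : KaehlerDifferential.D k Γ(X.left, V) y ∈ _)
  simp only [Function.comp_apply]
  rw [← ha, map_smul]
  exact Submodule.mem_span_singleton.mpr ⟨algebraMap _ _ a, by rw [algebraMap_smul]⟩

/-- For a nonempty open U, the points with an irreducible open neighbourhood meeting U form a clopen
set, hence the whole space. Taking such a neighbourhood of a point of U' shows that U meets U'. -/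
lemma preirreducibleSpace_of_connectedSpace {α : Type*} [TopologicalSpace α] [ConnectedSpace α]
    (h : ∀ x : α, ∃ V : Set α, IsOpen V ∧ x ∈ V ∧ IsPreirreducible V) : PreirreducibleSpace α := by
  refine ⟨fun U U' hU hU' => ?_⟩
  rintro ⟨a, -, ha⟩ ⟨b, -, hb⟩
  let A : Set α := {x | ∃ V : Set α, IsOpen V ∧ x ∈ V ∧ IsPreirreducible V ∧ (V ∩ U).Nonempty}
  have hA : IsClopen A := by
    constructor
    · rw [← isOpen_compl_iff, isOpen_iff_forall_mem_open]
      intro x hx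
      obtain ⟨V, hV, hxV, hirr⟩ := h x
      refine ⟨V, fun y hy => ?_, hV, hxV⟩
      rintro ⟨V', hV', hyV', hirr', hne⟩
      obtain ⟨z, hz, hz1, hz2⟩ := hirr' V U hV hU ⟨y, hyV', hy⟩ hne
      exact hx ⟨V, hV, hxV, hirr, z, hz1, hz2⟩
    · rw [isOpen_iff_forall_mem_open]
      rintro x ⟨V, hV, hxV, hirr, hne⟩
      exact ⟨V, fun y hy => ⟨V, hV, hy, hirr, hne⟩, hV, hxV⟩
  have hAu : A = Set.univ := hA.eq_univ (by
    obtain ⟨V, hV, hxV, hirr⟩ := h a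
    exact ⟨a, V, hV, hxV, hirr, a, hxV, ha⟩)
  obtain ⟨V, hV, hxV, hirr, hne⟩ : b ∈ A := hAu ▸ Set.mem_univ b
  obtain ⟨z, -, hz⟩ := hirr U U' hU hU' hne ⟨b, hxV, hb⟩
  exact ⟨z, Set.mem_univ z, hz⟩

/-- The noetherian hypothesis supplies around each point an affine open whose sections inject into
the stalk. Its coordinate ring is therefore a domain and the open set is irreducible; connectedness
makes local irreducibility global. -/
lemma isIntegral_of_isDomain_stalk (X : Scheme.{u}) [IsLocallyNoetherian X] [ConnectedSpace X]
    (h : ∀ x : X, IsDomain (X.presheaf.stalk x)) : IsIntegral X := by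
  have : IsReduced X := by
    have (x : X) : _root_.IsReduced (X.presheaf.stalk x) := inferInstance
    exact isReduced_of_isReduced_stalk X
  have : PreirreducibleSpace X := by
    refine preirreducibleSpace_of_connectedSpace fun x => ?_
    obtain ⟨U, hxU, hU, hinj⟩ := X.exists_germ_injective x
    refine ⟨U, U.2, hxU, ?_⟩
    have : IsDomain Γ(X, U) := hinj.isDomain (X.presheaf.germ U x hxU).hom
    have : IsIntegral (Spec Γ(X, U)) := inferInstance
    have h2 : IsIrreducible (Set.range hU.fromSpec) := by
      rw [← Set.image_univ]
      exact (IrreducibleSpace.isIrreducible_univ _).image _ hU.fromSpec.continuous.continuousOn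
    rw [hU.range_fromSpec] at h2
    exact h2.isPreirreducible
  have : IrreducibleSpace X := { toNonempty := inferInstance }
  exact isIntegral_of_irreducibleSpace_of_isReduced X

/-- Proper smooth geometrically connected curves over a field. -/
class IsProperCurve {k : Type u} [Field k] (X : Over (Spec (.of k))) : Prop where
  isProper : IsProper X.hom
  smooth : SmoothOfRelativeDimension 1 X.hom
  geometricallyConnected : GeometricallyConnected X.hom

attribute [instance] IsProperCurve.isProper IsProperCurve.geometricallyConnected

section

variable {k : Type u} [Field k] (X : Over (Spec (.of k))) [IsProperCurve X]

instance : IsLocallyNoetherian X.left := LocallyOfFiniteType.isLocallyNoetherian X.hom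

instance : ConnectedSpace X.left := GeometricallyConnected.connectedSpace_of_subsingleton X.hom

instance [CharZero k] : IsIntegral X.left :=
  isIntegral_of_isDomain_stalk X.left fun x =>
    (exists_isDomain_and_isPrincipalIdealRing_stalk X IsProperCurve.smooth x).1

instance isPrincipalIdealRing_stalk [CharZero k] (x : X.left) :
    IsPrincipalIdealRing (X.left.presheaf.stalk x) :=
  (exists_isDomain_and_isPrincipalIdealRing_stalk X IsProperCurve.smooth x).2

end

lemma polyGrading_zero_algebraMap_bijective (K : Type u) [Field K] (n : ℕ) :
    Function.Bijective (algebraMap K (polyGrading K n 0)) := by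
  refine ⟨fun a b h => MvPolynomial.C_injective (Fin (n + 1)) K (congrArg Subtype.val h),
    fun ⟨p, hp⟩ => ?_⟩
  have hp' := MvPolynomial.totalDegree_eq_zero_iff_eq_C.mp
    ((MvPolynomial.totalDegree_zero_iff_isHomogeneous _).mpr hp)
  exact ⟨_, Subtype.ext hp'.symm⟩

lemma isProper_projSpace (K : Type u) [Field K] (n : ℕ) : IsProper (projSpace K n).hom := by
  have hbij := polyGrading_zero_algebraMap_bijective K n
  have : IsScalarTower K (polyGrading K n 0) (MvPolynomial (Fin (n + 1)) K) :=
    ⟨fun a b c => smul_assoc a (b : MvPolynomial (Fin (n + 1)) K) c⟩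
  have : Algebra.FiniteType (polyGrading K n 0) (MvPolynomial (Fin (n + 1)) K) :=
    Algebra.FiniteType.of_restrictScalars_finiteType K _ _
  have : IsIso (CommRingCat.ofHom (algebraMap K (polyGrading K n 0))) :=
    (ConcreteCategory.isIso_iff_bijective _).mpr hbij
  change IsProper (Proj.toSpecZero (polyGrading K n) ≫
    Spec.map (CommRingCat.ofHom (algebraMap K (polyGrading K n 0))))
  infer_instance

lemma IsSmoothProjectiveCurve.isProperCurve {K : Type u} [Field K] {C : Over (Spec (.of K))}
    (hC : IsSmoothProjectiveCurve C) : IsProperCurve C := by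
  obtain ⟨n, i, hi⟩ := hC.projective
  have := isProper_projSpace K n
  refine ⟨?_, hC.smooth, hC.geometricallyConnected⟩
  rw [← Over.w i]
  infer_instance

instance {K L : Type u} [Field K] [Field L] [Algebra K L] (X : Over (Spec (.of K)))
    [IsProperCurve X] : IsProperCurve
      ((Over.pullback (Spec.map (CommRingCat.ofHom (algebraMap K L)))).obj X) where
  isProper := inferInstanceAs (IsProper (Limits.pullback.snd _ _))
  smooth :=
    have := smoothOfRelativeDimension_isStableUnderBaseChange.{u} 1
    MorphismProperty.of_isPullback (P := @SmoothOfRelativeDimension 1)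
      (IsPullback.of_hasPullback X.hom (Spec.map (CommRingCat.ofHom (algebraMap K L))))
      IsProperCurve.smooth
  geometricallyConnected := inferInstanceAs (GeometricallyConnected (Limits.pullback.snd _ _))

end

noncomputable section

open TensorProduct

/-! ### Function fields of curves and their base change -/

/-- Fields of fractions commute with finite extensions of scalars, as long as these stay domains. -/
lemma exists_algEquiv_tensorProduct_of_isFractionRing {K L A F F' : Type*} [Field K] [Field L]
    [Algebra K L] [FiniteDimensional K L] [CommRing A] [Algebra K A] [Field F] [Algebra A F]
    [IsFractionRing A F] [Algebra K F] [IsScalarTower K A F] [Field F'] [Algebra K F'] [Algebra L F']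
    [IsScalarTower K L F'] (ι : F →ₐ[K] F')
    (hinj : Function.Injective (Algebra.TensorProduct.lift (Algebra.ofId L F')
      (ι.comp (IsScalarTower.toAlgHom K A F)) fun _ _ => .all _ _))
    (hfrac : ∀ y : F', ∃ b c : L ⊗[K] A,
      Algebra.TensorProduct.lift (Algebra.ofId L F')
        (ι.comp (IsScalarTower.toAlgHom K A F)) (fun _ _ => .all _ _) c ≠ 0 ∧
      y * Algebra.TensorProduct.lift (Algebra.ofId L F')
        (ι.comp (IsScalarTower.toAlgHom K A F)) (fun _ _ => .all _ _) c =
      Algebra.TensorProduct.lift (Algebra.ofId L F')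
        (ι.comp (IsScalarTower.toAlgHom K A F)) (fun _ _ => .all _ _) b) :
    ∃ e : L ⊗[K] F ≃ₐ[L] F', ∀ x, e (1 ⊗ₜ x) = ι x := by
  set Φ := Algebra.TensorProduct.lift (Algebra.ofId L F') ι fun _ _ => .all _ _ with hΦ
  set ΦA := Algebra.TensorProduct.lift (Algebra.ofId L F')
      (ι.comp (IsScalarTower.toAlgHom K A F)) fun _ _ => .all _ _ with hΦA
  have hcomp (z : L ⊗[K] A) : Φ (Algebra.TensorProduct.map (AlgHom.id L L)
      (IsScalarTower.toAlgHom K A F) z) = ΦA z := by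
    induction z with
    | zero => simp
    | tmul x y => simp [hΦ, hΦA]
    | add x y hx hy => simp only [map_add, hx, hy]
  have : IsDomain A := (IsFractionRing.injective A F).isDomain (algebraMap A F)
  -- A tensor is a finite sum, so its F-components have a common denominator in A. This reduces
  -- injectivity on L ⊗ F to injectivity on L ⊗ A.
  have hden (z : L ⊗[K] F) : ∃ a : A, a ≠ 0 ∧ ∃ w : L ⊗[K] A,
      (1 ⊗ₜ algebraMap A F a) * z = Algebra.TensorProduct.map (AlgHom.id L L)
      (IsScalarTower.toAlgHom K A F) w := by
    induction z with
    | zero => exact ⟨1, one_ne_zero, 0, by simp⟩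
    | tmul x y =>
      obtain ⟨n, d, hd, rfl⟩ := IsFractionRing.div_surjective (A := A) y
      have hd0 := nonZeroDivisors.ne_zero hd
      refine ⟨d, hd0, x ⊗ₜ n, ?_⟩
      have : algebraMap A F d ≠ 0 := by simpa using hd0
      simp [mul_div_cancel₀ _ this]
    | add x y hx hy =>
      obtain ⟨a, ha, w, hw⟩ := hx
      obtain ⟨b, hb, v, hv⟩ := hy
      refine ⟨a * b, mul_ne_zero ha hb, (1 ⊗ₜ b) * w + (1 ⊗ₜ a) * v, ?_⟩
      rw [map_add, map_mul _ _ w, map_mul _ _ v, ← hw, ← hv]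
      have : (1 : L) ⊗ₜ[K] algebraMap A F (a * b) =
          (1 ⊗ₜ[K] algebraMap A F a) * (1 ⊗ₜ[K] algebraMap A F b) := by
        simp
      rw [this]
      simp only [Algebra.TensorProduct.map_tmul, map_one, IsScalarTower.coe_toAlgHom']
      ring
  have hΦinj : Function.Injective Φ := by
    rw [injective_iff_map_eq_zero]
    intro z hz
    obtain ⟨a, ha, w, hw⟩ := hden z
    have h1 : ΦA w = 0 := by rw [← hcomp, ← hw, map_mul, hz, mul_zero]
    rw [(map_eq_zero_iff _ hinj).mp h1, map_zero] at hw
    have ha' : algebraMap A F a ≠ 0 := by simpa using ha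
    have h2 : ((1 : L) ⊗ₜ[K] (algebraMap A F a)⁻¹) * ((1 ⊗ₜ algebraMap A F a) * z) = z := by
      rw [← mul_assoc, Algebra.TensorProduct.tmul_mul_tmul, inv_mul_cancel₀ ha', mul_one,
        ← Algebra.TensorProduct.one_def, one_mul]
    rw [← h2, hw, mul_zero]
  have hdom : IsDomain (L ⊗[K] F) := hΦinj.isDomain Φ.toRingHom
  -- Since L is finite over K, L ⊗ F is integral over the field F; being a domain, it is a field.
  -- The denominators c in `hfrac` are therefore invertible already before mapping to F', which
  -- gives surjectivity.
  let : Algebra F (L ⊗[K] F) := Algebra.TensorProduct.rightAlgebra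
  have : Algebra.IsIntegral F (L ⊗[K] F) := by
    refine ⟨fun z => ?_⟩
    induction z with
    | zero => exact isIntegral_zero
    | tmul x y =>
      have h1 : IsIntegral F ((x : L) ⊗ₜ[K] (1 : F)) :=
        ((Algebra.IsIntegral.isIntegral (R := K) x).map
          (Algebra.TensorProduct.includeLeft : L →ₐ[K] L ⊗[K] F)).tower_top
      have h2 : IsIntegral F ((1 : L) ⊗ₜ[K] y) :=
        isIntegral_algebraMap (R := F) (A := L ⊗[K] F) (x := y)
      simpa using h1.mul h2
    | add x y hx hy => exact hx.add hy
  have hfield : IsField (L ⊗[K] F) :=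
    isField_of_isIntegral_of_isField' (Field.toIsField F)
  refine ⟨AlgEquiv.ofBijective Φ ⟨hΦinj, fun y => ?_⟩, fun x => by simp [hΦ]⟩
  obtain ⟨b, c, hc, hy⟩ := hfrac y
  rw [← hcomp, ← hcomp] at hy
  rw [← hcomp] at hc
  obtain ⟨d, hd⟩ := hfield.mul_inv_cancel (a := Algebra.TensorProduct.map (AlgHom.id L L)
    (IsScalarTower.toAlgHom K A F) c) (fun h => hc (by rw [h, map_zero]))
  refine ⟨Algebra.TensorProduct.map (AlgHom.id L L) (IsScalarTower.toAlgHom K A F) b * d, ?_⟩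
  change Φ _ = y
  rw [map_mul, ← hy, mul_assoc, ← map_mul, hd, map_one, mul_one]

section

variable {k : Type u} [Field k]

instance functionFieldAlgebra (X : Over (Spec (.of k))) [IrreducibleSpace X.left] :
    Algebra k X.left.functionField :=
  ((X.left.presheaf.germ ⊤ (genericPoint X.left) (TopologicalSpace.Opens.mem_top _)).hom.comp
    (scalarsToSections X ⊤)).toAlgebra

lemma germ_scalarsToSections (X : Over (Spec (.of k))) [IrreducibleSpace X.left]
    (V : X.left.Opens) (hV : genericPoint X.left ∈ V) (a : k) :
    X.left.presheaf.germ V (genericPoint X.left) hV (scalarsToSections X V a) =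
      algebraMap k X.left.functionField a := by
  rw [← map_scalarsToSections X (homOfLE (le_top : V ≤ ⊤)),
    X.left.presheaf.germ_res_apply]
  rfl

lemma app_scalarsToSections {X Y : Over (Spec (.of k))} (φ : X ⟶ Y) (V : Y.left.Opens) (a : k) :
    φ.left.app V (scalarsToSections Y V a) = scalarsToSections X (φ.left ⁻¹ᵁ V) a := by
  simp only [scalarsToSections, ← Over.w φ, CommRingCat.hom_comp, RingHom.comp_apply,
    Scheme.Hom.comp_appTop]
  rw [← ConcreteCategory.comp_apply, φ.left.naturality, ConcreteCategory.comp_apply]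
  rfl

/-- The map on function fields induced by a dominant morphism. -/
def functionFieldMap {X Y : Over (Spec (.of k))} [IrreducibleSpace X.left] [IrreducibleSpace Y.left]
    (φ : X ⟶ Y) (h : φ.left (genericPoint X.left) = genericPoint Y.left) :
    Y.left.functionField →ₐ[k] X.left.functionField where
  __ := (Y.left.presheaf.stalkSpecializes (specializes_of_eq h) ≫
      φ.left.stalkMap (genericPoint X.left)).hom
  commutes' a := by
    rw [← germ_scalarsToSections Y ⊤ (TopologicalSpace.Opens.mem_top _),
      ← germ_scalarsToSections X (φ.left ⁻¹ᵁ ⊤) (TopologicalSpace.Opens.mem_top _),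
      ← app_scalarsToSections]
    change (Y.left.presheaf.germ ⊤ _ _ ≫ Y.left.presheaf.stalkSpecializes _ ≫
      φ.left.stalkMap _) _ = _
    rw [TopCat.Presheaf.germ_stalkSpecializes_assoc, Scheme.Hom.germ_stalkMap]
    rfl

lemma functionFieldMap_germ {X Y : Over (Spec (.of k))} [IrreducibleSpace X.left]
    [IrreducibleSpace Y.left] (φ : X ⟶ Y) (h : φ.left (genericPoint X.left) = genericPoint Y.left)
    (V : Y.left.Opens) (hV : genericPoint Y.left ∈ V) (s : Γ(Y.left, V)) :
    functionFieldMap φ h (Y.left.presheaf.germ V _ hV s) =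
      X.left.presheaf.germ (φ.left ⁻¹ᵁ V) (genericPoint X.left)
        (by change φ.left _ ∈ V; rwa [h]) (φ.left.app V s) := by
  change (Y.left.presheaf.germ V _ _ ≫ Y.left.presheaf.stalkSpecializes _ ≫
    φ.left.stalkMap _) _ = _
  rw [TopCat.Presheaf.germ_stalkSpecializes_assoc, Scheme.Hom.germ_stalkMap]
  rfl

end

end

/-! ### Base change of a curve and of its function field -/

noncomputable section

open TensorProduct

lemma genericPoint_map_eq_of_denseRange {α β : Type*} [TopologicalSpace α] [TopologicalSpace β]
    [QuasiSober α] [IrreducibleSpace α] [QuasiSober β] [IrreducibleSpace β] [T0Space β] (f : α → β)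
    (hf : Continuous f) (hd : DenseRange f) :
    f (genericPoint α) = genericPoint β := by
  refine IsGenericPoint.eq ?_ (genericPoint_spec β)
  have h := (genericPoint_spec α).image hf
  rwa [Set.image_univ, hd.closure_range] at h

section BaseChange

variable {K L : Type u} [Field K] [Field L] [Algebra K L]

/-- The base change of a scheme over `K` to an extension `L`. -/
abbrev baseChangeObj (L : Type u) [Field L] [Algebra K L] (X : Over (Spec (.of K))) :
    Over (Spec (.of L)) :=
  (Over.pullback (Spec.map (CommRingCat.ofHom (algebraMap K L)))).obj X

variable (X : Over (Spec (.of K)))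

/-- The projection from the base change, as a morphism of schemes over `K`. -/
def baseChangeFst : (Over.map (Spec.map (CommRingCat.ofHom (algebraMap K L)))).obj
    (baseChangeObj L X) ⟶ X :=
  (Over.mapPullbackAdj (Spec.map (CommRingCat.ofHom (algebraMap K L)))).counit.app X

lemma isPullback_baseChange : IsPullback (baseChangeFst (L := L) X).left (baseChangeObj L X).hom
    X.hom (Spec.map (CommRingCat.ofHom (algebraMap K L))) := by
  have : (baseChangeFst (L := L) X).left = Limits.pullback.fst _ _ := by
    simp [baseChangeFst]
  rw [this]
  exact IsPullback.of_hasPullback X.hom (Spec.map (CommRingCat.ofHom (algebraMap K L)))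

lemma scalarsToSections_map (Y : Over (Spec (.of L))) (V : Y.left.Opens) (a : K) :
    scalarsToSections ((Over.map (Spec.map (CommRingCat.ofHom (algebraMap K L)))).obj Y) V a =
      scalarsToSections Y V (algebraMap K L a) := by
  change Y.left.presheaf.map _ ((Y.hom ≫ Spec.map (CommRingCat.ofHom (algebraMap K L))).appTop
    ((Scheme.ΓSpecIso (.of K)).inv a)) =
    Y.left.presheaf.map _ (Y.hom.appTop ((Scheme.ΓSpecIso (.of L)).inv (algebraMap K L a)))
  congr 1
  rw [Scheme.Hom.comp_appTop, ConcreteCategory.comp_apply]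
  congr 1
  exact (congr($(Scheme.ΓSpecIso_inv_naturality (CommRingCat.ofHom (algebraMap K L))) a)).symm

set_option maxHeartbeats 1000000 in
lemma isPushout_baseChange (V : X.left.Opens) (hV : IsAffineOpen V) :
    IsPushout (CommRingCat.ofHom (algebraMap K L)) (CommRingCat.ofHom (scalarsToSections X V))
      (CommRingCat.ofHom (scalarsToSections (baseChangeObj L X)
        ((baseChangeFst (L := L) X).left ⁻¹ᵁ V)))
      ((baseChangeFst (L := L) X).left.app V) := by
  have h1 := (isIso_pushoutSection_iff (isPullback_baseChange (L := L) X) (US := ⊤) (UT := ⊤) le_top le_top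
    (UX := V) (UY := (baseChangeFst (L := L) X).left ⁻¹ᵁ V) (by simp)).mp
    (isIso_pushoutSection_of_isAffineOpen _ _ _ _ (isAffineOpen_top _) (isAffineOpen_top _) hV)
  refine h1.flip.of_iso (Scheme.ΓSpecIso (.of K)) (Scheme.ΓSpecIso (.of L)) (Iso.refl _) (Iso.refl _)
    ?_ ?_ ?_ ?_
  · exact (congrArg (· ≫ (Scheme.ΓSpecIso (CommRingCat.of L)).hom) (Scheme.Hom.appLE_eq_app
      (f := Spec.map (CommRingCat.ofHom (algebraMap K L))) (U := ⊤))).trans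
      (Scheme.ΓSpecIso_naturality (CommRingCat.ofHom (algebraMap K L)))
  · have : CommRingCat.ofHom (scalarsToSections X V) = (Scheme.ΓSpecIso (.of K)).inv ≫
      X.hom.appTop ≫ X.left.presheaf.map (homOfLE (le_top : V ≤ ⊤)).op := rfl
    rw [this, Iso.hom_inv_id_assoc]
    simp [Scheme.Hom.appLE]
  · have : CommRingCat.ofHom (scalarsToSections (baseChangeObj L X)
        ((baseChangeFst (L := L) X).left ⁻¹ᵁ V)) = (Scheme.ΓSpecIso (.of L)).inv ≫
      (baseChangeObj L X).hom.appTop ≫ (baseChangeObj L X).left.presheaf.map (homOfLE le_top).op := rfl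
    rw [this, Iso.hom_inv_id_assoc]
    exact (Category.comp_id _)
  · rw [Scheme.Hom.appLE_eq_app]
    simp

lemma genericPoint_baseChangeFst [IrreducibleSpace X.left] [IrreducibleSpace (baseChangeObj L X).left] :
    (baseChangeFst (L := L) X).left (genericPoint (baseChangeObj L X).left) =
      genericPoint X.left := by
  have h : Surjective (baseChangeFst (L := L) X).left :=
    MorphismProperty.of_isPullback (P := @Surjective) (isPullback_baseChange (L := L) X).flip
      inferInstance
  exact genericPoint_map_eq_of_denseRange _ (baseChangeFst (L := L) X).left.continuous
    h.surj.denseRange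

set_option maxHeartbeats 2000000 in
/-- The function field of the base change of a curve to a finite extension is obtained by extension
of scalars. -/
lemma nonempty_algEquiv_functionField_baseChange [FiniteDimensional K L]
    [IsIntegral X.left] [IsIntegral (baseChangeObj L X).left] :
    Nonempty (L ⊗[K] X.left.functionField ≃ₐ[L] (baseChangeObj L X).left.functionField) := by
  let p := baseChangeFst (L := L) X
  have : IrreducibleSpace ((Over.map (Spec.map (CommRingCat.ofHom (algebraMap K L)))).obj
    (baseChangeObj L X)).left := inferInstanceAs (IrreducibleSpace (baseChangeObj L X).left)
  have hp : p.left (genericPoint (baseChangeObj L X).left) = genericPoint X.left :=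
    genericPoint_baseChangeFst X
  let F' := (baseChangeObj L X).left.functionField
  let : Algebra K F' := functionFieldAlgebra ((Over.map (Spec.map (CommRingCat.ofHom (algebraMap K L)))).obj
    (baseChangeObj L X))
  have : IsScalarTower K L F' := by
    refine .of_algebraMap_eq fun a => ?_
    exact congrArg ((baseChangeObj L X).left.presheaf.germ ⊤ (genericPoint _)
      (TopologicalSpace.Opens.mem_top _)) (scalarsToSections_map (baseChangeObj L X) ⊤ a)
  let ι : X.left.functionField →ₐ[K] F' := functionFieldMap p hp
  obtain ⟨_, ⟨V, hV, rfl⟩, hξV, -⟩ := X.left.isBasis_affineOpens.exists_subset_of_mem_open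
    (Set.mem_univ (genericPoint X.left)) isOpen_univ
  have hne : Nonempty V := ⟨⟨_, hξV⟩⟩
  let V' : (baseChangeObj L X).left.Opens := p.left ⁻¹ᵁ V
  have hξV' : genericPoint (baseChangeObj L X).left ∈ V' := by
    change p.left _ ∈ V
    rwa [hp]
  have hne' : Nonempty V' := ⟨⟨_, hξV'⟩⟩
  have haff : IsAffineHom p.left :=
    MorphismProperty.of_isPullback (P := @IsAffineHom) (isPullback_baseChange (L := L) X).flip
      inferInstance
  have hV' : IsAffineOpen V' := hV.preimage p.left
  have hfr := functionField_isFractionRing_of_isAffineOpen X.left V hV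
  have hfr' := functionField_isFractionRing_of_isAffineOpen (baseChangeObj L X).left V' hV'
  let : Algebra K Γ(X.left, V) := (scalarsToSections X V).toAlgebra
  have : IsScalarTower K Γ(X.left, V) X.left.functionField :=
    .of_algebraMap_eq fun a => (germ_scalarsToSections X V hξV a).symm
  let : Algebra L Γ((baseChangeObj L X).left, V') := (scalarsToSections _ V').toAlgebra
  let : Algebra K Γ((baseChangeObj L X).left, V') :=
    ((algebraMap L Γ((baseChangeObj L X).left, V')).comp (algebraMap K L)).toAlgebra
  let : Algebra Γ(X.left, V) Γ((baseChangeObj L X).left, V') := (p.left.app V).hom.toAlgebra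
  have : IsScalarTower K L Γ((baseChangeObj L X).left, V') := .of_algebraMap_eq fun _ => rfl
  have hpush := isPushout_baseChange (L := L) X V hV
  have : IsScalarTower K Γ(X.left, V) Γ((baseChangeObj L X).left, V') :=
    .of_algebraMap_eq fun a => congr($(hpush.w) a)
  have hpush' : Algebra.IsPushout K L Γ(X.left, V) Γ((baseChangeObj L X).left, V') :=
    CommRingCat.isPushout_iff_isPushout.mp hpush
  let e := Algebra.IsPushout.equiv K L Γ(X.left, V) Γ((baseChangeObj L X).left, V')
  -- Over an affine open V the comparison map is the isomorphism L ⊗ Γ(V) ≅ Γ(V') followed by Γ(V')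
  -- → F'. As F' is the fraction field of Γ(V'), both hypotheses of the algebraic lemma follow.
  have he (z : L ⊗[K] Γ(X.left, V)) : Algebra.TensorProduct.lift (Algebra.ofId L F')
      (ι.comp (IsScalarTower.toAlgHom K Γ(X.left, V) X.left.functionField)) (fun _ _ => .all _ _) z =
      algebraMap Γ((baseChangeObj L X).left, V') F' (e z) := by
    induction z with
    | zero => simp
    | add x y hx hy => rw [map_add, map_add, map_add, hx, hy]
    | tmul l a =>
      rw [Algebra.TensorProduct.lift_tmul, Algebra.IsPushout.equiv_tmul, map_mul]
      congr 1
      · exact (germ_scalarsToSections (baseChangeObj L X) V' hξV' l).symm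
      · exact functionFieldMap_germ p hp V hξV a
  obtain ⟨E, -⟩ := exists_algEquiv_tensorProduct_of_isFractionRing (A := Γ(X.left, V)) ι
    (by
      intro z w hzw
      rw [he, he] at hzw
      exact e.injective (IsFractionRing.injective _ _ hzw))
    (fun y => by
      obtain ⟨n, d, hd, rfl⟩ := IsFractionRing.div_surjective (A := Γ((baseChangeObj L X).left, V')) y
      have hd' : algebraMap Γ((baseChangeObj L X).left, V') F' d ≠ 0 :=
        IsFractionRing.to_map_ne_zero_of_mem_nonZeroDivisors hd
      refine ⟨e.symm n, e.symm d, ?_, ?_⟩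
      · rw [he, e.apply_symm_apply]
        exact hd'
      · rw [he, he, e.apply_symm_apply, e.apply_symm_apply]
        exact div_mul_cancel₀ _ hd')
  exact ⟨E⟩

end BaseChange

end

noncomputable section

/-! ### Curves and their function fields -/

lemma fromSpecStalkOfMem_specializes {X : Scheme.{u}} (U : X.Opens) {x y : X} (h : x ⤳ y)
    (hx : x ∈ U) (hy : y ∈ U) :
    Spec.map (X.presheaf.stalkSpecializes h) ≫ U.fromSpecStalkOfMem y hy =
      U.fromSpecStalkOfMem x hx := by
  rw [← cancel_mono U.ι, Category.assoc, Scheme.Opens.fromSpecStalkOfMem_ι,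
    Scheme.Opens.fromSpecStalkOfMem_ι, Scheme.SpecMap_stalkSpecializes_fromSpecStalk]

instance isDominant_fromSpecStalk_genericPoint (X : Scheme.{u}) [IrreducibleSpace X] :
    IsDominant (X.fromSpecStalk (genericPoint X)) := by
  refine ⟨?_⟩
  rw [DenseRange, dense_iff_closure_eq, ← Set.univ_subset_iff]
  refine (genericPoint_spec X).symm.subset.trans ?_
  refine closure_mono (Set.singleton_subset_iff.mpr ?_)
  exact ⟨_, Scheme.fromSpecStalk_closedPoint⟩

/-- A rational map from a scheme whose local rings are valuation rings to a proper scheme is a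
morphism. -/
lemma exists_hom_of_valuationRing_stalk {X Y S : Scheme.{u}} [IsIntegral X]
    (hX : ∀ x : X, ValuationRing (X.presheaf.stalk x)) (sX : X ⟶ S) (sY : Y ⟶ S) [IsProper sY]
    [Y.IsSeparated]
    (g : Spec X.functionField ⟶ Y) (hg : g ≫ sY = X.fromSpecStalk _ ≫ sX) :
    ∃ φ : X ⟶ Y, X.fromSpecStalk (genericPoint X) ≫ φ = g := by
  let f : X ⤏ Y := .ofFunctionField sX sY g hg
  have hf : f.fromFunctionField = g := Scheme.RationalMap.fromFunctionField_ofFunctionField _ _ _ _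
  -- At each point x the valuative criterion for the valuation ring 𝒪_{X,x} in the function field
  -- extends g to Spec 𝒪_{X,x}. That extension spreads out to a neighbourhood of x and agrees with f
  -- generically.
  have hdom : f.domain = ⊤ := by
    refine top_unique fun x _ => ?_
    have : IsDomain (X.presheaf.stalk x) := inferInstance
    have := hX x
    have hv : ValuativeCriterion sY := by
      have : IsProper sY := inferInstance
      rw [IsProper.eq_valuativeCriterion] at this
      exact this.1.1.1
    have hsq : CommSq g (Spec.map (CommRingCat.ofHom
        (algebraMap (X.presheaf.stalk x) X.functionField))) sY (X.fromSpecStalk x ≫ sX) := by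
      refine ⟨?_⟩
      rw [hg, ← Scheme.SpecMap_stalkSpecializes_fromSpecStalk (genericPoint_specializes x),
        Category.assoc]
      rfl
    have hl := hv.existence
      (@ValuativeCommSq.mk _ _ sY (X.presheaf.stalk x) _ inferInstance this X.functionField _ _ _
        g (X.fromSpecStalk x ≫ sX) hsq)
    obtain ⟨l, hl1, hl2⟩ : ∃ l : Spec (X.presheaf.stalk x) ⟶ Y,
        Spec.map (X.presheaf.stalkSpecializes (genericPoint_specializes x)) ≫ l = g ∧
        l ≫ sY = X.fromSpecStalk x ≫ sX := by
      obtain ⟨l, hl1, hl2⟩ := hl.exists_lift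
      exact ⟨l, hl1, hl2⟩
    refine Scheme.RationalMap.mem_domain.mpr ⟨.ofFromSpecStalk sX sY l hl2,
      Scheme.PartialMap.mem_domain_ofFromSpecStalk _ _ _ _, ?_⟩
    apply Scheme.RationalMap.eq_of_fromFunctionField_eq
    rw [hf, Scheme.RationalMap.fromFunctionField_toRationalMap]
    have h1 := Scheme.PartialMap.fromSpecStalkOfMem_ofFromSpecStalk sX sY l hl2
    rw [← hl1]
    conv_rhs => rw [← h1]
    rw [Scheme.PartialMap.fromFunctionField, Scheme.PartialMap.fromSpecStalkOfMem,
      Scheme.PartialMap.fromSpecStalkOfMem, ← fromSpecStalkOfMem_specializes _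
        (genericPoint_specializes x) _ (Scheme.PartialMap.mem_domain_ofFromSpecStalk _ _ _ _),
      Category.assoc]
  let p := f.toPartialMap
  have hp : p.domain = ⊤ := hdom
  have hpf : p.fromFunctionField = g := by
    rw [← Scheme.RationalMap.fromFunctionField_toRationalMap,
      Scheme.RationalMap.toRationalMap_toPartialMap, hf]
  refine ⟨(X.topIso.inv ≫ (X.isoOfEq hp).inv) ≫ p.hom, ?_⟩
  rw [← hpf, Scheme.PartialMap.fromFunctionField, Scheme.PartialMap.fromSpecStalkOfMem,
    ← Category.assoc]
  congr 1
  rw [← cancel_mono p.domain.ι]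
  simp

section

variable {k : Type u} [Field k]

lemma fromSpecStalk_hom (X : Over (Spec (.of k))) [IrreducibleSpace X.left] :
    X.left.fromSpecStalk (genericPoint X.left) ≫ X.hom =
      Spec.map (CommRingCat.ofHom (algebraMap k X.left.functionField)) := by
  have h : X.hom = X.left.toSpecΓ ≫ Spec.map ((Scheme.ΓSpecIso (.of k)).inv ≫ X.hom.appTop) := by
    rw [Spec.map_comp, ← Scheme.toSpecΓ_naturality_assoc]
    simp
  have h2 : CommRingCat.ofHom (algebraMap k X.left.functionField) =
      ((Scheme.ΓSpecIso (.of k)).inv ≫ X.hom.appTop) ≫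
      X.left.presheaf.germ ⊤ (genericPoint X.left) (TopologicalSpace.Opens.mem_top _) := by
    ext a
    change X.left.presheaf.germ ⊤ _ _ (X.left.presheaf.map (𝟙 _) _) = _
    rw [X.left.presheaf.map_id]
    rfl
  rw [h, ← Category.assoc, Scheme.fromSpecStalk_toSpecΓ, ← Spec.map_comp, h2]

/-- A homomorphism of function fields as a morphism of commutative rings. -/
def functionFieldHom {X Y : Over (Spec (.of k))} [IrreducibleSpace X.left] [IrreducibleSpace Y.left]
    (e : Y.left.functionField →ₐ[k] X.left.functionField) :
    Y.left.functionField ⟶ X.left.functionField :=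
  CommRingCat.ofHom (R := Y.left.functionField) (S := X.left.functionField) e.toRingHom

lemma algebraMap_comp_functionFieldHom {X Y : Over (Spec (.of k))} [IrreducibleSpace X.left]
    [IrreducibleSpace Y.left] (e : Y.left.functionField →ₐ[k] X.left.functionField) :
    CommRingCat.ofHom (algebraMap k Y.left.functionField) ≫ functionFieldHom e =
      CommRingCat.ofHom (algebraMap k X.left.functionField) :=
  CommRingCat.hom_ext (RingHom.ext e.commutes)

lemma functionFieldHom_injective {X Y : Over (Spec (.of k))} [IrreducibleSpace X.left]
    [IrreducibleSpace Y.left] {e f : Y.left.functionField →ₐ[k] X.left.functionField}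
    (h : functionFieldHom e = functionFieldHom f) : e = f :=
  AlgHom.coe_ringHom_injective congr(CommRingCat.Hom.hom $h)

lemma fromSpecStalk_comp_left {X Y : Over (Spec (.of k))} [IrreducibleSpace X.left]
    [IrreducibleSpace Y.left] (φ : X ⟶ Y) (h : φ.left (genericPoint X.left) = genericPoint Y.left) :
    X.left.fromSpecStalk (genericPoint X.left) ≫ φ.left =
      Spec.map (functionFieldHom (functionFieldMap φ h)) ≫
        Y.left.fromSpecStalk (genericPoint Y.left) := by
  rw [← Scheme.SpecMap_stalkMap_fromSpecStalk,
    ← Scheme.SpecMap_stalkSpecializes_fromSpecStalk (specializes_of_eq h), ← Category.assoc,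
    ← Spec.map_comp]
  rfl

/-- A dominant morphism to a separated scheme is determined by its action on function fields. -/
lemma hom_ext_of_functionFieldMap_eq {X Y : Over (Spec (.of k))} [IsIntegral X.left]
    [IrreducibleSpace Y.left] [IsSeparated Y.hom] (φ ψ : X ⟶ Y)
    (hφ : φ.left (genericPoint X.left) = genericPoint Y.left)
    (hψ : ψ.left (genericPoint X.left) = genericPoint Y.left)
    (h : functionFieldMap φ hφ = functionFieldMap ψ hψ) : φ = ψ := by
  refine Over.OverMorphism.ext (ext_of_isDominant_of_isSeparated Y.hom ?_
    (X.left.fromSpecStalk (genericPoint X.left)) ?_)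
  · rw [Over.w, Over.w]
  · rw [fromSpecStalk_comp_left φ hφ, fromSpecStalk_comp_left ψ hψ, h]

/-- A homomorphism of function fields is a rational map, which extends everywhere because the source
has valuation local rings and the target is proper. The generic point goes to the generic point
since the map Spec k(X) → Y factors through Spec k(Y). -/
lemma exists_functionFieldMap_eq {X Y : Over (Spec (.of k))} [IsIntegral X.left] [IsIntegral Y.left]
    (hX : ∀ x : X.left, ValuationRing (X.left.presheaf.stalk x)) [IsProper Y.hom]
    (e : Y.left.functionField →ₐ[k] X.left.functionField) :
    ∃ (φ : X ⟶ Y) (h : φ.left (genericPoint X.left) = genericPoint Y.left),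
      functionFieldMap φ h = e := by
  have : Y.left.IsSeparated := by
    refine ⟨?_⟩
    have : Limits.terminal.from Y.left = Y.hom ≫ Limits.terminal.from _ :=
      Limits.terminal.hom_ext _ _
    rw [this]
    infer_instance
  obtain ⟨φ, hφ⟩ := exists_hom_of_valuationRing_stalk hX X.hom Y.hom
    (Spec.map (functionFieldHom e) ≫ Y.left.fromSpecStalk (genericPoint Y.left)) (by
      rw [Category.assoc, fromSpecStalk_hom, fromSpecStalk_hom]
      exact (Spec.map_comp _ _).symm.trans (congrArg Spec.map (algebraMap_comp_functionFieldHom e)))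
  have hw : φ ≫ Y.hom = X.hom := by
    refine ext_of_isDominant_of_isSeparated (Limits.terminal.from (Spec (.of k)))
      (Limits.terminal.hom_ext _ _) (X.left.fromSpecStalk (genericPoint X.left)) ?_
    rw [reassoc_of% hφ, fromSpecStalk_hom, fromSpecStalk_hom]
    exact (Spec.map_comp _ _).symm.trans (congrArg Spec.map (algebraMap_comp_functionFieldHom e))
  let Φ : X ⟶ Y := Over.homMk φ hw
  have hgen : φ (genericPoint X.left) = genericPoint Y.left := by
    have h1 : φ (X.left.fromSpecStalk _ (IsLocalRing.closedPoint _)) =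
        Y.left.fromSpecStalk _ (Spec.map (functionFieldHom e) (IsLocalRing.closedPoint _)) :=
      congr($(hφ) (IsLocalRing.closedPoint X.left.functionField))
    rw [Scheme.fromSpecStalk_closedPoint] at h1
    rw [h1]
    refine Eq.trans ?_ Scheme.fromSpecStalk_closedPoint
    congr 1
    exact Subsingleton.elim (α := PrimeSpectrum Y.left.functionField) _ _
  refine ⟨Φ, hgen, ?_⟩
  have h2 := fromSpecStalk_comp_left Φ hgen
  rw [show Φ.left = φ from rfl, hφ, cancel_mono] at h2
  exact (functionFieldHom_injective (Spec.map_injective h2)).symm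

lemma functionFieldMap_id (X : Over (Spec (.of k))) [IrreducibleSpace X.left] :
    functionFieldMap (𝟙 X) rfl = AlgHom.id k _ := by
  have h : X.left.fromSpecStalk _ ≫ 𝟙 X.left = _ := fromSpecStalk_comp_left (𝟙 X) rfl
  have h' : 𝟙 _ ≫ X.left.fromSpecStalk _ = _ :=
    ((Category.id_comp _).trans (Category.comp_id _).symm).trans h
  rw [cancel_mono, ← Spec.map_id] at h'
  exact functionFieldHom_injective (Spec.map_injective h'.symm)

lemma functionFieldMap_comp {X Y Z : Over (Spec (.of k))} [IrreducibleSpace X.left]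
    [IrreducibleSpace Y.left] [IrreducibleSpace Z.left] (φ : X ⟶ Y) (ψ : Y ⟶ Z)
    (hφ : φ.left (genericPoint X.left) = genericPoint Y.left)
    (hψ : ψ.left (genericPoint Y.left) = genericPoint Z.left)
    (h : (φ ≫ ψ).left (genericPoint X.left) = genericPoint Z.left) :
    functionFieldMap (φ ≫ ψ) h = (functionFieldMap φ hφ).comp (functionFieldMap ψ hψ) := by
  have h1 := fromSpecStalk_comp_left (φ ≫ ψ) h
  rw [Over.comp_left, ← Category.assoc, fromSpecStalk_comp_left φ hφ, Category.assoc,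
    fromSpecStalk_comp_left ψ hψ, ← Category.assoc, cancel_mono] at h1
  exact functionFieldHom_injective (Spec.map_injective (h1.symm.trans (Spec.map_comp _ _).symm))

/-- Proper curves with isomorphic function fields are isomorphic. -/
lemma exists_iso_of_functionField_algEquiv {X Y : Over (Spec (.of k))} [IsIntegral X.left]
    [IsIntegral Y.left] (hX : ∀ x : X.left, ValuationRing (X.left.presheaf.stalk x))
    (hY : ∀ y : Y.left, ValuationRing (Y.left.presheaf.stalk y)) [IsProper X.hom] [IsProper Y.hom]
    (e : Y.left.functionField ≃ₐ[k] X.left.functionField) :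
    ∃ (φ : X ≅ Y) (h : φ.hom.left (genericPoint X.left) = genericPoint Y.left),
      functionFieldMap φ.hom h = e := by
  obtain ⟨φ, hφ, hφe⟩ := exists_functionFieldMap_eq hX e.toAlgHom
  obtain ⟨ψ, hψ, hψe⟩ := exists_functionFieldMap_eq hY e.symm.toAlgHom
  have h1 : (φ ≫ ψ).left (genericPoint X.left) = genericPoint X.left := by
    rw [Over.comp_left, Scheme.Hom.comp_apply, hφ, hψ]
  have h2 : (ψ ≫ φ).left (genericPoint Y.left) = genericPoint Y.left := by
    rw [Over.comp_left, Scheme.Hom.comp_apply, hψ, hφ]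
  refine ⟨⟨φ, ψ, ?_, ?_⟩, hφ, hφe⟩
  · refine hom_ext_of_functionFieldMap_eq _ _ h1 rfl ?_
    rw [functionFieldMap_comp φ ψ hφ hψ, functionFieldMap_id, hφe, hψe]
    ext x
    simp
  · refine hom_ext_of_functionFieldMap_eq _ _ h2 rfl ?_
    rw [functionFieldMap_comp ψ φ hψ hφ, functionFieldMap_id, hφe, hψe]
    ext x
    simp

end

end

noncomputable section

/-! ### The projective line -/

lemma MvPolynomial.IsHomogeneous.eval₂_mul {R S σ : Type*} [CommSemiring R] [CommSemiring S]
    {p : MvPolynomial σ R} {n : ℕ} (hp : p.IsHomogeneous n) (f : R →+* S) (c : S) (x : σ → S) :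
    p.eval₂ f (fun i => c * x i) = c ^ n * p.eval₂ f x := by
  rw [MvPolynomial.eval₂_eq, MvPolynomial.eval₂_eq, Finset.mul_sum]
  refine Finset.sum_congr rfl fun d hd => ?_
  have hd' : d.degree = n := by
    rw [Finsupp.degree_eq_weight_one]
    exact hp (MvPolynomial.mem_support_iff.mp hd)
  simp only [mul_pow, Finset.prod_mul_distrib, Finset.prod_pow_eq_pow_sum]
  rw [show ∑ i ∈ d.support, d i = n from hd']
  ring

section

variable (k : Type u) [Field k]

/-- The scalars in the ring of a standard chart of the projective line. -/
def scalarsToAway (i : Fin 2) :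
    k →+* HomogeneousLocalization.Away (polyGrading k 1) (MvPolynomial.X i) :=
  (HomogeneousLocalization.fromZeroRingHom (polyGrading k 1) _).comp
    (algebraMap k (polyGrading k 1 0))

lemma val_scalarsToAway (i : Fin 2) (a : k) :
    (scalarsToAway k i a).val = algebraMap (MvPolynomial (Fin 2) k) _ (MvPolynomial.C a) := by
  simp only [scalarsToAway, RingHom.comp_apply]
  rw [← HomogeneousLocalization.algebraMap_eq, ← HomogeneousLocalization.algebraMap_apply,
    ← IsScalarTower.algebraMap_apply]
  rfl

/-- The affine coordinate `X_j / X_i` on a standard chart of the projective line. -/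
def lineCoordinate (i j : Fin 2) :
    HomogeneousLocalization.Away (polyGrading k 1) (MvPolynomial.X i) :=
  HomogeneousLocalization.Away.mk (polyGrading k 1) (MvPolynomial.isHomogeneous_X k i) 1
    (MvPolynomial.X j) (by simpa using MvPolynomial.isHomogeneous_X k j)

lemma algebraMap_mul_val_lineCoordinate (i j : Fin 2) :
    algebraMap (MvPolynomial (Fin 2) k) (Localization.Away (MvPolynomial.X i))
      (MvPolynomial.X i) * (lineCoordinate k i j).val =
    algebraMap (MvPolynomial (Fin 2) k) _ (MvPolynomial.X j) := by
  let s : Submonoid.powers (MvPolynomial.X i : MvPolynomial (Fin 2) k) :=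
    ⟨MvPolynomial.X i ^ 1, 1, rfl⟩
  have h : (lineCoordinate k i j).val = Localization.mk (MvPolynomial.X j) s := rfl
  have h2 := IsLocalization.mk'_spec' (Localization.Away (MvPolynomial.X i : MvPolynomial (Fin 2) k))
    (MvPolynomial.X j : MvPolynomial (Fin 2) k)
    s
  rw [h, Localization.mk_eq_mk']
  simpa only [s, pow_one] using h2

/-- The polynomials in the affine coordinate `X_j / X_i`, as elements of the ring of
a standard chart of the projective line. -/
def polynomialToAway (i j : Fin 2) : Polynomial k →+*
    HomogeneousLocalization.Away (polyGrading k 1) (MvPolynomial.X i) :=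
  Polynomial.eval₂RingHom (scalarsToAway k i)
    (lineCoordinate k i j)

/-- Dehomogenization: a fraction a / X_i^n with a homogeneous of degree n is the image of the
polynomial obtained from a by setting X_i = 1 and X_j = T. -/
lemma polynomialToAway_surjective {i j : Fin 2} (hij : i ≠ j) :
    Function.Surjective (polynomialToAway k i j) := by
  intro z
  obtain ⟨n, a, ha, rfl⟩ :=
    HomogeneousLocalization.Away.mk_surjective _ (MvPolynomial.isHomogeneous_X k i) z
  have ha' : a.IsHomogeneous n := by simpa using ha
  let q : Polynomial k := a.eval₂ Polynomial.C (fun l => if l = i then 1 else Polynomial.X)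
  refine ⟨q, HomogeneousLocalization.val_injective _ ?_⟩
  let v : HomogeneousLocalization.Away (polyGrading k 1) (MvPolynomial.X i) →+*
      Localization.Away (MvPolynomial.X i : MvPolynomial (Fin 2) k) := algebraMap _ _
  have hv (z) : v z = z.val := HomogeneousLocalization.algebraMap_apply _
  have h1 : v (polynomialToAway k i j q) = a.eval₂ ((algebraMap (MvPolynomial (Fin 2) k) _).comp
      MvPolynomial.C) (fun l => if l = i then 1 else v (polynomialToAway k i j Polynomial.X)) := by
    rw [← RingHom.comp_apply, ← MvPolynomial.coe_eval₂Hom, MvPolynomial.hom_eval₂]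
    congr 1
    · ext b
      simp only [RingHom.comp_apply, polynomialToAway, Polynomial.coe_eval₂RingHom,
        Polynomial.eval₂_C]
      rw [hv, val_scalarsToAway]
    · ext l
      split_ifs <;> simp
  rw [← hv, h1]
  have hval := HomogeneousLocalization.Away.val_mk (polyGrading k 1) n
    (MvPolynomial.isHomogeneous_X k i) a ha
  refine Eq.trans ?_ hval.symm
  have h2 : algebraMap (MvPolynomial (Fin 2) k)
      (Localization.Away (MvPolynomial.X i : MvPolynomial (Fin 2) k)) a =
      algebraMap (MvPolynomial (Fin 2) k) _ (MvPolynomial.X i) ^ n * a.eval₂ ((algebraMap (MvPolynomial (Fin 2) k) _).comp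
      MvPolynomial.C) (fun l => if l = i then 1 else v (polynomialToAway k i j Polynomial.X)) := by
    rw [← ha'.eval₂_mul ((algebraMap (MvPolynomial (Fin 2) k) _).comp MvPolynomial.C)]
    conv_lhs => rw [← MvPolynomial.eval₂_eta a, MvPolynomial.hom_eval₂]
    congr 1
    ext l
    split_ifs with h
    · rw [mul_one, h]
    · have hl : l = j := by omega
      simp only [polynomialToAway, Polynomial.coe_eval₂RingHom, Polynomial.eval₂_X, hv]
      rw [algebraMap_mul_val_lineCoordinate, hl]
  rw [Localization.mk_eq_mk', eq_comm, IsLocalization.mk'_eq_iff_eq_mul, h2, map_pow]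
  ring

instance isDomain_away (p : MvPolynomial (Fin 2) k) [NeZero p] :
    IsDomain (HomogeneousLocalization.Away (polyGrading k 1) p) := by
  have : IsDomain (Localization.Away p) :=
    IsLocalization.isDomain_localization (powers_le_nonZeroDivisors_of_noZeroDivisors (NeZero.ne p))
  exact (HomogeneousLocalization.val_injective _).isDomain (algebraMap
    (HomogeneousLocalization.Away (polyGrading k 1) p) (Localization.Away p))

instance (i : Fin 2) : NeZero (MvPolynomial.X i : MvPolynomial (Fin 2) k) := ⟨MvPolynomial.X_ne_zero i⟩

instance isPrincipalIdealRing_away (i : Fin 2) : IsPrincipalIdealRing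
    (HomogeneousLocalization.Away (polyGrading k 1) (MvPolynomial.X i)) := by
  obtain ⟨j, hj⟩ := exists_ne i
  exact IsPrincipalIdealRing.of_surjective (polynomialToAway k i j)
    (polynomialToAway_surjective k hj.symm)

/-- The standard charts of the projective line. -/
abbrev lineChart (i : Fin 2) :
    Spec (.of (HomogeneousLocalization.Away (polyGrading k 1) (MvPolynomial.X i))) ⟶
      (projSpace k 1).left :=
  Proj.awayι (polyGrading k 1) (MvPolynomial.X i) (MvPolynomial.isHomogeneous_X k i) one_pos

lemma lineChart_hom (i : Fin 2) : lineChart k i ≫ (projSpace k 1).hom =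
    Spec.map (CommRingCat.ofHom (scalarsToAway k i)) := by
  change lineChart k i ≫ (Proj.toSpecZero (polyGrading k 1) ≫
    Spec.map (CommRingCat.ofHom (algebraMap k (polyGrading k 1 0)))) = _
  exact (Proj.awayι_toSpecZero_assoc (polyGrading k 1) _ _ _ _).trans (Spec.map_comp _ _).symm

lemma exists_mem_range_lineChart (x : (projSpace k 1).left) :
    ∃ i, x ∈ Set.range (lineChart k i) := by
  have h := Proj.iSup_basicOpen_eq_top' (polyGrading k 1) (MvPolynomial.X : Fin 2 → _)
    (fun i => ⟨1, MvPolynomial.isHomogeneous_X k i⟩) (by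
      have h1 := MvPolynomial.adjoin_range_X (R := k) (σ := Fin 2)
      refine top_unique fun p _ => ?_
      have hp : p ∈ Algebra.adjoin k (Set.range (MvPolynomial.X : Fin 2 → MvPolynomial (Fin 2) k)) :=
        h1 ▸ Algebra.mem_top
      induction hp using Algebra.adjoin_induction with
      | mem x hx => exact Algebra.subset_adjoin hx
      | algebraMap a =>
        exact Subalgebra.algebraMap_mem _ (algebraMap k (polyGrading k 1 0) a)
      | add x y _ _ hx hy => exact add_mem (hx Algebra.mem_top) (hy Algebra.mem_top)
      | mul x y _ _ hx hy => exact mul_mem (hx Algebra.mem_top) (hy Algebra.mem_top))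
  have hx : x ∈ ⨆ i, Proj.basicOpen (polyGrading k 1) (MvPolynomial.X i : MvPolynomial (Fin 2) k) :=
    h ▸ TopologicalSpace.Opens.mem_top x
  obtain ⟨i, hi⟩ := TopologicalSpace.Opens.mem_iSup.mp hx
  rw [← Proj.opensRange_awayι _ _ (MvPolynomial.isHomogeneous_X k i) one_pos] at hi
  exact ⟨i, hi⟩

/-- Both charts contain the locus where X_i X_j is invertible, which is the spectrum of a domain.
This overlap is what makes the line connected. -/
lemma range_lineChart_inter_nonempty (i j : Fin 2) :
    (Set.range (lineChart k i) ∩ Set.range (lineChart k j)).Nonempty := by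
  have : NeZero (MvPolynomial.X i * MvPolynomial.X j : MvPolynomial (Fin 2) k) :=
    ⟨mul_ne_zero (MvPolynomial.X_ne_zero i) (MvPolynomial.X_ne_zero j)⟩
  have := isDomain_away k (MvPolynomial.X i * MvPolynomial.X j)
  let p : Spec (.of (HomogeneousLocalization.Away (polyGrading k 1)
      (MvPolynomial.X i * MvPolynomial.X j))) :=
    Classical.arbitrary (PrimeSpectrum (HomogeneousLocalization.Away (polyGrading k 1)
      (MvPolynomial.X i * MvPolynomial.X j)))
  refine ⟨Proj.awayι (polyGrading k 1) (MvPolynomial.X i * MvPolynomial.X j)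
    ((MvPolynomial.isHomogeneous_X k i).mul (MvPolynomial.isHomogeneous_X k j)) two_pos p,
    ⟨_, congr($(Proj.SpecMap_awayMap_awayι (polyGrading k 1) (MvPolynomial.isHomogeneous_X k i)
      one_pos (MvPolynomial.isHomogeneous_X k j) rfl) p)⟩,
    ⟨_, congr($(Proj.SpecMap_awayMap_awayι (polyGrading k 1) (MvPolynomial.isHomogeneous_X k j)
      one_pos (MvPolynomial.isHomogeneous_X k i) (mul_comm _ _)) p)⟩⟩

lemma irreducible_range_lineChart (i : Fin 2) : IsIrreducible (Set.range (lineChart k i)) := by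
  rw [← Set.image_univ]
  exact (IrreducibleSpace.isIrreducible_univ _).image _ (lineChart k i).continuous.continuousOn

instance : ConnectedSpace (projSpace k 1).left := by
  refine connectedSpace_iff_univ.mpr ?_
  have h : (Set.univ : Set (projSpace k 1).left) =
      Set.range (lineChart k 0) ∪ Set.range (lineChart k 1) := by
    refine (Set.eq_univ_of_forall fun x => ?_).symm
    obtain ⟨i, hi⟩ := exists_mem_range_lineChart k x
    fin_cases i
    · exact .inl hi
    · exact .inr hi
  rw [h]
  exact (irreducible_range_lineChart k 0).isConnected.union (range_lineChart_inter_nonempty k 0 1)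
    (irreducible_range_lineChart k 1).isConnected

instance : IsProper (projSpace k 1).hom := isProper_projSpace k 1

instance : IsLocallyNoetherian (projSpace k 1).left :=
  LocallyOfFiniteType.isLocallyNoetherian (projSpace k 1).hom

lemma isDomain_and_isPrincipalIdealRing_stalk_spec (R : CommRingCat.{u}) [IsDomain R]
    [IsPrincipalIdealRing R] (y : PrimeSpectrum R) : IsDomain ((Spec R).presheaf.stalk y) ∧
      IsPrincipalIdealRing ((Spec R).presheaf.stalk y) := by
  let : Algebra R ((Spec R).presheaf.stalk y) :=
    inferInstanceAs (Algebra R ((Spec.structureSheaf R).presheaf.stalk y))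
  have : IsLocalization.AtPrime ((Spec R).presheaf.stalk y) y.asIdeal :=
    inferInstanceAs (IsLocalization.AtPrime ((Spec.structureSheaf R).presheaf.stalk y) y.asIdeal)
  refine ⟨IsLocalization.isDomain_of_atPrime _ y.asIdeal, ⟨fun I => ?_⟩⟩
  rw [← IsLocalization.map_under y.asIdeal.primeCompl _ I]
  infer_instance

instance (i : Fin 2) : IsOpenImmersion (lineChart k i) := by
  have := @IsOpenImmersion.comp _ _ _
    (Proj.basicOpenIsoSpec (polyGrading k 1) (MvPolynomial.X i)
      (MvPolynomial.isHomogeneous_X k i) one_pos).inv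
    (Proj.basicOpen (polyGrading k 1) (MvPolynomial.X i)).ι inferInstance inferInstance
  exact this

lemma isDomain_and_isPrincipalIdealRing_stalk_projSpace (x : (projSpace k 1).left) :
    IsDomain ((projSpace k 1).left.presheaf.stalk x) ∧
      IsPrincipalIdealRing ((projSpace k 1).left.presheaf.stalk x) := by
  obtain ⟨i, y, rfl⟩ := exists_mem_range_lineChart k x
  let e := (asIso ((lineChart k i).stalkMap y)).commRingCatIsoToRingEquiv
  obtain ⟨h1, h2⟩ := isDomain_and_isPrincipalIdealRing_stalk_spec _ y
  exact ⟨e.toMulEquiv.isDomain _, IsPrincipalIdealRing.of_surjective e.symm.toRingHom e.symm.surjective⟩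

instance : IsIntegral (projSpace k 1).left :=
  isIntegral_of_isDomain_stalk _ fun x => (isDomain_and_isPrincipalIdealRing_stalk_projSpace k x).1

lemma valuationRing_stalk_projSpace (x : (projSpace k 1).left) :
    ValuationRing ((projSpace k 1).left.presheaf.stalk x) := by
  have := (isDomain_and_isPrincipalIdealRing_stalk_projSpace k x).2
  infer_instance

end

end

noncomputable section

/-! ### Morphisms between projective lines and rational functions -/

section

variable {k : Type u} [Field k] {L : Type u} [Field L] [Algebra k L]

/-- The extension of `evalAway` to the whole localization. -/
lemma exists_evalAway_eq (a : L) : ∃ ψ : Localization.Away (MvPolynomial.X 1 : MvPolynomial (Fin 2) k) →+* L,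
    (∀ z, evalAway k a z = ψ z.val) ∧
      ∀ p, ψ (algebraMap (MvPolynomial (Fin 2) k) _ p) = MvPolynomial.aeval ![a, 1] p :=
  ⟨_, fun _ => rfl, fun p => IsLocalization.Away.lift_eq (S := Localization.Away
    (MvPolynomial.X 1 : MvPolynomial (Fin 2) k)) (MvPolynomial.X 1)
    (g := (MvPolynomial.aeval ![a, 1] : MvPolynomial (Fin 2) k →ₐ[k] L).toRingHom) (by simp) p⟩

lemma evalAway_scalarsToAway (a : L) (c : k) :
    evalAway k a (scalarsToAway k 1 c) = algebraMap k L c := by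
  obtain ⟨ψ, h1, h2⟩ := exists_evalAway_eq (k := k) a
  rw [h1, val_scalarsToAway, h2, MvPolynomial.aeval_C]

lemma evalAway_lineCoordinate (a : L) : evalAway k a (lineCoordinate k 1 0) = a := by
  obtain ⟨ψ, h1, h2⟩ := exists_evalAway_eq (k := k) a
  have h := congr(ψ $(algebraMap_mul_val_lineCoordinate k 1 0))
  rw [map_mul, h2, h2, ← h1] at h
  simpa using h

lemma evalAway_polynomialToAway (a : L) (p : Polynomial k) :
    evalAway k a (polynomialToAway k 1 0 p) = Polynomial.aeval a p := by
  induction p using Polynomial.induction_on' with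
  | add p q hp hq => rw [map_add, map_add, map_add, hp, hq]
  | monomial n c =>
    rw [← Polynomial.C_mul_X_pow_eq_monomial]
    simp [polynomialToAway, evalAway_scalarsToAway, evalAway_lineCoordinate]

lemma evalAway_ext {φ : HomogeneousLocalization.Away (polyGrading k 1) (MvPolynomial.X 1) →+* L}
    {a : L} (h1 : ∀ c, φ (scalarsToAway k 1 c) = algebraMap k L c)
    (h2 : φ (lineCoordinate k 1 0) = a) : φ = evalAway k a := by
  ext z
  obtain ⟨p, rfl⟩ := polynomialToAway_surjective k (i := 1) (j := 0) (by decide) z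
  rw [evalAway_polynomialToAway]
  induction p using Polynomial.induction_on' with
  | add p q hp hq => rw [map_add, map_add, map_add, hp, hq]
  | monomial n c =>
    rw [← Polynomial.C_mul_X_pow_eq_monomial]
    simp [polynomialToAway, h1, h2]

lemma specMap_affinePoint {L' : Type u} [Field L'] [Algebra k L'] (σ : L →ₐ[k] L') (a : L) :
    Spec.map (CommRingCat.ofHom σ.toRingHom) ≫ affinePoint k a = affinePoint k (σ a) := by
  have h : CommRingCat.ofHom (evalAway k a) ≫ CommRingCat.ofHom σ.toRingHom =
      CommRingCat.ofHom (evalAway k (σ a)) := ?_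
  · exact (Category.assoc _ _ (lineChart k 1)).symm.trans
      (congrArg (· ≫ lineChart k 1) ((Spec.map_comp _ _).symm.trans (congrArg Spec.map h)))
  refine CommRingCat.hom_ext (evalAway_ext (fun c => ?_) ?_)
  · exact (congrArg σ (evalAway_scalarsToAway a c)).trans (σ.commutes c)
  · exact congrArg σ (evalAway_lineCoordinate a)

lemma affinePoint_hom (a : L) : affinePoint k a ≫ (projSpace k 1).hom =
    Spec.map (CommRingCat.ofHom (algebraMap k L)) := by
  refine (Category.assoc _ (lineChart k 1) _).trans ((congrArg _ (lineChart_hom k 1)).trans ?_)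
  rw [← Spec.map_comp, ← CommRingCat.ofHom_comp]
  congr 2
  ext c
  exact evalAway_scalarsToAway a c

variable (k)

lemma evalAway_X_injective : Function.Injective (evalAway k (RatFunc.X : RatFunc k)) := by
  rw [injective_iff_map_eq_zero]
  intro z hz
  obtain ⟨p, rfl⟩ := polynomialToAway_surjective k (i := 1) (j := 0) (by decide) z
  rw [evalAway_polynomialToAway, RatFunc.aeval_X_left_eq_algebraMap] at hz
  rw [(map_eq_zero_iff _ (RatFunc.algebraMap_injective k)).mp hz, map_zero]

lemma affinePoint_X_closedPoint :
    affinePoint k (RatFunc.X : RatFunc k) (IsLocalRing.closedPoint (RatFunc k)) =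
      genericPoint (projSpace k 1).left := by
  have h1 : IsDominant (Spec.map (CommRingCat.ofHom (evalAway k (RatFunc.X : RatFunc k)))) := by
    refine ⟨?_⟩
    refine (PrimeSpectrum.denseRange_comap_iff_ker_le_nilRadical _).mpr ?_
    exact ((RingHom.injective_iff_ker_eq_bot _).mp (evalAway_X_injective k)).le.trans bot_le
  have h2 : IsDominant (lineChart k 1) := by
    refine ⟨(lineChart k 1).isOpenEmbedding.isOpen_range.dense ?_⟩
    exact (irreducible_range_lineChart k 1).nonempty
  have h3 : IsDominant (affinePoint k (RatFunc.X : RatFunc k)) :=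
    inferInstanceAs (IsDominant (_ ≫ lineChart k 1))
  rw [← genericPoint_map_eq_of_denseRange _ (affinePoint k (RatFunc.X : RatFunc k)).continuous
    h3.denseRange]
  congr 1
  exact Subsingleton.elim (α := PrimeSpectrum (RatFunc k)) _ _

/-- The function field of the projective line is the field of rational functions. -/
lemma exists_algEquiv_functionField_projSpace :
    ∃ e : (projSpace k 1).left.functionField ≃ₐ[k] RatFunc k,
      affinePoint k (RatFunc.X : RatFunc k) =
        Spec.map (CommRingCat.ofHom (R := (projSpace k 1).left.functionField) e.toRingEquiv.toRingHom) ≫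
          (projSpace k 1).left.fromSpecStalk (genericPoint (projSpace k 1).left) := by
  let p := affinePoint k (RatFunc.X : RatFunc k)
  have hp : genericPoint (projSpace k 1).left ⤳ p (IsLocalRing.closedPoint (RatFunc k)) :=
    specializes_of_eq (affinePoint_X_closedPoint k).symm
  have hp' : p (IsLocalRing.closedPoint (RatFunc k)) ⤳ genericPoint (projSpace k 1).left :=
    specializes_of_eq (affinePoint_X_closedPoint k)
  let E : (projSpace k 1).left.functionField ⟶ .of (RatFunc k) :=
    (projSpace k 1).left.presheaf.stalkSpecializes hp' ≫ Scheme.stalkClosedPointTo p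
  have hE : Spec.map E ≫ (projSpace k 1).left.fromSpecStalk _ = p := by
    rw [Spec.map_comp, Category.assoc, Scheme.SpecMap_stalkSpecializes_fromSpecStalk]
    exact Scheme.Spec_stalkClosedPointTo_fromSpecStalk p
  have hcomm (c : k) : E (algebraMap k (projSpace k 1).left.functionField c) =
      algebraMap k (RatFunc k) c := by
    have h := affinePoint_hom (k := k) (RatFunc.X : RatFunc k)
    rw [← show _ = affinePoint k (RatFunc.X : RatFunc k) from hE, Category.assoc,
      fromSpecStalk_hom] at h
    have h' := Spec.map_injective ((Spec.map_comp _ _).trans h)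
    exact congr($h' c)
  let ea : (projSpace k 1).left.functionField →ₐ[k] RatFunc k := ⟨E.hom, hcomm⟩
  -- The spectrum of the function field factors through the chart X₁ ≠ 0. The pullback of X₀ / X₁
  -- along this factorization is the required preimage, and X generates k(X), so `ea` is onto.
  have hX : RatFunc.X ∈ ea.fieldRange := by
    have hr : Set.range ((projSpace k 1).left.fromSpecStalk (genericPoint (projSpace k 1).left)) ⊆
        Set.range (lineChart k 1) := by
      rintro _ ⟨y, rfl⟩
      have hy : y = IsLocalRing.closedPoint (projSpace k 1).left.functionField :=
        Subsingleton.elim (α := PrimeSpectrum (projSpace k 1).left.functionField) _ _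
      rw [hy]
      refine (Scheme.fromSpecStalk_closedPoint (X := (projSpace k 1).left)).symm ▸ ?_
      rw [← affinePoint_X_closedPoint]
      exact ⟨Spec.map (CommRingCat.ofHom (evalAway k (RatFunc.X : RatFunc k)))
        (IsLocalRing.closedPoint (RatFunc k)), rfl⟩
    let ψ := Spec.preimage (IsOpenImmersion.lift (lineChart k 1) _ hr)
    have hψ : Spec.map ψ ≫ lineChart k 1 = (projSpace k 1).left.fromSpecStalk _ := by
      rw [Spec.map_preimage, IsOpenImmersion.lift_fac]
    have h1 : Spec.map (ψ ≫ E) ≫ lineChart k 1 =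
        Spec.map (CommRingCat.ofHom (evalAway k (RatFunc.X : RatFunc k))) ≫ lineChart k 1 := by
      rw [Spec.map_comp, Category.assoc, hψ]
      exact hE
    have h2 := Spec.map_injective ((cancel_mono _).mp h1)
    exact ⟨ψ (lineCoordinate k 1 0), congr($h2 (lineCoordinate k 1 0)).trans
      (evalAway_lineCoordinate _)⟩
  have hsurj : Function.Surjective ea := by
    rw [← AlgHom.fieldRange_eq_top, ← top_le_iff, ← RatFunc.adjoin_X]
    exact IntermediateField.adjoin_le_iff.mpr (Set.singleton_subset_iff.mpr hX)
  exact ⟨AlgEquiv.ofBijective ea ⟨ea.injective, hsurj⟩, hE.symm⟩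


variable {k}

/-- A dominant endomorphism of the projective line, other than an automorphism, is given by
a rational function of degree greater than one. -/
lemma exists_isGivenBy (g : projSpace k 1 ⟶ projSpace k 1)
    (hg : g.left (genericPoint (projSpace k 1).left) = genericPoint (projSpace k 1).left)
    (hiso : ¬ Function.Surjective (functionFieldMap g hg)) :
    ∃ f : RatFunc k, IsGivenBy g f ∧ 1 < ratFuncDegree f := by
  obtain ⟨e, he⟩ := exists_algEquiv_functionField_projSpace k
  let σ : RatFunc k →ₐ[k] RatFunc k :=
    (e.toAlgHom.comp (functionFieldMap g hg)).comp e.symm.toAlgHom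
  have hσ : ¬ Function.Surjective σ := by
    intro h
    refine hiso fun y => ?_
    obtain ⟨x, hx⟩ := h (e y)
    exact ⟨e.symm x, e.injective hx⟩
  refine ⟨σ RatFunc.X, ?_, ?_⟩
  · rw [IsGivenBy, ← specMap_affinePoint σ, he, Category.assoc, fromSpecStalk_comp_left g hg,
      ← Category.assoc, ← Category.assoc]
    congr 1
    refine (Spec.map_comp _ _).symm.trans (Eq.trans ?_ (Spec.map_comp _ _))
    congr 1
    refine CommRingCat.hom_ext (RingHom.ext fun x => ?_)
    exact congrArg (fun y => e (functionFieldMap g hg y)) (e.symm_apply_apply x).symm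
  -- The degree of σ(X) is [k(X) : k(σ(X))]. Degree zero would make σ(X) constant, against the
  -- transcendence of X; degree one would make σ surjective.
  · by_contra! hdeg
    have hC : ¬ ∃ c, σ RatFunc.X = RatFunc.C c := by
      rintro ⟨c, hc⟩
      have : RatFunc.X = algebraMap k (RatFunc k) c := σ.injective (hc.trans (σ.commutes c).symm)
      exact (RatFunc.transcendental_X (K := k)) (this ▸ isAlgebraic_algebraMap c)
    have h1 := RatFunc.finrank_eq_max_natDegree (σ RatFunc.X)
    have := RatFunc.isAlgebraic_adjoin_simple_X' _ hC
    have h2 : Module.finrank (IntermediateField.adjoin k {σ RatFunc.X}) (RatFunc k) = 1 := by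
      refine le_antisymm (h1.trans_le hdeg) ?_
      rw [Nat.one_le_iff_ne_zero, h1]
      intro h0
      refine hC ⟨(σ RatFunc.X).num.coeff 0 / (σ RatFunc.X).denom.coeff 0, ?_⟩
      have h3 := Nat.max_eq_zero_iff.mp h0
      refine (RatFunc.num_div_denom _).symm.trans ?_
      rw [map_div₀]
      congr 1
      · exact (congrArg _ (Polynomial.eq_C_of_natDegree_eq_zero h3.1)).trans (RatFunc.algebraMap_C _)
      · exact (congrArg _ (Polynomial.eq_C_of_natDegree_eq_zero h3.2)).trans (RatFunc.algebraMap_C _)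
    refine hσ ?_
    rw [← AlgHom.fieldRange_eq_top, ← top_le_iff, ← IntermediateField.finrank_eq_one_iff_eq_top.mp h2]
    exact IntermediateField.adjoin_le_iff.mpr (Set.singleton_subset_iff.mpr ⟨_, rfl⟩)

end

end

noncomputable section

/-! ### Morphisms of curves -/

/-- Generizations of z are the primes of the local ring at z. In a principal ideal domain a nonzero
prime is maximal, and the zero ideal is the generic point. -/
lemma eq_or_eq_genericPoint_of_specializes {X : Scheme.{u}} [IsIntegral X] {y z : X}
    [IsPrincipalIdealRing (X.presheaf.stalk z)] (h : y ⤳ z) : y = z ∨ y = genericPoint X := by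
  have hy : y ∈ Set.range (X.fromSpecStalk z) := by
    rw [Scheme.range_fromSpecStalk]
    exact h
  obtain ⟨p, rfl⟩ := hy
  by_cases hp : p.asIdeal = ⊥
  · right
    have h2 : genericPoint X ∈ Set.range (X.fromSpecStalk z) := by
      rw [Scheme.range_fromSpecStalk]
      exact genericPoint_specializes z
    obtain ⟨q, hq⟩ := h2
    have h3 : p ⤳ q := (PrimeSpectrum.le_iff_specializes (R := X.presheaf.stalk z) p q).mp
      ((PrimeSpectrum.asIdeal_le_asIdeal _ _).mp (hp.le.trans bot_le))
    have h4 := h3.map (X.fromSpecStalk z).continuous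
    rw [hq] at h4
    exact (h4.antisymm (genericPoint_specializes _)).eq
  · left
    have h1 : p = IsLocalRing.closedPoint (X.presheaf.stalk z) := by
      have hpp : p.asIdeal.IsPrime := PrimeSpectrum.isPrime (R := X.presheaf.stalk z) p
      have : p.asIdeal.IsMaximal := IsPrime.to_maximal_ideal hp
      exact PrimeSpectrum.ext (IsLocalRing.eq_maximalIdeal this)
    rw [h1]
    exact Scheme.fromSpecStalk_closedPoint

section

variable {k : Type u} [Field k] {X Y : Over (Spec (.of k))}

instance isProper_left [IsProper X.hom] [IsSeparated Y.hom] (φ : X ⟶ Y) : IsProper φ.left := by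
  have : IsProper (φ.left ≫ Y.hom) := by rwa [Over.w]
  exact IsProper.of_comp φ.left Y.hom

/-- Every φ(x) is a specialization of the image of the generic point. If this image is not generic
in Y, it has no specialization but itself, and φ is constant. -/
lemma map_genericPoint_eq_of_nonconstant [IsProper X.hom] [IsSeparated Y.hom] [IsIntegral X.left]
    [IsIntegral Y.left] [∀ y : Y.left, IsPrincipalIdealRing (Y.left.presheaf.stalk y)] (φ : X ⟶ Y)
    (h : ¬ (Set.range φ.left).Subsingleton) :
    φ.left (genericPoint X.left) = genericPoint Y.left := by
  by_contra hne
  refine h ?_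
  have h1 (x : X.left) : φ.left x = φ.left (genericPoint X.left) := by
    have h2 := (genericPoint_specializes x).map φ.left.continuous
    exact ((eq_or_eq_genericPoint_of_specializes h2).resolve_right hne).symm
  rintro _ ⟨x, rfl⟩ _ ⟨y, rfl⟩
  rw [h1 x, h1 y]

lemma surjective_of_map_genericPoint_eq [IsProper X.hom] [IsSeparated Y.hom] [IrreducibleSpace X.left]
    [IrreducibleSpace Y.left] (φ : X ⟶ Y)
    (h : φ.left (genericPoint X.left) = genericPoint Y.left) : Surjective φ.left := by
  refine ⟨fun y => ?_⟩
  have h1 : IsClosed (Set.range φ.left) := by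
    rw [← Set.image_univ]
    exact φ.left.isClosedMap _ isClosed_univ
  exact (genericPoint_specializes y).mem_closed h1 ⟨_, h⟩

/-- The degree condition on a tower enters the argument only through this: its maps are not
isomorphisms. -/
lemma morphismDegree_eq_one_of_isIso {X Y : Scheme.{u}} (f : X ⟶ Y) [IsIso f] [IrreducibleSpace X] :
    morphismDegree f = 1 := by
  have h : ∃ ξ : X, IsGenericPoint ξ Set.univ := ⟨_, genericPoint_spec X⟩
  rw [morphismDegree, dif_pos h]
  let := (f.residueFieldMap h.choose).hom.toAlgebra
  have hb : Function.Bijective (algebraMap (Y.residueField (f h.choose)) (X.residueField h.choose)) :=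
    (ConcreteCategory.isIso_iff_bijective (f.residueFieldMap h.choose)).mp inferInstance
  let e := LinearEquiv.ofBijective (Algebra.linearMap (Y.residueField (f h.choose))
    (X.residueField h.choose)) hb
  rw [← e.finrank_eq, Module.finrank_self]

lemma isIso_of_surjective_functionFieldMap [IsIntegral X.left] [IsIntegral Y.left]
    (hX : ∀ x : X.left, ValuationRing (X.left.presheaf.stalk x))
    (hY : ∀ y : Y.left, ValuationRing (Y.left.presheaf.stalk y)) [IsProper X.hom] [IsProper Y.hom]
    (φ : X ⟶ Y) (h : φ.left (genericPoint X.left) = genericPoint Y.left)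
    (hs : Function.Surjective (functionFieldMap φ h)) : IsIso φ := by
  obtain ⟨ψ, hψ, hψe⟩ := exists_iso_of_functionField_algEquiv hX hY
    (AlgEquiv.ofBijective (functionFieldMap φ h) ⟨(functionFieldMap φ h).injective, hs⟩)
  have : φ = ψ.hom := hom_ext_of_functionFieldMap_eq _ _ h hψ (hψe.symm ▸ rfl)
  rw [this]
  infer_instance

section

variable {L : Type u} [Field L] [Algebra k L]

lemma isPullback_baseChange_map (φ : X ⟶ Y) :
    IsPullback (baseChangeFst (L := L) X).left
      ((Over.pullback (Spec.map (CommRingCat.ofHom (algebraMap k L)))).map φ).left φ.left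
      (baseChangeFst (L := L) Y).left := by
  have h1 := isPullback_baseChange (L := L) X
  have h2 := isPullback_baseChange (L := L) Y
  have hw : ((Over.pullback (Spec.map (CommRingCat.ofHom (algebraMap k L)))).map φ).left ≫
      (baseChangeFst (L := L) Y).left = (baseChangeFst (L := L) X).left ≫ φ.left :=
    congrArg CommaMorphism.left
      ((Over.mapPullbackAdj (Spec.map (CommRingCat.ofHom (algebraMap k L)))).counit.naturality φ)
  rw [← Over.w φ, ← Over.w ((Over.pullback (Spec.map (CommRingCat.ofHom (algebraMap k L)))).map φ)] at h1
  exact (IsPullback.of_right h1.flip hw h2.flip).flip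

lemma surjective_baseChange_map (φ : X ⟶ Y) [Surjective φ.left] :
    Surjective ((Over.pullback (Spec.map (CommRingCat.ofHom (algebraMap k L)))).map φ).left :=
  MorphismProperty.of_isPullback (P := @Surjective) (isPullback_baseChange_map φ) inferInstance

/-- The projection Y_L → Y is surjective, flat and quasi-compact, and isomorphisms descend along
such morphisms. This keeps the maps of a tower from becoming isomorphisms over L. -/
lemma isIso_of_isIso_baseChange_map (φ : X ⟶ Y)
    [IsIso ((Over.pullback (Spec.map (CommRingCat.ofHom (algebraMap k L)))).map φ)] : IsIso φ := by
  have h1 : Surjective (baseChangeFst (L := L) Y).left :=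
    MorphismProperty.of_isPullback (P := @Surjective) (isPullback_baseChange (L := L) Y).flip
      inferInstance
  have h2 : Flat (baseChangeFst (L := L) Y).left :=
    MorphismProperty.of_isPullback (P := @Flat) (isPullback_baseChange (L := L) Y).flip
      inferInstance
  have h3 : QuasiCompact (baseChangeFst (L := L) Y).left :=
    MorphismProperty.of_isPullback (P := @QuasiCompact) (isPullback_baseChange (L := L) Y).flip
      inferInstance
  have : IsIso φ.left := MorphismProperty.of_isPullback_of_descendsAlong
    (P := .isomorphisms Scheme.{u}) (Q := @Surjective ⊓ @Flat ⊓ @QuasiCompact)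
    (isPullback_baseChange_map (L := L) φ).flip ⟨⟨h1, h2⟩, h3⟩
    (inferInstanceAs (IsIso ((Over.forget _).map
      ((Over.pullback (Spec.map (CommRingCat.ofHom (algebraMap k L)))).map φ))))
  have : IsIso ((Over.forget _).map φ) := this
  exact isIso_of_reflects_iso φ (Over.forget _)

end

end

end

noncomputable section

/-! ### Vanishing of the first cohomology group -/

section

open Abelian

variable {T : Type u} [TopologicalSpace T]
  (F : Sheaf (Opens.grothendieckTopology T) AddCommGrpCat.{u})

/-- The free abelian sheaf on an open set. -/
abbrev freeSheafOn (U : TopologicalSpace.Opens T) :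
    Sheaf (Opens.grothendieckTopology T) AddCommGrpCat.{u} :=
  (yoneda ⋙ (Functor.whiskeringRight _ _ _).obj AddCommGrpCat.free ⋙
    presheafToSheaf (Opens.grothendieckTopology T) AddCommGrpCat.{u}).obj U

/-- Morphisms from the free abelian sheaf on an open set are sections on this open set. -/
def freeSheafOnHomEquiv (U : TopologicalSpace.Opens T) :
    (freeSheafOn U ⟶ F) ≃ F.obj.obj (op U) :=
  (((sheafificationAdjunction (Opens.grothendieckTopology T) AddCommGrpCat.{u}).homEquiv _ _).trans
    ((AddCommGrpCat.adj.whiskerRight _).homEquiv _ _)).trans yonedaEquiv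

lemma freeSheafOnHomEquiv_naturality {U V : TopologicalSpace.Opens T} (i : V ⟶ U)
    (h : freeSheafOn U ⟶ F) :
    freeSheafOnHomEquiv F V ((yoneda ⋙ (Functor.whiskeringRight _ _ _).obj AddCommGrpCat.free ⋙
      presheafToSheaf (Opens.grothendieckTopology T) AddCommGrpCat.{u}).map i ≫ h) =
      F.obj.map i.op (freeSheafOnHomEquiv F U h) := by
  simp only [freeSheafOnHomEquiv, Equiv.trans_apply, Functor.comp_map]
  rw [Adjunction.homEquiv_naturality_left]
  refine (congrArg yonedaEquiv (Adjunction.homEquiv_naturality_left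
    (AddCommGrpCat.adj.whiskerRight (TopologicalSpace.Opens T)ᵒᵖ) (yoneda.map i) _)).trans ?_
  exact (yonedaEquiv_naturality _ i).symm

/-- The bijection is evaluation at the universal section of the free sheaf, and evaluation is
additive. -/
lemma freeSheafOnHomEquiv_sub {U : TopologicalSpace.Opens T} (g h : freeSheafOn U ⟶ F) :
    freeSheafOnHomEquiv F U (g - h) = freeSheafOnHomEquiv F U g - freeSheafOnHomEquiv F U h := by
  have h1 (f : freeSheafOn U ⟶ F) : freeSheafOnHomEquiv F U f = f.hom.app (op U)
    ((toSheafify (Opens.grothendieckTopology T) (yoneda.obj U ⋙ AddCommGrpCat.free)).app (op U)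
      ((AddCommGrpCat.adj.unit.app ((yoneda.obj U).obj (op U))) (𝟙 U))) := rfl
  rw [h1, h1, h1]
  rfl

/-- The presheaf represented by the whole space is constant. -/
def freeSheafOnTopIso : freeSheafOn (⊤ : TopologicalSpace.Opens T) ≅
    (constantSheaf (Opens.grothendieckTopology T) AddCommGrpCat.{u}).obj
      (AddCommGrpCat.of (ULift ℤ)) :=
  (presheafToSheaf _ _).mapIso (NatIso.ofComponents (fun U =>
    AddEquiv.toAddCommGrpIso
      (letI : Unique (U.unop ⟶ (⊤ : TopologicalSpace.Opens T)) :=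
        ⟨⟨homOfLE le_top⟩, fun _ => Subsingleton.elim _ _⟩
       (FreeAbelianGroup.uniqueEquiv (U.unop ⟶ (⊤ : TopologicalSpace.Opens T))).trans
        AddEquiv.ulift.symm :
        (AddCommGrpCat.free.obj (U.unop ⟶ (⊤ : TopologicalSpace.Opens T)) : Type u) ≃+
          (AddCommGrpCat.of (ULift.{u} ℤ)))) (by
      intro U V f
      refine (AddCommGrpCat.adj.homEquiv _ _).injective ?_
      ext x
      rfl))

/-- Mayer–Vietoris: the obstruction to writing s as a difference is its image under the connecting
map into H¹ of U ∪ V, the whole space, which vanishes. -/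
lemma exists_sub_eq_of_subsingleton_H [Subsingleton (F.H 1)] (U V : TopologicalSpace.Opens T)
    (hUV : U ⊔ V = ⊤) (s : F.obj.obj (op (U ⊓ V))) :
    ∃ (a : F.obj.obj (op U)) (b : F.obj.obj (op V)),
      F.obj.map (homOfLE inf_le_left : U ⊓ V ⟶ U).op a -
        F.obj.map (homOfLE inf_le_right : U ⊓ V ⟶ V).op b = s := by
  have hsub : Subsingleton (F.H' 1 (U ⊔ V)) := by
    rw [hUV]
    -- `F.H 1` is Ext out of a constant sheaf, while the Mayer–Vietoris sequence uses Ext out of the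
    -- free sheaf on ⊤. Composing with the isomorphism of these two sheaves transfers the vanishing.
    refine subsingleton_of_forall_eq 0 fun (x : Ext (freeSheafOn ⊤) F 1) => ?_
    have h1 : x = (Ext.mk₀ (freeSheafOnTopIso (T := T)).hom).comp
        ((Ext.mk₀ (freeSheafOnTopIso (T := T)).inv).comp x (zero_add 1)) (zero_add 1) := by
      rw [Ext.mk₀_comp_mk₀_assoc, Iso.hom_inv_id, Ext.mk₀_id_comp]
    have h2 : (Ext.mk₀ (freeSheafOnTopIso (T := T)).inv).comp x (zero_add 1) = 0 :=
      Subsingleton.elim (α := F.H 1) _ _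
    rw [h1, h2, Ext.comp_zero]
    rfl
  let S := Opens.mayerVietorisSquare U V
  let x : F.H' 0 (U ⊓ V) := Ext.mk₀ ((freeSheafOnHomEquiv F _).symm s)
  have hex := (S.sequence_exact F 0 1 rfl).exact 1
  have hx : S.δ F 0 1 rfl x = 0 := Subsingleton.elim (α := F.H' 1 (U ⊔ V)) _ _
  obtain ⟨y, hy⟩ := (ShortComplex.ab_exact_iff _).mp hex x hx
  obtain ⟨⟨y₁, y₂⟩, rfl⟩ :=
    (AddCommGrpCat.biprodIsoProd _ _).addCommGroupIsoToAddEquiv.symm.surjective y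
  have hy' : (F.cohomologyPresheaf 0).map S.f₁₂.op y₁ - (F.cohomologyPresheaf 0).map S.f₁₃.op y₂ =
    x := (S.fromBiprod_biprodIsoProd_inv_apply F y₁ y₂).symm.trans hy
  obtain ⟨h₁, rfl⟩ := (Ext.mk₀_bijective (freeSheafOn U) F).surjective y₁
  obtain ⟨h₂, rfl⟩ := (Ext.mk₀_bijective (freeSheafOn V) F).surjective y₂
  refine ⟨freeSheafOnHomEquiv F U h₁, freeSheafOnHomEquiv F V h₂, ?_⟩
  rw [← freeSheafOnHomEquiv_naturality, ← freeSheafOnHomEquiv_naturality, ← freeSheafOnHomEquiv_sub,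
    ← Equiv.eq_symm_apply]
  refine (Ext.mk₀_bijective _ F).injective (Eq.trans ?_ hy')
  refine (map_sub Ext.addEquiv₀.symm _ _).trans ?_
  congr 1
  · exact (Ext.mk₀_comp_mk₀ _ _).symm
  · exact (Ext.mk₀_comp_mk₀ _ _).symm

end

end

noncomputable section

/-! ### Curves of genus zero -/

section

variable {k : Type u} [Field k] [CharZero k] (X : Over (Spec (.of k))) [IsProperCurve X]

instance compactSpace_left : CompactSpace X.left :=
  QuasiCompact.compactSpace_of_compactSpace X.hom

instance noetherianSpace_left : TopologicalSpace.NoetherianSpace X.left := by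
  have : AlgebraicGeometry.IsNoetherian X.left := {}
  infer_instance

variable {X}

lemma isClosed_singleton_of_ne_genericPoint {p : X.left} (hp : p ≠ genericPoint X.left) :
    IsClosed ({p} : Set X.left) := by
  rw [← closure_subset_iff_isClosed]
  intro y hy
  rcases eq_or_eq_genericPoint_of_specializes (specializes_iff_mem_closure.mpr hy) with h | h
  · exact h.symm
  · exact absurd h hp

/-- A closed set in a noetherian space is a finite union of irreducible closed sets. The generic
point of each one differs from that of the curve, so it is a closed point. -/
lemma finite_of_isClosed_of_genericPoint_notMem {Z : Set X.left} (hZ : IsClosed Z)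
    (h : genericPoint X.left ∉ Z) : Z.Finite := by
  obtain ⟨S, hS, hS1, hS2, rfl⟩ :=
    TopologicalSpace.NoetherianSpace.exists_finite_set_isClosed_irreducible hZ
  refine hS.sUnion fun t ht => ?_
  obtain ⟨p, hp⟩ := QuasiSober.sober (hS2 t ht) (hS1 t ht)
  have hpt : p ∈ t := hp.mem
  have hne : p ≠ genericPoint X.left := by
    rintro rfl
    exact h ⟨t, ht, hpt⟩
  have h1 : t = {p} := by
    rw [← hp.def, (isClosed_singleton_of_ne_genericPoint hne).closure_eq]
  rw [h1]
  exact Set.finite_singleton p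

/-- The complement of a point other than the generic point. -/
def complOpen {p : X.left} (hp : p ≠ genericPoint X.left) : X.left.Opens :=
  ⟨{p}ᶜ, (isClosed_singleton_of_ne_genericPoint hp).isOpen_compl⟩

lemma genericPoint_mem_complOpen {p : X.left} (hp : p ≠ genericPoint X.left) :
    genericPoint X.left ∈ complOpen hp := fun h => hp h.symm

variable (X) in
/-- The functions that are regular on an open set. -/
def sectionsSubalgebra (U : X.left.Opens) (hU : genericPoint X.left ∈ U) :
    Subalgebra k X.left.functionField where
  __ := (X.left.presheaf.germ U _ hU).hom.range
  algebraMap_mem' a := ⟨_, germ_scalarsToSections X U hU a⟩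

variable (X) in
/-- The functions that are regular at a point. -/
def stalkSubalgebra (p : X.left) : Subalgebra k X.left.functionField where
  __ := (X.left.presheaf.stalkSpecializes (genericPoint_specializes p)).hom.range
  algebraMap_mem' a := ⟨X.left.presheaf.germ ⊤ p (TopologicalSpace.Opens.mem_top _)
    (scalarsToSections X ⊤ a), by
    rw [← germ_scalarsToSections X ⊤ (TopologicalSpace.Opens.mem_top _) a]
    exact X.left.presheaf.germ_stalkSpecializes_apply _ _ _⟩

lemma mem_of_isOpen_of_nonempty {U : X.left.Opens} {p : X.left} (hp : p ∈ U) :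
    genericPoint X.left ∈ U := (genericPoint_specializes p).mem_open U.2 hp

lemma mem_stalkSubalgebra_iff_exists {p : X.left} {f : X.left.functionField} :
    f ∈ stalkSubalgebra X p ↔ ∃ (U : X.left.Opens) (hp : p ∈ U) (s : Γ(X.left, U)),
      X.left.presheaf.germ U _ (mem_of_isOpen_of_nonempty hp) s = f := by
  constructor
  · rintro ⟨s, rfl⟩
    obtain ⟨U, hU, s, rfl⟩ := X.left.presheaf.exists_germ_eq s
    exact ⟨U, hU, s, (X.left.presheaf.germ_stalkSpecializes_apply _ _ _).symm⟩
  · rintro ⟨U, hU, s, rfl⟩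
    exact ⟨_, X.left.presheaf.germ_stalkSpecializes_apply hU _ s⟩

/-- Genus zero means that any principal part at p is that of a function regular elsewhere. If f is
regular on W, the open sets X \ {p} and W ∪ {p} cover X and meet inside W; vanishing of H¹ splits f
on the overlap. -/
lemma exists_add_eq_of_curveGenus_eq_zero (hX : curveGenus X = 0) {p : X.left}
    (hp : p ≠ genericPoint X.left) (f : X.left.functionField) :
    ∃ s ∈ sectionsSubalgebra X (complOpen hp) (genericPoint_mem_complOpen hp),
      ∃ o ∈ stalkSubalgebra X p, s + o = f := by
  have : Subsingleton ((structureSheafAb X.left).H 1) :=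
    (rank_zero_iff.mp (Cardinal.toENat_eq_zero.mp hX) :
      Subsingleton (structureCohomology X 1))
  obtain ⟨W, hW, w, hw⟩ := X.left.presheaf.exists_germ_eq (x := genericPoint X.left) f
  have hfin : ((W : Set X.left)ᶜ \ {p}).Finite :=
    (finite_of_isClosed_of_genericPoint_notMem W.2.isClosed_compl
      (fun h => h hW)).subset Set.sdiff_subset
  have hcl : IsClosed ((W : Set X.left)ᶜ \ {p}) := by
    rw [← Set.biUnion_of_singleton ((W : Set X.left)ᶜ \ {p})]
    refine hfin.isClosed_biUnion fun q hq => isClosed_singleton_of_ne_genericPoint ?_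
    rintro rfl
    exact hq.1 hW
  let V : X.left.Opens := ⟨_, hcl.isOpen_compl⟩
  have hpV : p ∈ V := fun h => h.2 rfl
  have hUV : complOpen hp ⊔ V = ⊤ := by
    refine top_le_iff.mp fun q _ => ?_
    by_cases hq : q = p
    · exact Or.inr (hq ▸ hpV)
    · exact Or.inl hq
  have hle : complOpen hp ⊓ V ≤ W := by
    intro q hq
    by_contra h
    exact hq.2 ⟨h, hq.1⟩
  have hξ : genericPoint X.left ∈ complOpen hp ⊓ V :=
    ⟨genericPoint_mem_complOpen hp, mem_of_isOpen_of_nonempty hpV⟩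
  obtain ⟨a, b, hab⟩ : ∃ (a : Γ(X.left, complOpen hp)) (b : Γ(X.left, V)),
      X.left.presheaf.map (homOfLE inf_le_left : complOpen hp ⊓ V ⟶ complOpen hp).op a -
        X.left.presheaf.map (homOfLE inf_le_right : complOpen hp ⊓ V ⟶ V).op b =
      X.left.presheaf.map (homOfLE hle).op w :=
    exists_sub_eq_of_subsingleton_H (structureSheafAb X.left) (complOpen hp) V
      hUV (X.left.presheaf.map (homOfLE hle).op w)
  refine ⟨_, ⟨a, rfl⟩, _, neg_mem (mem_stalkSubalgebra_iff_exists.mpr ⟨V, hpV, b, rfl⟩), ?_⟩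
  have h1 := congrArg (X.left.presheaf.germ _ _ hξ) hab
  rw [map_sub, TopCat.Presheaf.germ_res_apply, TopCat.Presheaf.germ_res_apply,
    TopCat.Presheaf.germ_res_apply] at h1
  rw [← hw, ← sub_eq_add_neg]
  exact h1

end

end

noncomputable section

open Polynomial TensorProduct

/-! ### Constants and local rings of curves -/

/-- If `K(f) ⊗ F` is a domain for an integral element `f` of `F`, then `f` is in `K`. -/
lemma mem_range_algebraMap_of_isDomain_tensorProduct {K F : Type*} [Field K] [Field F] [Algebra K F]
    {f : F} (hf : IsIntegral K f)
    (hd : IsDomain (IntermediateField.adjoin K {f} ⊗[K] F)) :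
    f ∈ (algebraMap K F).range := by
  let L := IntermediateField.adjoin K {f}
  have hfd : FiniteDimensional K L := IntermediateField.adjoin.finiteDimensional hf
  have hinj : Function.Injective (Algebra.TensorProduct.map (AlgHom.id K L) L.val) :=
    Module.Flat.lTensor_preserves_injective_linearMap (M := L) L.val.toLinearMap
      L.val.injective
  have hd' : IsDomain (L ⊗[K] L) :=
    hinj.isDomain (Algebra.TensorProduct.map (AlgHom.id K L) L.val).toRingHom
  -- L ⊗ L embeds into L ⊗ F, so it is a domain, and being integral over K it is a field.
  -- Multiplication L ⊗ L → L is then injective, so [L : K]² ≤ [L : K].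
  have hfield := isField_of_isIntegral_of_isField' (R := K) (S := L ⊗[K] L) (Field.toIsField K)
  have hinj2 : Function.Injective (Algebra.TensorProduct.lmul' K (S := L)) := by
    rw [injective_iff_map_eq_zero]
    intro x hx
    by_contra hx0
    obtain ⟨y, hy⟩ := hfield.mul_inv_cancel hx0
    have h1 := congrArg (Algebra.TensorProduct.lmul' K (S := L)) hy
    rw [map_mul, hx, zero_mul, map_one] at h1
    exact zero_ne_one h1
  have h1 := LinearMap.finrank_le_finrank_of_injective
    (f := (Algebra.TensorProduct.lmul' K (S := L)).toLinearMap) hinj2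
  rw [Module.finrank_tensorProduct] at h1
  have h2 : Module.finrank K L = 1 := by
    have : 0 < Module.finrank K L := Module.finrank_pos
    nlinarith
  have h3 : f ∈ (⊥ : IntermediateField K F) := by
    rw [← IntermediateField.finrank_eq_one_iff.mp h2]
    exact IntermediateField.mem_adjoin_simple_self K f
  obtain ⟨a, ha⟩ := IntermediateField.mem_bot.mp h3
  exact ⟨a, ha⟩

/-- A uniformizer, and a generator of the residue field. -/
lemma exists_uniformizer_and_residue_generator {k A F : Type*} [Field k] [CharZero k] [CommRing A]
    [IsDomain A] [IsLocalRing A] [IsPrincipalIdealRing A] (hA : ¬ IsField A) [Algebra k A]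
    [FiniteDimensional k (IsLocalRing.ResidueField A)] [Field F] [Algebra A F]
    [IsFractionRing A F] :
    ∃ (t θ : A) (g : k[X]), t ≠ 0 ∧ IsLocalRing.maximalIdeal A = Ideal.span {t} ∧ g.Monic ∧
      Irreducible g ∧ t ∣ aeval θ g ∧ (∀ x : A, ∃ q : k[X], t ∣ x - aeval θ q) ∧
      ∀ f : F, ∃ (n : ℕ) (a : A), algebraMap A F t ^ n * f = algebraMap A F a := by
  obtain ⟨t, ht⟩ := (IsPrincipalIdealRing.principal (IsLocalRing.maximalIdeal A)).principal
  rw [Ideal.submodule_span_eq] at ht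
  have ht0 : t ≠ 0 := by
    rintro rfl
    rw [Ideal.span_singleton_zero] at ht
    exact hA (IsLocalRing.isField_iff_maximalIdeal_eq.mpr ht)
  obtain ⟨θ', hθ'⟩ := Field.exists_primitive_element k (IsLocalRing.ResidueField A)
  obtain ⟨θ, rfl⟩ := IsLocalRing.residue_surjective θ'
  have hres (q : k[X]) : IsLocalRing.residue A (aeval θ q) = aeval (IsLocalRing.residue A θ) q :=
    (aeval_algHom_apply (IsScalarTower.toAlgHom k A (IsLocalRing.ResidueField A)) θ q).symm
  have hdvd (x : A) : t ∣ x ↔ IsLocalRing.residue A x = 0 := by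
    rw [IsLocalRing.residue_eq_zero_iff, ht, Ideal.mem_span_singleton]
  have hint := Algebra.IsIntegral.isIntegral (R := k) (IsLocalRing.residue A θ)
  refine ⟨t, θ, minpoly k (IsLocalRing.residue A θ), ht0, ht, minpoly.monic hint,
    minpoly.irreducible hint, ?_, fun x => ?_, fun f => ?_⟩
  · rw [hdvd, hres, minpoly.aeval]
  · have h1 : IsLocalRing.residue A x ∈ IntermediateField.adjoin k {IsLocalRing.residue A θ} :=
      hθ' ▸ IntermediateField.mem_top
    rw [← IntermediateField.mem_toSubalgebra,
      IntermediateField.adjoin_simple_toSubalgebra_of_isAlgebraic hint.isAlgebraic,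
      Algebra.adjoin_singleton_eq_range_aeval] at h1
    obtain ⟨q, hq⟩ := h1
    refine ⟨q, ?_⟩
    rw [hdvd, map_sub, hres, sub_eq_zero]
    exact hq.symm
  · obtain ⟨n, d, hd, rfl⟩ := IsFractionRing.div_surjective (A := A) f
    have hd0 := nonZeroDivisors.ne_zero hd
    have hti : Irreducible t := by
      refine (Ideal.span_singleton_prime ht0).mp ?_ |>.irreducible
      rw [← ht]
      infer_instance
    have htu : ¬ IsUnit t := hti.not_isUnit
    obtain ⟨m, c, hc, rfl⟩ := WfDvdMonoid.max_power_factor hd0 hti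
    have hcu : IsUnit c := by
      by_contra h
      have := (IsLocalRing.mem_maximalIdeal c).mpr h
      rw [ht, Ideal.mem_span_singleton] at this
      exact hc this
    obtain ⟨c', rfl⟩ := hcu
    refine ⟨m, n * (c'⁻¹ : Aˣ), ?_⟩
    have h1 : algebraMap A F t ≠ 0 := by simpa using ht0
    have h2 : algebraMap A F (c' : A) ≠ 0 := by simp
    have h3 : algebraMap A F (c' : A) * algebraMap A F ((c'⁻¹ : Aˣ) : A) = 1 := by
      rw [← map_mul, Units.mul_inv, map_one]
    simp only [map_mul, map_pow]
    field_simp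
    linear_combination -(algebraMap A F n) * h3

section

variable {k : Type u} [Field k] [CharZero k] {X : Over (Spec (.of k))} [IsProperCurve X]

/-- This is where geometric connectedness acts: over L = k(f) the curve remains integral, with
function field L ⊗ k(X), so this tensor product is a domain. That forces L = k. -/
lemma mem_range_algebraMap_of_isIntegral {f : X.left.functionField} (hf : IsIntegral k f) :
    f ∈ (algebraMap k X.left.functionField).range := by
  let L := IntermediateField.adjoin k {f}
  have hfd : FiniteDimensional k L := IntermediateField.adjoin.finiteDimensional hf
  have : CharZero L := algebraRat.charZero L
  have : IsProperCurve (baseChangeObj L X) := by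
    unfold baseChangeObj
    infer_instance
  obtain ⟨e⟩ := nonempty_algEquiv_functionField_baseChange (K := k) (L := L) (X := X)
  exact mem_range_algebraMap_of_isDomain_tensorProduct hf (e.injective.isDomain e.toRingHom)

/-- A function regular both off p and near p glues to a global section. Global sections are integral
over k because X → Spec k is universally closed. -/
lemma isIntegral_of_mem_sections_of_mem_stalk {p : X.left} (hp : p ≠ genericPoint X.left)
    {f : X.left.functionField}
    (hs : f ∈ sectionsSubalgebra X (complOpen hp) (genericPoint_mem_complOpen hp))
    (ho : f ∈ stalkSubalgebra X p) : IsIntegral k f := by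
  obtain ⟨s, hs⟩ := hs
  obtain ⟨V, hV, w, hw⟩ := mem_stalkSubalgebra_iff_exists.mp ho
  have hcov : (⊤ : X.left.Opens) ≤ complOpen hp ⊔ V := by
    refine fun q _ => ?_
    by_cases hq : q = p
    · exact Or.inr (hq ▸ hV)
    · exact Or.inl hq
  obtain ⟨z, hz⟩ : ∃ z : Γ(X.left, ⊤), X.left.presheaf.germ ⊤ _ (TopologicalSpace.Opens.mem_top _) z = f := by
    have hξ : genericPoint X.left ∈ complOpen hp ⊓ V :=
      ⟨genericPoint_mem_complOpen hp, mem_of_isOpen_of_nonempty hV⟩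
    have hsw : X.left.presheaf.map (homOfLE inf_le_left : complOpen hp ⊓ V ⟶ complOpen hp).op s =
        X.left.presheaf.map (homOfLE inf_le_right : complOpen hp ⊓ V ⟶ V).op w := by
      refine germ_injective_of_isIntegral X.left _ hξ ?_
      rw [TopCat.Presheaf.germ_res_apply, TopCat.Presheaf.germ_res_apply]
      exact hs.trans hw.symm
    let z₀ : Γ(X.left, complOpen hp ⊔ V) :=
      (X.left.sheaf.objSupIsoProdEqLocus (complOpen hp) V).inv ⟨(s, w), hsw⟩
    have hz₀ : X.left.presheaf.map (homOfLE le_sup_left : complOpen hp ⟶ complOpen hp ⊔ V).op z₀ =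
      s := X.left.sheaf.objSupIsoProdEqLocus_inv_fst (complOpen hp) V ⟨(s, w), hsw⟩
    refine ⟨X.left.presheaf.map (homOfLE hcov).op z₀, ?_⟩
    rw [TopCat.Presheaf.germ_res_apply]
    rw [← hs, ← hz₀]
    exact (TopCat.Presheaf.germ_res_apply _ _ _ _ _).symm
  obtain ⟨q, hq, hq0⟩ := isIntegral_appTop_of_universallyClosed X.hom z
  let ι : Γ(X.left, ⊤) →+* X.left.functionField :=
    (X.left.presheaf.germ ⊤ _ (TopologicalSpace.Opens.mem_top _)).hom
  have h2 : ι.comp (X.hom.appTop.hom.comp (Scheme.ΓSpecIso (.of k)).inv.hom) =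
      algebraMap k X.left.functionField := by
    ext a
    rw [← germ_scalarsToSections X ⊤ (TopologicalSpace.Opens.mem_top _) a]
    change ι _ = ι _
    congr 1
    change _ = X.left.presheaf.map (𝟙 _) _
    rw [X.left.presheaf.map_id]
    rfl
  have h3 : RingHom.comp (algebraMap k X.left.functionField)
      (Scheme.ΓSpecIso (.of k)).hom.hom = ι.comp X.hom.appTop.hom := by
    rw [← h2]
    ext a
    change ι (X.hom.appTop.hom (((Scheme.ΓSpecIso (.of k)).hom ≫ (Scheme.ΓSpecIso (.of k)).inv) a)) = _
    rw [Iso.hom_inv_id]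
    rfl
  refine ⟨q.map (Scheme.ΓSpecIso (.of k)).hom.hom, hq.map _, ?_⟩
  rw [eval₂_map, h3, ← hz]
  refine (hom_eval₂ q _ ι z).symm.trans ?_
  rw [hq0, map_zero]

end

end

noncomputable section

open Polynomial

/-! ### The function field of a curve of genus zero -/

/-- Two subalgebras `S` and `O` of a field `F` which behave like the functions on a curve of genus
zero that are regular outside a point, respectively at this point, together with a uniformizer `t`
of `O` and a generator `θ` of the residue field of `O` with minimal polynomial `g`. -/
structure IsGenusZeroPair {k F : Type*} [Field k] [Field F] [Algebra k F] (S O : Subalgebra k F)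
    (t θ : F) (g : k[X]) : Prop where
  exists_add_eq (f : F) : ∃ s ∈ S, ∃ o ∈ O, s + o = f
  mem_range (f : F) : f ∈ S → f ∈ O → f ∈ (algebraMap k F).range
  exists_mul_mem (f : F) : ∃ s ∈ S, s ≠ 0 ∧ f * s ∈ S
  exists_pow_mul_mem (f : F) : ∃ n : ℕ, t ^ n * f ∈ O
  ne_zero : t ≠ 0
  mem : t ∈ O
  inv_notMem : t⁻¹ ∉ O
  mem' : θ ∈ O
  monic : g.Monic
  irreducible : Irreducible g
  inv_mul_aeval_mem : t⁻¹ * aeval θ g ∈ O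
  exists_inv_mul_sub_mem (x : F) : x ∈ O → ∃ q : k[X], t⁻¹ * (x - aeval θ q) ∈ O

section

variable {k : Type u} [Field k] (X : Over (Spec (.of k)))

/-- The local rings of a scheme over `k` as `k`-algebras. -/
abbrev stalkAlgebra (p : X.left) : Algebra k (X.left.presheaf.stalk p) :=
  ((X.left.presheaf.germ ⊤ p (TopologicalSpace.Opens.mem_top _)).hom.comp
    (scalarsToSections X ⊤)).toAlgebra

lemma fromSpecStalk_comp_hom (p : X.left) :
    letI := stalkAlgebra X p
    X.left.fromSpecStalk p ≫ X.hom =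
      Spec.map (CommRingCat.ofHom (algebraMap k (X.left.presheaf.stalk p))) := by
  let := stalkAlgebra X p
  have h : X.hom = X.left.toSpecΓ ≫ Spec.map ((Scheme.ΓSpecIso (.of k)).inv ≫ X.hom.appTop) := by
    rw [Spec.map_comp, ← Scheme.toSpecΓ_naturality_assoc]
    simp
  have h2 : CommRingCat.ofHom (algebraMap k (X.left.presheaf.stalk p)) =
      ((Scheme.ΓSpecIso (.of k)).inv ≫ X.hom.appTop) ≫
      X.left.presheaf.germ ⊤ p (TopologicalSpace.Opens.mem_top _) := by
    ext a
    change X.left.presheaf.germ ⊤ _ _ (X.left.presheaf.map (𝟙 _) _) = _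
    rw [X.left.presheaf.map_id]
    rfl
  rw [h, ← Category.assoc, Scheme.fromSpecStalk_toSpecΓ, ← Spec.map_comp, h2]

lemma germ_scalarsToSections_stalk {p : X.left} {V : X.left.Opens} (hV : p ∈ V) (a : k) :
    letI := stalkAlgebra X p
    X.left.presheaf.germ V p hV (scalarsToSections X V a) =
      algebraMap k (X.left.presheaf.stalk p) a := by
  rw [← map_scalarsToSections X (homOfLE (le_top : V ≤ ⊤)),
    X.left.presheaf.germ_res_apply]
  rfl

lemma finite_residueField_of_isClosed [LocallyOfFiniteType X.hom] {p : X.left}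
    (hp : IsClosed ({p} : Set X.left)) :
    letI := stalkAlgebra X p
    FiniteDimensional k (IsLocalRing.ResidueField (X.left.presheaf.stalk p)) := by
  let := stalkAlgebra X p
  have := isClosed_singleton_iff_isClosedImmersion.mp hp
  have h1 : IsFinite (X.left.fromSpecResidueField p ≫ X.hom) :=
    isFinite_iff_locallyOfFiniteType_of_jacobsonSpace.mpr inferInstance
  have h2 : X.left.fromSpecResidueField p ≫ X.hom = Spec.map
      (CommRingCat.ofHom (algebraMap k (X.left.presheaf.stalk p)) ≫ X.left.residue p) := by
    rw [Spec.map_comp, ← fromSpecStalk_comp_hom X p]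
    exact Category.assoc _ _ _
  rw [h2, IsFinite.SpecMap_iff] at h1
  exact h1

lemma exists_polynomial_eval₂_mem_maximalIdeal [LocallyOfFiniteType X.hom] {p : X.left}
    (hp : IsClosed ({p} : Set X.left)) (y : X.left.presheaf.stalk p) :
    letI := stalkAlgebra X p
    ∃ g : k[X], g ≠ 0 ∧ aeval y g ∈ IsLocalRing.maximalIdeal (X.left.presheaf.stalk p) := by
  let := stalkAlgebra X p
  have := finite_residueField_of_isClosed X hp
  have hint := Algebra.IsIntegral.isIntegral (R := k) (IsLocalRing.residue _ y)
  refine ⟨_, minpoly.ne_zero hint, ?_⟩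
  rw [← IsLocalRing.residue_eq_zero_iff]
  exact (aeval_algHom_apply (IsScalarTower.toAlgHom k (X.left.presheaf.stalk p)
    (IsLocalRing.ResidueField (X.left.presheaf.stalk p))) y _).symm.trans (minpoly.aeval _ _)

end

section

variable {k : Type u} [Field k] [CharZero k] {X : Over (Spec (.of k))} [IsProperCurve X]

lemma not_isField_stalk {p : X.left} (hp : p ≠ genericPoint X.left) :
    ¬ IsField (X.left.presheaf.stalk p) := by
  intro h
  have h1 : genericPoint X.left ∈ Set.range (X.left.fromSpecStalk p) := by
    rw [Scheme.range_fromSpecStalk]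
    exact genericPoint_specializes p
  obtain ⟨q, hq⟩ := h1
  have h2 : q.asIdeal ≤ IsLocalRing.maximalIdeal (X.left.presheaf.stalk p) :=
    IsLocalRing.le_maximalIdeal (PrimeSpectrum.isPrime (R := X.left.presheaf.stalk p) q).ne_top
  have h4 := IsLocalRing.isField_iff_maximalIdeal_eq.mp h
  have h3 : q = IsLocalRing.closedPoint (X.left.presheaf.stalk p) :=
    PrimeSpectrum.ext (le_antisymm h2 (h4.le.trans bot_le))
  rw [h3] at hq
  exact hp (Scheme.fromSpecStalk_closedPoint.symm.trans hq)

/-- Affineness of X \ {p} is not needed: denominators are polynomials in one nonconstant regular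
function b. At each of the finitely many points outside the domain W of f, residue fields are finite
over k, so a nonzero polynomial in b vanishes there. The product d of these is nonzero because b is
transcendental, and a power of d clears the poles of f. -/
lemma exists_mul_mem_sectionsSubalgebra {p : X.left} (hp : p ≠ genericPoint X.left)
    {b₀ : X.left.functionField}
    (hb : b₀ ∈ sectionsSubalgebra X (complOpen hp) (genericPoint_mem_complOpen hp))
    (hb' : b₀ ∉ (algebraMap k X.left.functionField).range) (f : X.left.functionField) :
    ∃ s ∈ sectionsSubalgebra X (complOpen hp) (genericPoint_mem_complOpen hp),
      s ≠ 0 ∧ f * s ∈ sectionsSubalgebra X (complOpen hp) (genericPoint_mem_complOpen hp) := by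
  obtain ⟨b, hb⟩ := hb
  obtain ⟨W, hW, w, hw⟩ := X.left.presheaf.exists_germ_eq (x := genericPoint X.left) f
  let U := complOpen hp
  let c : k →+* Γ(X.left, U) := scalarsToSections X U
  have hξU := genericPoint_mem_complOpen hp
  have hfin : (W : Set X.left)ᶜ.Finite :=
    finite_of_isClosed_of_genericPoint_notMem W.2.isClosed_compl (fun h => h hW)
  have hg (q : X.left) : ∃ g : k[X], g ≠ 0 ∧ ∀ hq : q ∈ U, q ∉ W →
      ¬ IsUnit (X.left.presheaf.germ U q hq (eval₂ c b g)) := by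
    by_cases hq : q ∈ U ∧ q ∉ W
    · have hqξ : q ≠ genericPoint X.left := by
        rintro rfl
        exact hq.2 hW
      let := stalkAlgebra X q
      obtain ⟨g, hg, hm⟩ := exists_polynomial_eval₂_mem_maximalIdeal X
        (isClosed_singleton_of_ne_genericPoint hqξ) (X.left.presheaf.germ U q hq.1 b)
      refine ⟨g, hg, fun hqU _ hu => (IsLocalRing.mem_maximalIdeal _).mp hm ?_⟩
      convert hu using 1
      refine Eq.trans ?_ (hom_eval₂ g c (X.left.presheaf.germ U q hqU).hom b).symm
      rw [aeval_def]
      congr 1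
      ext a
      exact (germ_scalarsToSections_stalk X hqU a).symm
    · exact ⟨1, one_ne_zero, fun h1 h2 => absurd ⟨h1, h2⟩ hq⟩
  choose g hg0 hg using hg
  let G : k[X] := ∏ q ∈ hfin.toFinset, g q
  have hG0 : G ≠ 0 := Finset.prod_ne_zero_iff.mpr fun q _ => hg0 q
  let d : Γ(X.left, U) := eval₂ c b G
  have hdW : X.left.basicOpen d ≤ W := by
    intro q hq
    by_contra hqW
    obtain ⟨hqU, hu⟩ := (X.left.mem_basicOpen'' d q).mp hq
    have hdvd : eval₂ c b (g q) ∣ d :=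
      (eval₂RingHom c b).map_dvd (Finset.dvd_prod_of_mem g (hfin.mem_toFinset.mpr hqW))
    exact hg q hqU hqW (isUnit_of_dvd_unit (map_dvd _ hdvd) hu)
  have hgerm (q : k[X]) : (X.left.presheaf.germ U _ hξU) (eval₂ c b q) =
      aeval ((X.left.presheaf.germ U _ hξU) b) q := by
    refine (hom_eval₂ q c (X.left.presheaf.germ U _ hξU).hom b).trans ?_
    rw [aeval_def]
    congr 1
    ext a
    exact germ_scalarsToSections X U hξU a
  have hd0 : X.left.presheaf.germ U _ hξU d ≠ 0 := by
    intro h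
    refine hb' (mem_range_algebraMap_of_isIntegral (k := k) ?_)
    rw [← isAlgebraic_iff_isIntegral]
    exact ⟨G, hG0, (congrArg (aeval · G) hb).symm.trans ((hgerm G).symm.trans h)⟩
  have hξd : genericPoint X.left ∈ X.left.basicOpen d := by
    refine (X.left.mem_basicOpen'' d _).mpr ⟨hξU, ?_⟩
    exact IsUnit.mk0 (G₀ := X.left.functionField) _ hd0
  obtain ⟨n, y, hy⟩ := exists_eq_pow_mul_of_isCompact_of_isQuasiSeparated X.left U
    (TopologicalSpace.NoetherianSpace.isCompact _)
    (IsQuasiSeparated.of_quasiSeparatedSpace _) d (X.left.presheaf.map (homOfLE hdW).op w)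
  refine ⟨_, ⟨d ^ n, rfl⟩, ?_, y, ?_⟩
  · refine (map_pow (X.left.presheaf.germ U _ hξU).hom d n).trans_ne ?_
    exact pow_ne_zero (M₀ := X.left.functionField) n hd0
  · have h1 := congrArg (X.left.presheaf.germ _ _ hξd) hy
    rw [map_mul, map_pow] at h1
    dsimp only [TopCat.Presheaf.restrictOpenCommRingCat_apply] at h1
    rw [TopCat.Presheaf.germ_res_apply, TopCat.Presheaf.germ_res_apply] at h1
    refine h1.trans ?_
    refine (mul_comm _ _).trans (congrArg₂ (· * ·) ?_ ?_)
    · exact (TopCat.Presheaf.germ_res_apply _ _ _ _ _).trans hw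
    · exact (map_pow (X.left.presheaf.germ U _ hξU).hom d n).symm

end

end

/-! ### Genus zero pairs attached to closed points and to rational points -/

noncomputable section

open Polynomial

/-- A k-point is a local homomorphism from the local ring at its image to k; compatibility with the
structure maps makes it a retraction of scalars. It is the form in which rationality of a point is
used below. -/
lemma exists_retraction_stalk {k : Type u} [Field k] {X : Over (Spec (.of k))}
    (Q : Over.mk (𝟙 (Spec (.of k))) ⟶ X) :
    ∃ (p : X.left) (ρ : X.left.presheaf.stalk p →+* k), IsLocalHom ρ ∧
      ∀ a, ρ (letI := stalkAlgebra X p; algebraMap k (X.left.presheaf.stalk p) a) = a := by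
  let f : Spec (.of k) ⟶ X.left := Q.left
  refine ⟨f (IsLocalRing.closedPoint k), (Scheme.stalkClosedPointTo f).hom, inferInstance,
    fun a => ?_⟩
  let := stalkAlgebra X (f (IsLocalRing.closedPoint k))
  have h1 : Spec.map (CommRingCat.ofHom (algebraMap k
      (X.left.presheaf.stalk (f (IsLocalRing.closedPoint k)))) ≫ Scheme.stalkClosedPointTo f) =
      Spec.map (𝟙 _) := by
    rw [Spec.map_comp, ← fromSpecStalk_comp_hom, Spec.map_id]
    refine (Category.assoc _ _ _).symm.trans ?_
    rw [Scheme.Spec_stalkClosedPointTo_fromSpecStalk]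
    exact Over.w Q
  exact congr($(Spec.map_injective h1).hom a)

section

variable {k : Type u} [Field k] [CharZero k] {X : Over (Spec (.of k))} [IsProperCurve X]

lemma isScalarTower_stalkAlgebra (p : X.left) :
    letI := stalkAlgebra X p
    IsScalarTower k (X.left.presheaf.stalk p) X.left.functionField := by
  let := stalkAlgebra X p
  refine IsScalarTower.of_algebraMap_eq fun a => ?_
  exact (X.left.presheaf.germ_stalkSpecializes_apply (TopologicalSpace.Opens.mem_top p)
    (genericPoint_specializes p) (scalarsToSections X ⊤ a)).symm

/-- The pair consists of the functions regular off p and of the local ring at p, with t a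
uniformizer, θ a lift of a generator of the residue field and g its minimal polynomial. At a
rational point the value of θ is a root of g in k, so the irreducible g is linear. -/
lemma exists_isGenusZeroPair (hX : curveGenus X = 0) {p : X.left}
    (hp : p ≠ genericPoint X.left) :
    ∃ (S O : Subalgebra k X.left.functionField) (t θ : X.left.functionField) (g : k[X]),
      IsGenusZeroPair S O t θ g ∧
      ((∃ ρ : X.left.presheaf.stalk p →+* k, IsLocalHom ρ ∧
        ∀ a, ρ (letI := stalkAlgebra X p; algebraMap k (X.left.presheaf.stalk p) a) = a) →
        g.natDegree = 1) := by
  let := stalkAlgebra X p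
  have := isScalarTower_stalkAlgebra (k := k) p
  have := finite_residueField_of_isClosed X (isClosed_singleton_of_ne_genericPoint hp)
  obtain ⟨t, θ, g, ht0, ht, hgm, hgi, htg, hq, hpow⟩ :=
    exists_uniformizer_and_residue_generator (k := k) (A := X.left.presheaf.stalk p)
      (F := X.left.functionField) (not_isField_stalk hp)
  let ι : X.left.presheaf.stalk p →ₐ[k] X.left.functionField := IsScalarTower.toAlgHom k _ _
  have hι : Function.Injective ι := IsFractionRing.injective (X.left.presheaf.stalk p) _
  have hO (a : X.left.presheaf.stalk p) : ι a ∈ stalkSubalgebra X p := ⟨a, rfl⟩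
  have ht0' : ι t ≠ 0 := by rwa [Ne, map_eq_zero_iff ι hι]
  have hinv : (ι t)⁻¹ ∉ stalkSubalgebra X p := by
    rintro ⟨a, ha⟩
    have h1 : ι (t * a) = ι 1 := by
      rw [map_mul, map_one]
      exact (congrArg (ι t * ·) ha).trans (mul_inv_cancel₀ ht0')
    have h2 : t ∈ IsLocalRing.maximalIdeal (X.left.presheaf.stalk p) :=
      ht ▸ Ideal.mem_span_singleton_self t
    exact (IsLocalRing.mem_maximalIdeal t).mp h2 (.of_mul_eq_one a (hι h1))
  have hdvd {a : X.left.presheaf.stalk p} (h : t ∣ a) : (ι t)⁻¹ * ι a ∈ stalkSubalgebra X p := by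
    obtain ⟨c, rfl⟩ := h
    rw [map_mul, inv_mul_cancel_left₀ ht0']
    exact hO c
  refine ⟨sectionsSubalgebra X (complOpen hp) (genericPoint_mem_complOpen hp),
    stalkSubalgebra X p, ι t, ι θ, g, ⟨exists_add_eq_of_curveGenus_eq_zero hX hp,
    fun f hs ho => mem_range_algebraMap_of_isIntegral
      (isIntegral_of_mem_sections_of_mem_stalk hp hs ho), ?_, fun f => ?_,
    ht0', hO t, hinv, hO θ, hgm, hgi, ?_, ?_⟩, ?_⟩
  -- The nonconstant function required for denominators is the one with principal part 1/t: were it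
  -- constant, 1/t would be regular at p.
  · obtain ⟨s, hs, o, ho, hso⟩ := exists_add_eq_of_curveGenus_eq_zero hX hp (ι t)⁻¹
    refine exists_mul_mem_sectionsSubalgebra hp hs fun ⟨a, ha⟩ => hinv ?_
    rw [← hso, ← ha]
    exact add_mem (Subalgebra.algebraMap_mem _ a) ho
  · obtain ⟨n, a, h⟩ := hpow f
    exact ⟨n, h ▸ hO a⟩
  · rw [aeval_algHom_apply]
    exact hdvd htg
  · rintro _ ⟨x, rfl⟩
    obtain ⟨q, h⟩ := hq x
    refine ⟨q, ?_⟩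
    have h1 := hdvd h
    rwa [map_sub, ← aeval_algHom_apply] at h1
  · rintro ⟨ρ, hρ, hρ'⟩
    refine natDegree_eq_of_degree_eq_some (degree_eq_one_of_irreducible_of_root hgi
      (x := ρ θ) ?_)
    have h1 : ρ (aeval θ g) = 0 := by
      by_contra h
      have h2 : aeval θ g ∈ IsLocalRing.maximalIdeal (X.left.presheaf.stalk p) := by
        rw [ht]
        exact Ideal.mem_span_singleton.mpr htg
      exact (IsLocalRing.mem_maximalIdeal _).mp h2 (hρ.map_nonunit _ (IsUnit.mk0 _ h))
    rw [aeval_def, hom_eval₂] at h1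
    rwa [show ρ.comp (algebraMap k (X.left.presheaf.stalk p)) = RingHom.id k from
      RingHom.ext hρ'] at h1

lemma exists_mem_functionField_notMem_range {p : X.left} (hp : p ≠ genericPoint X.left) :
    ∃ f : X.left.functionField, f ∉ (algebraMap k X.left.functionField).range := by
  let := stalkAlgebra X p
  have := isScalarTower_stalkAlgebra (k := k) p
  obtain ⟨t, ht, htu⟩ : ∃ t : X.left.presheaf.stalk p, t ≠ 0 ∧ ¬ IsUnit t := by
    by_contra! h
    exact not_isField_stalk hp
      ⟨⟨0, 1, zero_ne_one⟩, mul_comm, fun h0 => (h _ h0).exists_right_inv⟩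
  refine ⟨algebraMap (X.left.presheaf.stalk p) _ t, ?_⟩
  rintro ⟨a, ha⟩
  rw [IsScalarTower.algebraMap_apply k (X.left.presheaf.stalk p)] at ha
  have h1 := IsFractionRing.injective (X.left.presheaf.stalk p) X.left.functionField ha
  refine htu (h1 ▸ IsUnit.map _ (IsUnit.mk0 a ?_))
  rintro rfl
  exact ht (by rw [← h1, map_zero])

lemma exists_isGenusZeroPair_of_nontrivial [Nontrivial X.left] (hX : curveGenus X = 0) :
    ∃ (S O : Subalgebra k X.left.functionField) (t θ : X.left.functionField) (g : k[X]),
      IsGenusZeroPair S O t θ g := by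
  obtain ⟨p, hp⟩ := exists_ne (genericPoint X.left)
  obtain ⟨S, O, t, θ, g, h, -⟩ := exists_isGenusZeroPair hX hp
  exact ⟨S, O, t, θ, g, h⟩

lemma exists_isGenusZeroPair_of_rationalPoint [Nontrivial X.left] (hX : curveGenus X = 0)
    (Q : Over.mk (𝟙 (Spec (.of k))) ⟶ X) :
    ∃ (S O : Subalgebra k X.left.functionField) (t θ : X.left.functionField) (g : k[X]),
      IsGenusZeroPair S O t θ g ∧ g.natDegree = 1 := by
  obtain ⟨p, ρ, hρ, hρ'⟩ := exists_retraction_stalk Q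
  -- At the generic point the retraction would embed the whole function field into k over k,
  -- although the function field contains a nonconstant element.
  have hp : p ≠ genericPoint X.left := by
    rintro rfl
    obtain ⟨q, hq⟩ := exists_ne (genericPoint X.left)
    obtain ⟨f, hf⟩ := exists_mem_functionField_notMem_range (k := k) hq
    let ρ' : X.left.functionField →+* k := ρ
    exact hf ⟨ρ' f, ρ'.injective (hρ' (ρ' f))⟩
  obtain ⟨S, O, t, θ, g, h, h'⟩ := exists_isGenusZeroPair hX hp
  exact ⟨S, O, t, θ, g, h, h' ⟨ρ, hρ, hρ'⟩⟩

end

end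

noncomputable section

/-! ### Generators of function fields of genus zero -/

section

variable {M E : Type*} [Field M] [Field E] [Algebra M E] {J : Type*} [Fintype J]

/-- A criterion for a field to be generated by one transcendental element: the elements `ε j` are
orthogonal idempotents modulo `t` which span the residue ring of `O`. -/
lemma exists_transcendental_adjoin_eq_top (A O : Subalgebra M E) (t : E) (ε : J → E)
    (hadd : ∀ z : E, ∃ a ∈ A, ∃ o ∈ O, a + o = z)
    (hconst : ∀ z : E, z ∈ A → z ∈ O → z ∈ (algebraMap M E).range)
    (hfrac : ∀ z : E, ∃ a ∈ A, a ≠ 0 ∧ z * a ∈ A)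
    (hpow : ∀ z : E, ∃ n : ℕ, t ^ n * z ∈ O) (ht0 : t ≠ 0) (ht : t ∈ O) (ht' : t⁻¹ ∉ O)
    (hε : ∀ j, ε j ∈ O) (horth : ∀ i j, i ≠ j → t⁻¹ * (ε i * ε j) ∈ O)
    (hidem : ∀ j, t⁻¹ * (ε j * ε j - ε j) ∈ O)
    (hspan : ∀ x ∈ O, ∃ c : J → M, t⁻¹ * (x - ∑ j, c j • ε j) ∈ O) :
    ∃ b : E, IntermediateField.adjoin M {b} = ⊤ ∧ Transcendental M b := by
  classical
  -- b j has principal part ε j / t. Geometrically t = 0 is a union of rational points indexed by J,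
  -- and b j has at most a simple pole at the j-th of them and no other pole.
  choose b hbA o ho hbo using fun j => hadd (t⁻¹ * ε j)
  have htb (j : J) : t * b j = ε j - t * o j := by
    rw [eq_sub_iff_add_eq, ← mul_add, hbo, mul_inv_cancel_left₀ ht0]
  have htbO (j : J) : t * b j ∈ O := htb j ▸ sub_mem (hε j) (mul_mem ht (ho j))
  -- an idempotent that does not vanish modulo `t`
  obtain ⟨j₀, hj₀⟩ : ∃ j, t⁻¹ * ε j ∉ O := by
    by_contra! h
    obtain ⟨c, hc⟩ := hspan 1 (one_mem O)
    refine ht' ?_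
    have h1 : t⁻¹ = t⁻¹ * (1 - ∑ j, c j • ε j) + ∑ j, c j • (t⁻¹ * ε j) := by
      simp_rw [← mul_smul_comm]
      rw [← Finset.mul_sum]
      ring
    rw [h1]
    exact add_mem hc (sum_mem fun j _ => O.smul_mem (h j) _)
  have hb_notMem {j : J} (hj : t⁻¹ * ε j ∉ O) (c : M) : b j ≠ algebraMap M E c := by
    intro h
    refine hj ?_
    rw [← hbo, h]
    exact add_mem (O.algebraMap_mem c) (ho j)
  -- relations between the generators
  have hmem (j : J) : b j ∈ IntermediateField.adjoin M {b j₀} := by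
    by_cases hjj : j = j₀
    · exact hjj ▸ IntermediateField.mem_adjoin_simple_self M _
    -- For j ≠ j₀ the poles of the two factors lie at different points, so the product has only
    -- simple poles. Matching its principal part with c j₀ • b j₀ + c j • b j leaves an element of A
    -- ∩ O, a constant; the relation expresses b j as a Möbius transform of b j₀.
    have h1 : t * (b j₀ * b j) ∈ O := by
      have : t * (b j₀ * b j) = t⁻¹ * (ε j₀ * ε j) - ε j₀ * o j - ε j * o j₀ +
          t * (o j * o j₀) := by
        have : t * (b j₀ * b j) = t⁻¹ * ((t * b j₀) * (t * b j)) := by field_simp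
        rw [this, htb, htb]
        field_simp
        ring
      rw [this]
      exact add_mem (sub_mem (sub_mem (horth _ _ (Ne.symm hjj)) (mul_mem (hε _) (ho _)))
        (mul_mem (hε _) (ho _))) (mul_mem ht (mul_mem (ho _) (ho _)))
    obtain ⟨c, hc⟩ := hspan _ h1
    -- the other coefficients vanish
    have hc' (i : J) (hi : i ≠ j₀) (hij : i ≠ j) : t⁻¹ * (c i • ε i) ∈ O := by
      have h2 : t⁻¹ * (ε i * ε i * (t * (b j₀ * b j))) ∈ O := by
        have : t⁻¹ * (ε i * ε i * (t * (b j₀ * b j))) =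
            (t⁻¹ * (ε i * ε j₀) - ε i * o j₀) * (t⁻¹ * (ε i * ε j) - ε i * o j) := by
          have : t⁻¹ * (ε i * ε i * (t * (b j₀ * b j))) =
            (t⁻¹ * (ε i * (t * b j₀))) * (t⁻¹ * (ε i * (t * b j))) := by field_simp
          rw [this, htb, htb]
          field_simp
        rw [this]
        exact mul_mem (sub_mem (horth _ _ hi) (mul_mem (hε _) (ho _)))
          (sub_mem (horth _ _ hij) (mul_mem (hε _) (ho _)))
      have h3 : t⁻¹ * (ε i * ε i * ∑ l, c l • ε l) ∈ O := by
        have : t⁻¹ * (ε i * ε i * ∑ l, c l • ε l) = t⁻¹ * (ε i * ε i * (t * (b j₀ * b j))) -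
          (ε i * ε i) * (t⁻¹ * (t * (b j₀ * b j) - ∑ l, c l • ε l)) := by ring
        rw [this]
        exact sub_mem h2 (mul_mem (mul_mem (hε i) (hε i)) hc)
      have h4 : t⁻¹ * (ε i * ε i * (c i • ε i)) ∈ O := by
        have : t⁻¹ * (ε i * ε i * (c i • ε i)) = t⁻¹ * (ε i * ε i * ∑ l, c l • ε l) -
            ∑ l ∈ Finset.univ.erase i, c l • (ε i * (t⁻¹ * (ε i * ε l))) := by
          rw [← Finset.add_sum_erase Finset.univ _ (Finset.mem_univ i), eq_sub_iff_add_eq, mul_add,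
            mul_add, Finset.mul_sum, Finset.mul_sum]
          congr 1
          refine Finset.sum_congr rfl fun l _ => ?_
          rw [Algebra.smul_def, Algebra.smul_def]
          ring
        rw [this]
        refine sub_mem h3 (sum_mem fun l hl => O.smul_mem (mul_mem (hε i) ?_) _)
        exact horth _ _ (Finset.ne_of_mem_erase hl).symm
      have : t⁻¹ * (c i • ε i) = t⁻¹ * (ε i * ε i * (c i • ε i)) -
          c i • (ε i * (t⁻¹ * (ε i * ε i - ε i)) + t⁻¹ * (ε i * ε i - ε i)) := by
        rw [Algebra.smul_def, Algebra.smul_def]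
        ring
      rw [this]
      exact sub_mem h4 (O.smul_mem (add_mem (mul_mem (hε i) (hidem i)) (hidem i)) _)
    have h5 : b j₀ * b j - c j₀ • b j₀ - c j • b j ∈ O := by
      have : b j₀ * b j - c j₀ • b j₀ - c j • b j =
          t⁻¹ * (t * (b j₀ * b j) - ∑ l, c l • ε l) + c j₀ • o j₀ + c j • o j +
            ∑ l ∈ (Finset.univ.erase j₀).erase j, t⁻¹ * (c l • ε l) := by
        rw [← Finset.mul_sum, ← Finset.add_sum_erase Finset.univ (fun l => c l • ε l)
          (Finset.mem_univ j₀), ← Finset.add_sum_erase (Finset.univ.erase j₀) (fun l => c l • ε l)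
          (Finset.mem_erase.mpr ⟨hjj, Finset.mem_univ j⟩)]
        have e1 : ε j₀ = t * b j₀ + t * o j₀ := by rw [htb]; ring
        have e2 : ε j = t * b j + t * o j := by rw [htb]; ring
        rw [e1, e2]
        simp only [Algebra.smul_def]
        field_simp
        ring
      rw [this]
      refine add_mem (add_mem (add_mem hc (O.smul_mem (ho _) _)) (O.smul_mem (ho _) _))
        (sum_mem fun l hl => ?_)
      rw [Finset.mem_erase, Finset.mem_erase] at hl
      exact hc' l hl.2.1 hl.1
    obtain ⟨γ, hγ⟩ := hconst _ (sub_mem (sub_mem (mul_mem (hbA j₀) (hbA j))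
      (A.smul_mem (hbA _) _)) (A.smul_mem (hbA _) _)) h5
    have h6 : b j₀ - algebraMap M E (c j) ≠ 0 := sub_ne_zero.mpr (hb_notMem hj₀ _)
    have h7 : b j = (algebraMap M E (c j₀) * b j₀ + algebraMap M E γ) /
        (b j₀ - algebraMap M E (c j)) := by
      rw [eq_div_iff h6, hγ, Algebra.smul_def, Algebra.smul_def]
      ring
    rw [h7]
    have h8 := IntermediateField.mem_adjoin_simple_self M (b j₀)
    exact div_mem (add_mem (mul_mem (algebraMap_mem _ _) h8) (algebraMap_mem _ _))
      (sub_mem h8 (algebraMap_mem _ _))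
  have hidem' (j : J) (n : ℕ) : t⁻¹ * (ε j ^ (n + 1) - ε j) ∈ O := by
    induction n with
    | zero => simp
    | succ n ih =>
      have : t⁻¹ * (ε j ^ (n + 1 + 1) - ε j) =
          ε j * (t⁻¹ * (ε j ^ (n + 1) - ε j)) + t⁻¹ * (ε j * ε j - ε j) := by ring
      rw [this]
      exact add_mem (mul_mem (hε j) ih) (hidem j)
  have htbpow (j : J) (n : ℕ) : t⁻¹ * ((t * b j) ^ (n + 1) - ε j) ∈ O := by
    have h1 : t⁻¹ * ((t * b j) ^ (n + 1) - ε j ^ (n + 1)) ∈ O := by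
      obtain ⟨w, hw⟩ := sub_dvd_pow_sub_pow (⟨t * b j, htbO j⟩ : O) ⟨ε j, hε j⟩ (n + 1)
      have hw' : (t * b j) ^ (n + 1) - ε j ^ (n + 1) = (t * b j - ε j) * w :=
        congrArg Subtype.val hw
      rw [hw', htb, sub_sub_cancel_left, ← mul_assoc, mul_neg, inv_mul_cancel_left₀ ht0]
      exact mul_mem (neg_mem (ho j)) w.2
    have : t⁻¹ * ((t * b j) ^ (n + 1) - ε j) = t⁻¹ * ((t * b j) ^ (n + 1) - ε j ^ (n + 1)) +
      t⁻¹ * (ε j ^ (n + 1) - ε j) := by ring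
    rw [this]
    exact add_mem h1 (hidem' j n)
  -- Induction on the pole order: the elements b j ^ (n + 1) realise the leading terms ε j /
  -- t^(n+1), so a combination of them lowers the order of z by one.
  have hAmem (n : ℕ) : ∀ z ∈ A, t ^ n * z ∈ O → z ∈ IntermediateField.adjoin M {b j₀} := by
    induction n with
    | zero =>
      intro z hz hzO
      obtain ⟨c, rfl⟩ := hconst z hz (by simpa using hzO)
      exact algebraMap_mem _ _
    | succ n ih =>
      intro z hz hzO
      obtain ⟨c, hc⟩ := hspan _ hzO
      have h1 := ih (z - ∑ j, c j • b j ^ (n + 1))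
        (sub_mem hz (sum_mem fun j _ => A.smul_mem (pow_mem (hbA j) _) _)) (by
          have : t ^ n * (z - ∑ j, c j • b j ^ (n + 1)) =
              t⁻¹ * (t ^ (n + 1) * z - ∑ j, c j • ε j) -
                ∑ j, c j • (t⁻¹ * ((t * b j) ^ (n + 1) - ε j)) := by
            simp_rw [← mul_smul_comm, ← Finset.mul_sum, smul_sub, Finset.sum_sub_distrib, mul_pow]
            simp_rw [← mul_smul_comm, ← Finset.mul_sum]
            field_simp
            ring
          rw [this]
          exact sub_mem hc (sum_mem fun j _ => O.smul_mem (htbpow j n) _))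
      have h2 := add_mem h1 (sum_mem fun j (_ : j ∈ Finset.univ) =>
        (IntermediateField.adjoin M {b j₀}).smul_mem (pow_mem (hmem j) (n + 1)) (x := c j))
      rwa [sub_add_cancel] at h2
  have htop : IntermediateField.adjoin M {b j₀} = ⊤ := by
    refine eq_top_iff.mpr fun z _ => ?_
    obtain ⟨a, ha, ha0, hza⟩ := hfrac z
    obtain ⟨n, hn⟩ := hpow a
    obtain ⟨m, hm⟩ := hpow (z * a)
    rw [← mul_div_cancel_right₀ z ha0]
    exact div_mem (hAmem m _ hza hm) (hAmem n a ha hn)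
  -- If the generator were algebraic, then t would be algebraic over M, and the inverse of an
  -- algebraic element of O lies in O, against `ht'`.
  refine ⟨b j₀, htop, fun halg => ht' ?_⟩
  have h1 : Algebra.IsAlgebraic M (⊤ : IntermediateField M E) := by
    rw [← htop]
    exact IntermediateField.isAlgebraic_adjoin_simple halg.isIntegral
  have h2 : IsAlgebraic M t := by
    have := h1.isAlgebraic ⟨t, IntermediateField.mem_top⟩
    exact this.algebraMap (A := E)
  exact O.inv_mem_of_algebraic (x := ⟨t, ht⟩) h2

end

end

noncomputable section

open Polynomial

/-! ### Extension of scalars -/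

/-- A field extension generated by one transcendental element. -/
def IsSimpleTranscendental (M E : Type*) [Field M] [Field E] [Algebra M E] : Prop :=
  ∃ x : E, IntermediateField.adjoin M {x} = ⊤ ∧ Transcendental M x

section

variable (k F M E : Type*) [Field k] [Field F] [Field M] [Field E] [Algebra k F] [Algebra k M]
  [Algebra k E] [Algebra F E] [Algebra M E] [IsScalarTower k F E] [IsScalarTower k M E]
  [Algebra.IsPushout k F M E] {ι : Type*} (b : Module.Basis ι k M)

/-- The basis of `F ⊗ M` over `F` given by a basis of `M`. -/
def pushoutBasis : Module.Basis ι F E :=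
  IsBaseChange.basis b (Algebra.IsPushout.out (R := k) (S := F) (R' := M) (S' := E))

variable {k M}

lemma pushoutBasis_apply (i : ι) : pushoutBasis k F M E b i = algebraMap M E (b i) :=
  IsBaseChange.basis_apply b _ i

variable {F E}

lemma pushoutBasis_repr_algebraMap (m : M) (i : ι) :
    (pushoutBasis k F M E b).repr (algebraMap M E m) i = algebraMap k F (b.repr m i) :=
  IsBaseChange.basis_repr_comp_apply b (Algebra.IsPushout.out (R := k) (S := F) (R' := M) (S' := E))
    m i

lemma pushoutBasis_repr_algebraMap_mul (f : F) (m : M) (i : ι) :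
    (pushoutBasis k F M E b).repr (algebraMap F E f * algebraMap M E m) i =
      f * algebraMap k F (b.repr m i) := by
  rw [← Algebra.smul_def, map_smul, Finsupp.smul_apply, pushoutBasis_repr_algebraMap, smul_eq_mul]

lemma pushoutBasis_repr_algebraMap' (f : F) (i : ι) :
    (pushoutBasis k F M E b).repr (algebraMap F E f) i = f * algebraMap k F (b.repr 1 i) := by
  rw [← pushoutBasis_repr_algebraMap_mul (E := E), map_one, mul_one]

lemma sum_pushoutBasis_repr [Fintype ι] (z : E) :
    ∑ i, algebraMap F E ((pushoutBasis k F M E b).repr z i) * algebraMap M E (b i) = z := by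
  conv_rhs => rw [← (pushoutBasis k F M E b).sum_repr z]
  simp_rw [pushoutBasis_apply, Algebra.smul_def]

variable (E) in
/-- The extension of scalars of a subalgebra. -/
def scalarExtension [Fintype ι] (S : Subalgebra k F) : Subalgebra M E where
  carrier := {z | ∀ i, (pushoutBasis k F M E b).repr z i ∈ S}
  add_mem' {x y} hx hy i := by
    rw [map_add]
    exact add_mem (hx i) (hy i)
  algebraMap_mem' m i := by
    rw [pushoutBasis_repr_algebraMap]
    exact S.algebraMap_mem _
  mul_mem' {x y} hx hy i := by
    rw [← sum_pushoutBasis_repr (F := F) b x, ← sum_pushoutBasis_repr (F := F) b y, Finset.sum_mul_sum, map_sum,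
      Finsupp.finsetSum_apply]
    refine sum_mem fun j _ => ?_
    rw [map_sum, Finsupp.finsetSum_apply]
    refine sum_mem fun l _ => ?_
    rw [mul_mul_mul_comm, ← map_mul, ← map_mul, pushoutBasis_repr_algebraMap_mul]
    exact mul_mem (mul_mem (hx j) (hy l)) (S.algebraMap_mem _)

lemma mem_scalarExtension [Fintype ι] {S : Subalgebra k F} {z : E} :
    z ∈ scalarExtension E b S ↔ ∀ i, (pushoutBasis k F M E b).repr z i ∈ S := Iff.rfl

lemma algebraMap_mem_scalarExtension [Fintype ι] {S : Subalgebra k F} {f : F} :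
    algebraMap F E f ∈ scalarExtension E b S ↔ f ∈ S := by
  simp_rw [mem_scalarExtension, pushoutBasis_repr_algebraMap']
  refine ⟨fun h => ?_, fun h i => mul_mem h (S.algebraMap_mem _)⟩
  obtain ⟨i, hi⟩ : ∃ i, b.repr 1 i ≠ 0 := by
    by_contra! h
    exact one_ne_zero (b.repr.map_eq_zero_iff.mp (Finsupp.ext h))
  have h1 := mul_mem (h i) (S.algebraMap_mem (b.repr 1 i)⁻¹)
  rwa [mul_assoc, ← map_mul, mul_inv_cancel₀ hi, map_one, mul_one] at h1

/-- Over a field M in which g splits, the residue ring becomes M[T]/(g), a product of copies of M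
indexed by the roots of g. Its idempotents are the Lagrange basis polynomials evaluated at θ; with
them the generation criterion applies to the extended pair. -/
theorem IsGenusZeroPair.isSimpleTranscendental [Fintype ι] [CharZero k] {S O : Subalgebra k F} {t θ : F}
    {g : k[X]} (h : IsGenusZeroPair S O t θ g) (hs : (g.map (algebraMap k M)).Splits)
    (b : Module.Basis ι k M) : IsSimpleTranscendental M E := by
  classical
  let B := pushoutBasis k F M E b
  let O' := scalarExtension E b O
  let θ' := algebraMap F E θ
  let t' := algebraMap F E t
  let R : Finset M := (g.map (algebraMap k M)).roots.toFinset
  have hθ' : θ' ∈ O' := (algebraMap_mem_scalarExtension b).mpr h.mem'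
  have haeval (q : M[X]) : aeval θ' q ∈ O' := by
    rw [show aeval θ' q = (aeval (⟨θ', hθ'⟩ : O') q : E) from
      (aeval_algHom_apply O'.val ⟨θ', hθ'⟩ q)]
    exact SetLike.coe_mem _
  have hmap (q : k[X]) : aeval θ' (q.map (algebraMap k M)) = algebraMap F E (aeval θ q) := by
    rw [aeval_map_algebraMap, aeval_algebraMap_apply]
  -- The roots of g are simple in characteristic zero, so a polynomial vanishing at all of them is a
  -- multiple of g, and g(θ) is divisible by t.
  have hvanish (q : M[X]) (hq : ∀ r ∈ R, q.eval r = 0) : t'⁻¹ * aeval θ' q ∈ O' := by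
    have hdvd : g.map (algebraMap k M) ∣ q := by
      by_cases hq0 : q = 0
      · rw [hq0]
        exact dvd_zero _
      refine hs.dvd_of_roots_le_roots (map_ne_zero h.monic.ne_zero) ?_
      rw [Multiset.le_iff_subset (nodup_roots (h.irreducible.separable.map))]
      intro r hr
      rw [mem_roots hq0]
      exact hq r (Multiset.mem_toFinset.mpr hr)
    obtain ⟨c, rfl⟩ := hdvd
    rw [map_mul, hmap, ← mul_assoc, ← map_inv₀, ← map_mul]
    exact mul_mem ((algebraMap_mem_scalarExtension b).mpr h.inv_mul_aeval_mem) (haeval c)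
  have hbasis (r s : M) (hs : s ∈ R) : (Lagrange.basis R id r).eval s = if r = s then 1 else 0 := by
    split_ifs with hrs
    · subst hrs
      exact Lagrange.eval_basis_self (v := id) Function.injective_id.injOn hs
    · exact Lagrange.eval_basis_of_ne (v := id) hrs hs
  refine exists_transcendental_adjoin_eq_top (J := R) (scalarExtension E b S) O' t'
    (fun r => aeval θ' (Lagrange.basis R id (r : M))) (fun z => ?_) (fun z hzS hzO => ?_)
    (fun z => ?_) (fun z => ?_) ?_ ((algebraMap_mem_scalarExtension b).mpr h.mem) ?_
    (fun r => haeval _) (fun r s hrs => ?_) (fun r => ?_) (fun x hx => ?_)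
  · choose s hs o ho hso using fun i => h.exists_add_eq (B.repr z i)
    refine ⟨∑ i, algebraMap F E (s i) * algebraMap M E (b i), sum_mem fun i _ =>
      mul_mem ((algebraMap_mem_scalarExtension b).mpr (hs i)) (algebraMap_mem _ _),
      ∑ i, algebraMap F E (o i) * algebraMap M E (b i), sum_mem fun i _ =>
      mul_mem ((algebraMap_mem_scalarExtension b).mpr (ho i)) (algebraMap_mem _ _), ?_⟩
    rw [← Finset.sum_add_distrib]
    simp_rw [← add_mul, ← map_add, hso]
    exact sum_pushoutBasis_repr b z
  · choose c hc using fun i => h.mem_range _ (hzS i) (hzO i)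
    refine ⟨∑ i, algebraMap k M (c i) * b i, ?_⟩
    rw [map_sum, ← sum_pushoutBasis_repr (F := F) b z]
    refine Finset.sum_congr rfl fun i _ => ?_
    rw [map_mul, ← hc i, ← IsScalarTower.algebraMap_apply, ← IsScalarTower.algebraMap_apply]
  · choose s hs hs0 hsz using fun i => h.exists_mul_mem (B.repr z i)
    refine ⟨algebraMap F E (∏ i, s i), (algebraMap_mem_scalarExtension b).mpr
      (prod_mem fun i _ => hs i), ?_, fun i => ?_⟩
    · rw [_root_.map_ne_zero]
      exact Finset.prod_ne_zero_iff.mpr fun i _ => hs0 i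
    · rw [mul_comm, ← Algebra.smul_def, map_smul, Finsupp.smul_apply, smul_eq_mul,
        ← Finset.mul_prod_erase _ _ (Finset.mem_univ i), mul_right_comm, mul_comm (s i)]
      exact mul_mem (hsz i) (prod_mem fun i _ => hs i)
  · choose n hn using fun i => h.exists_pow_mul_mem (B.repr z i)
    refine ⟨∑ i, n i, fun i => ?_⟩
    rw [← map_pow, ← Algebra.smul_def, map_smul, Finsupp.smul_apply, smul_eq_mul,
      ← Finset.add_sum_erase _ _ (Finset.mem_univ i), add_comm, pow_add, mul_assoc]
    exact mul_mem (pow_mem h.mem _) (hn i)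
  · rw [_root_.map_ne_zero]
    exact h.ne_zero
  · rw [← map_inv₀, algebraMap_mem_scalarExtension]
    exact h.inv_notMem
  · rw [← map_mul]
    refine hvanish _ fun s' hs' => ?_
    rw [eval_mul, hbasis _ _ hs', hbasis _ _ hs']
    have : (r : M) ≠ s := fun h => hrs (Subtype.ext h)
    split_ifs with h1 h2
    · exact absurd (h1.trans h2.symm) this
    all_goals simp
  · rw [← map_mul, ← map_sub]
    refine hvanish _ fun s' hs' => ?_
    rw [eval_sub, eval_mul, hbasis _ _ hs']
    split_ifs <;> simp
  · choose q hq using fun i => h.exists_inv_mul_sub_mem _ (hx i)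
    obtain ⟨P, hP⟩ : ∃ P : M[X],
        aeval θ' P = ∑ i, algebraMap F E (aeval θ (q i)) * algebraMap M E (b i) := by
      refine ⟨∑ i, (q i).map (algebraMap k M) * C (b i), ?_⟩
      rw [map_sum]
      refine Finset.sum_congr rfl fun i _ => ?_
      rw [map_mul, hmap, aeval_C]
    refine ⟨fun r => P.eval (r : M), ?_⟩
    have h1 : t'⁻¹ * (x - aeval θ' P) ∈ O' := by
      have : t'⁻¹ * (x - aeval θ' P) = ∑ i, algebraMap F E (t⁻¹ * (B.repr x i - aeval θ (q i))) *
          algebraMap M E (b i) := by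
        rw [hP]
        conv_lhs => rw [← sum_pushoutBasis_repr (F := F) b x]
        rw [← Finset.sum_sub_distrib, Finset.mul_sum]
        refine Finset.sum_congr rfl fun i _ => ?_
        rw [map_mul, map_sub, map_inv₀]
        ring
      rw [this]
      exact sum_mem fun i _ => mul_mem ((algebraMap_mem_scalarExtension b).mpr (hq i))
        (algebraMap_mem _ _)
    have h2 := hvanish (P - ∑ r : R, C (P.eval (r : M)) * Lagrange.basis R id (r : M)) (by
      intro s' hs'
      rw [eval_sub, eval_finsetSum, sub_eq_zero, Finset.sum_eq_single ⟨s', hs'⟩]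
      · rw [eval_mul, eval_C, hbasis _ _ hs', if_pos rfl, mul_one]
      · intro r _ hr
        rw [eval_mul, hbasis _ _ hs', if_neg fun h => hr (Subtype.ext h), mul_zero]
      · intro h
        exact absurd (Finset.mem_univ _) h)
    have h3 := add_mem h1 h2
    rw [← mul_add, map_sub, sub_add_sub_cancel, map_sum] at h3
    simpa only [map_mul, aeval_C, Algebra.smul_def] using h3

end

end

noncomputable section

open Polynomial TensorProduct

/-! ### Simple transcendental extensions -/

/-- The derivation `d/dX` of the field of rational functions. -/
lemma exists_derivation_ratFunc_X_eq_one (M : Type*) [Field M] :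
    ∃ D : Derivation M (RatFunc M) (RatFunc M), D RatFunc.X = 1 := by
  have : Algebra.FormallyEtale M[X] (RatFunc M) :=
    Algebra.FormallyEtale.of_isLocalization (nonZeroDivisors M[X])
  let l : RatFunc M ⊗[M[X]] Ω[M[X]⁄M] →ₗ[RatFunc M] RatFunc M :=
    LinearMap.liftBaseChange (RatFunc M) ((Algebra.linearMap M[X] (RatFunc M)).comp
      (KaehlerDifferential.polynomialEquiv M).toLinearMap)
  refine ⟨(l.comp (KaehlerDifferential.tensorKaehlerEquivOfFormallyEtale M M[X]
    (RatFunc M)).symm.toLinearMap).compDer (KaehlerDifferential.D M (RatFunc M)), ?_⟩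
  change l ((KaehlerDifferential.tensorKaehlerEquivOfFormallyEtale M M[X]
    (RatFunc M)).symm (KaehlerDifferential.D M (RatFunc M) RatFunc.X)) = 1
  rw [← RatFunc.algebraMap_X,
    KaehlerDifferential.tensorKaehlerEquivOfFormallyEtale_symm_D_algebraMap]
  simp [l]

section

variable {M E : Type*} [Field M] [Field E] [Algebra M E]

lemma exists_algEquiv_ratFunc {x : E} (hx : IntermediateField.adjoin M {x} = ⊤)
    (hx' : Transcendental M x) : ∃ e : RatFunc M ≃ₐ[M] E, e RatFunc.X = x :=
  ⟨(RatFunc.algEquivOfTranscendental x hx').trans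
    ((IntermediateField.equivOfEq hx).trans IntermediateField.topEquiv), by simp⟩

lemma isSimpleTranscendental_iff :
    IsSimpleTranscendental M E ↔ Nonempty (RatFunc M ≃ₐ[M] E) := by
  constructor
  · rintro ⟨x, hx, hx'⟩
    exact ⟨(exists_algEquiv_ratFunc hx hx').choose⟩
  · rintro ⟨e⟩
    refine ⟨e RatFunc.X, ?_, ?_⟩
    · have h := IntermediateField.adjoin_map M {(RatFunc.X : RatFunc M)} e.toAlgHom
      rw [RatFunc.adjoin_X, ← AlgHom.fieldRange_eq_map, Set.image_singleton] at h
      refine h.symm.trans ?_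
      exact AlgHom.fieldRange_eq_top.mpr e.surjective
    · exact fun h => RatFunc.transcendental_X
        ((isAlgebraic_algHom_iff e.toAlgHom e.injective).mp h)

lemma exists_derivation_eq_one {x : E} (hx : IntermediateField.adjoin M {x} = ⊤)
    (hx' : Transcendental M x) : ∃ D : Derivation M E E, D x = 1 := by
  obtain ⟨e, he⟩ := exists_algEquiv_ratFunc hx hx'
  obtain ⟨D, hD⟩ := exists_derivation_ratFunc_X_eq_one M
  refine ⟨Derivation.mk' (e.toLinearMap.comp (D.toLinearMap.comp e.symm.toLinearMap)) fun a b => ?_,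
    ?_⟩
  · change e (D (e.symm (a * b))) = a • e (D (e.symm b)) + b • e (D (e.symm a))
    rw [map_mul, D.leibniz]
    simp
  · change e (D (e.symm x)) = 1
    rw [← he, e.symm_apply_apply, hD, map_one]

/-- A derivation over M of the field M(x) is determined by its value at x, so these derivations form
a space of dimension at most one over E. -/
lemma derivation_apply_eq_mul {x : E} (hx : IntermediateField.adjoin M {x} = ⊤)
    (D D' : Derivation M E E) (hD : D x = 1) (z : E) : D' z = D' x * D z := by
  have h : z ∈ IntermediateField.adjoin M {x} := hx ▸ IntermediateField.mem_top
  induction h using IntermediateField.adjoin_induction with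
  | mem y hy =>
    rw [Set.mem_singleton_iff.mp hy, hD, mul_one]
  | algebraMap m => simp
  | add y z _ _ hy hz => rw [map_add, map_add, hy, hz, mul_add]
  | inv y _ hy =>
    rw [D.leibniz_inv, D'.leibniz_inv, hy]
    simp only [smul_eq_mul]
    ring
  | mul y z _ _ hy hz =>
    rw [D.leibniz, D'.leibniz, hy, hz]
    simp only [smul_eq_mul]
    ring

lemma IsSimpleTranscendental.mem_range_of_isIntegral (h : IsSimpleTranscendental M E) {z : E}
    (hz : IsIntegral M z) : z ∈ (algebraMap M E).range := by
  obtain ⟨e⟩ := isSimpleTranscendental_iff.mp h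
  by_contra hz'
  have h1 : Transcendental M (e.symm z) := by
    refine RatFunc.transcendental_of_ne_C _ ?_
    rintro ⟨c, hc⟩
    refine hz' ⟨c, ?_⟩
    rw [e.symm_apply_eq] at hc
    rw [hc, ← RatFunc.algebraMap_eq_C, e.commutes]
  exact h1 ((isAlgebraic_algHom_iff e.symm.toAlgHom e.symm.injective).mpr hz.isAlgebraic)

/-- Generators of a simple transcendental extension are related by a Möbius transformation. -/
lemma exists_mul_eq_of_adjoin_eq_top {x y : E} (hx : IntermediateField.adjoin M {x} = ⊤)
    (hx' : Transcendental M x) (hy : IntermediateField.adjoin M {y} = ⊤) :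
    ∃ a b c d : M, algebraMap M E c * x + algebraMap M E d ≠ 0 ∧
      y * (algebraMap M E c * x + algebraMap M E d) = algebraMap M E a * x + algebraMap M E b := by
  obtain ⟨e, he⟩ := exists_algEquiv_ratFunc hx hx'
  let f := e.symm y
  have hf : IntermediateField.adjoin M {f} = ⊤ := by
    have h := IntermediateField.adjoin_map M {y} e.symm.toAlgHom
    rw [hy, ← AlgHom.fieldRange_eq_map, Set.image_singleton] at h
    refine h.symm.trans ?_
    exact AlgHom.fieldRange_eq_top.mpr e.symm.surjective
  -- The degree of f is [M(X) : M(f)] = 1, so its numerator and denominator are at most linear.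
  have hdeg := f.finrank_eq_max_natDegree
  rw [hf, IntermediateField.finrank_top] at hdeg
  have h1 := eq_X_add_C_of_natDegree_le_one ((le_max_left _ _).trans hdeg.symm.le)
  have h2 := eq_X_add_C_of_natDegree_le_one ((le_max_right _ _).trans hdeg.symm.le)
  have hC (c : M) : e (algebraMap M[X] (RatFunc M) (C c)) = algebraMap M E c := by
    rw [RatFunc.algebraMap_C, ← RatFunc.algebraMap_eq_C, e.commutes]
  have h3 (a b : M) : e (algebraMap M[X] (RatFunc M) (C a * X + C b)) =
      algebraMap M E a * x + algebraMap M E b := by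
    rw [map_add, map_mul, map_add, map_mul, hC, hC, RatFunc.algebraMap_X, he]
  refine ⟨f.num.coeff 1, f.num.coeff 0, f.denom.coeff 1, f.denom.coeff 0, ?_, ?_⟩
  · rw [← h3, ← h2, map_ne_zero_iff _ e.injective,
      map_ne_zero_iff _ (RatFunc.algebraMap_injective M)]
    exact f.denom_ne_zero
  · rw [← h3, ← h3, ← h1, ← h2]
    have h4 : y = e f := (e.apply_symm_apply y).symm
    rw [h4, ← map_mul]
    congr 1
    have h5 : algebraMap M[X] (RatFunc M) f.denom ≠ 0 := by
      rw [map_ne_zero_iff _ (RatFunc.algebraMap_injective M)]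
      exact f.denom_ne_zero
    rw [← div_eq_iff h5 |>.mp f.num_div_denom]

end

end

noncomputable section

/-! ### Galois descent -/

section

variable (k F M E : Type*) [Field k] [Field F] [Field M] [Field E] [Algebra k F] [Algebra k M]
  [Algebra k E] [Algebra F E] [Algebra M E] [IsScalarTower k F E] [IsScalarTower k M E]
  [Algebra.IsPushout k F M E]

variable {k M}

/-- The action of the automorphisms of `M` on `F ⊗ M`. -/
def pushoutMap (σ : M ≃ₐ[k] M) : E ≃ₐ[F] E :=
  (Algebra.IsPushout.equiv k F M E).symm.trans
    ((Algebra.TensorProduct.congr AlgEquiv.refl σ).trans (Algebra.IsPushout.equiv k F M E))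

lemma pushoutMap_algebraMap (σ : M ≃ₐ[k] M) (m : M) :
    pushoutMap F E σ (algebraMap M E m) = algebraMap M E (σ m) := by
  simp [pushoutMap, Algebra.IsPushout.equiv_symm_algebraMap_right, Algebra.IsPushout.equiv_tmul]

lemma pushoutMap_one (z : E) : pushoutMap F E (1 : M ≃ₐ[k] M) z = z := by
  change Algebra.IsPushout.equiv k F M E (Algebra.TensorProduct.congr AlgEquiv.refl AlgEquiv.refl
    ((Algebra.IsPushout.equiv k F M E).symm z)) = z
  rw [Algebra.TensorProduct.congr_refl]
  exact AlgEquiv.apply_symm_apply _ _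

variable [FiniteDimensional k M] [IsGalois k M]

variable (M) {F E} in
-- Expanding z over a k-basis of M turns the sum over the Galois group into traces of the basis
-- elements, which lie in k.
lemma sum_pushoutMap_mem_range (z : E) :
    ∑ σ : M ≃ₐ[k] M, pushoutMap F E σ z ∈ (algebraMap F E).range := by
  let b := Module.finBasis k M
  rw [← sum_pushoutBasis_repr (F := F) b z]
  simp_rw [map_sum]
  rw [Finset.sum_comm]
  refine sum_mem fun i _ => ?_
  simp_rw [map_mul, AlgEquiv.commutes, pushoutMap_algebraMap]
  rw [← Finset.mul_sum, ← map_sum, ← trace_eq_sum_automorphisms, ← IsScalarTower.algebraMap_apply,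
    IsScalarTower.algebraMap_apply k F E]
  exact mul_mem ⟨_, rfl⟩ ⟨_, rfl⟩

variable (M) {F E} in
-- An invariant element is its own average over the Galois group; the order of the group is
-- invertible in characteristic zero.
lemma mem_range_of_pushoutMap_eq [CharZero k] {z : E} (hz : ∀ σ : M ≃ₐ[k] M, pushoutMap F E σ z = z) :
    z ∈ (algebraMap F E).range := by
  have h := sum_pushoutMap_mem_range (k := k) (F := F) M z
  simp_rw [hz, Finset.sum_const, nsmul_eq_mul] at h
  have : CharZero E := charZero_of_injective_algebraMap (algebraMap k E).injective
  have h0 : ((Finset.univ : Finset (M ≃ₐ[k] M)).card : E) ≠ 0 :=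
    Nat.cast_ne_zero.mpr (Finset.card_ne_zero_of_mem (Finset.mem_univ 1))
  rw [← mul_div_cancel_left₀ z h0]
  have h1 : ((Finset.univ : Finset (M ≃ₐ[k] M)).card : E) ∈ (algebraMap F E).fieldRange :=
    natCast_mem _ _
  exact div_mem (S := Subfield E) (hSM := inferInstance) (x := _) (show _ ∈ (algebraMap F E).fieldRange from h) h1

/-- A stable subspace is spanned by its invariants. -/
lemma mem_span_of_stable {V : Submodule M E}
    (hV : ∀ (σ : M ≃ₐ[k] M), ∀ z ∈ V, pushoutMap F E σ z ∈ V) {z : E} (hz : z ∈ V) :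
    z ∈ Submodule.span M ((V : Set E) ∩ (algebraMap F E).range) := by
  by_contra hz'
  -- Take a functional l killing the invariants but not z. The traces of all a z are invariants in
  -- V, so Σ l(σ z) σ(a) = 0 for every a in M. Dedekind's independence of characters forces the
  -- coefficient l(z) at σ = 1 to vanish.
  obtain ⟨l, hl, hl'⟩ := Submodule.exists_le_ker_of_notMem hz'
  have h1 (a : M) : ∑ σ : M ≃ₐ[k] M, l (pushoutMap F E σ z) * σ a = 0 := by
    have h2 : ∑ σ : M ≃ₐ[k] M, pushoutMap F E σ (algebraMap M E a * z) ∈ (V : Set E) ∩ (algebraMap F E).range :=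
      ⟨sum_mem fun σ _ => hV σ _ (by rw [← Algebra.smul_def]; exact V.smul_mem a hz),
        sum_pushoutMap_mem_range M _⟩
    have h3 := LinearMap.mem_ker.mp (hl' (Submodule.subset_span h2))
    rw [map_sum] at h3
    rw [← h3]
    refine Finset.sum_congr rfl fun σ _ => ?_
    rw [map_mul, pushoutMap_algebraMap, ← Algebra.smul_def, map_smul, smul_eq_mul, mul_comm]
  have hind := linearIndependent_monoidHom M M
  have h2 := Fintype.linearIndependent_iff.mp (hind.comp (fun σ : M ≃ₐ[k] M =>
    ((σ : M →+* M) : M →* M)) fun σ τ h => AlgEquiv.ext fun m => DFunLike.congr_fun h m)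
    (fun σ => l (pushoutMap F E σ z)) (by
      ext a
      simpa using h1 a) 1
  refine hl ?_
  rwa [pushoutMap_one] at h2

end

end

noncomputable section

/-! ### Invariant derivations -/

section

variable {k F M E : Type*} [Field k] [Field F] [Field M] [Field E] [Algebra k F] [Algebra k M]
  [Algebra k E] [Algebra F E] [Algebra M E] [IsScalarTower k F E] [IsScalarTower k M E]
  [Algebra.IsPushout k F M E]

lemma pushoutMap_symm_algebraMap (σ : M ≃ₐ[k] M) (m : M) :
    (pushoutMap F E σ).symm (algebraMap M E m) = algebraMap M E (σ.symm m) := by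
  rw [AlgEquiv.symm_apply_eq, pushoutMap_algebraMap, AlgEquiv.apply_symm_apply]

/-- The conjugate of a derivation. -/
def conjDerivation (σ : M ≃ₐ[k] M) (D : Derivation M E E) : Derivation M E E :=
  Derivation.mk'
    { toFun := fun z => pushoutMap F E σ (D ((pushoutMap F E σ).symm z))
      map_add' := fun x y => by simp only [map_add]
      map_smul' := fun m x => by
        rw [Algebra.smul_def, map_mul, pushoutMap_symm_algebraMap, ← Algebra.smul_def, D.map_smul,
          Algebra.smul_def, map_mul, pushoutMap_algebraMap, AlgEquiv.apply_symm_apply,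
          ← Algebra.smul_def]
        rfl }
    (fun x y => by
      simp [D.leibniz])

lemma conjDerivation_apply (σ : M ≃ₐ[k] M) (D : Derivation M E E) (z : E) :
    conjDerivation (F := F) σ D (pushoutMap F E σ z) = pushoutMap F E σ (D z) := by
  change pushoutMap F E σ (D ((pushoutMap F E σ).symm (pushoutMap F E σ z))) = _
  rw [AlgEquiv.symm_apply_apply]

lemma exists_derivation_apply_ne_zero [FiniteDimensional k M] (D : Derivation M E E) {x : E}
    (hx : D x ≠ 0) : ∃ f : F, D (algebraMap F E f) ≠ 0 := by
  by_contra! h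
  refine hx ?_
  rw [← sum_pushoutBasis_repr (F := F) (Module.finBasis k M) x, map_sum]
  refine Finset.sum_eq_zero fun i _ => ?_
  rw [D.leibniz, D.map_algebraMap, h, smul_zero, smul_zero, add_zero]

lemma adjoin_pushoutMap_eq_top (σ : M ≃ₐ[k] M) {x : E}
    (hx : IntermediateField.adjoin M {x} = ⊤) :
    IntermediateField.adjoin M {pushoutMap F E σ x} = ⊤ := by
  refine eq_top_iff.mpr fun z _ => ?_
  suffices h : ∀ y ∈ IntermediateField.adjoin M {x},
      pushoutMap F E σ y ∈ IntermediateField.adjoin M {pushoutMap F E σ x} by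
    rw [← (pushoutMap F E σ).apply_symm_apply z]
    exact h _ (hx ▸ IntermediateField.mem_top)
  intro y hy
  induction hy using IntermediateField.adjoin_induction with
  | mem y hy =>
    rw [Set.mem_singleton_iff.mp hy]
    exact IntermediateField.mem_adjoin_simple_self M _
  | algebraMap m =>
    rw [pushoutMap_algebraMap]
    exact algebraMap_mem _ _
  | add y z _ _ hy hz =>
    rw [map_add]
    exact add_mem hy hz
  | inv y _ hy =>
    rw [map_inv₀]
    exact inv_mem hy
  | mul y z _ _ hy hz =>
    rw [map_mul]
    exact mul_mem hy hz

/-- The products of an element with quadratic polynomials in another element. -/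
def quadraticMultiples (M : Type*) {E : Type*} [Field M] [Field E] [Algebra M E] (l x : E) :
    Submodule M E where
  carrier := {z | ∃ p q r : M, z = l * (algebraMap M E p * x ^ 2 + algebraMap M E q * x +
    algebraMap M E r)}
  zero_mem' := ⟨0, 0, 0, by simp⟩
  add_mem' := by
    rintro _ _ ⟨p, q, r, rfl⟩ ⟨p', q', r', rfl⟩
    refine ⟨p + p', q + q', r + r', ?_⟩
    simp only [map_add]
    ring
  smul_mem' := by
    rintro m _ ⟨p, q, r, rfl⟩
    refine ⟨m * p, m * q, m * r, ?_⟩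
    simp only [map_mul, Algebra.smul_def]
    ring

/-- A form of a simple transcendental extension is generated by two elements `v` and `w` such that
`w ^ 2` is a quadratic polynomial in `v`. -/
lemma exists_sq_eq_of_isSimpleTranscendental [FiniteDimensional k M] [IsGalois k M] [CharZero k]
    (h : IsSimpleTranscendental M E) :
    ∃ (v w : F) (α β γ : M), algebraMap F E v ∉ (algebraMap M E).range ∧
      IntermediateField.adjoin M {algebraMap F E v, algebraMap F E w} = ⊤ ∧
      algebraMap F E w ^ 2 = algebraMap M E α * algebraMap F E v ^ 2 +
        algebraMap M E β * algebraMap F E v + algebraMap M E γ := by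
  obtain ⟨x, hx, hx'⟩ := h
  have hchar : CharZero E := charZero_of_injective_algebraMap (algebraMap k E).injective
  obtain ⟨D, hD⟩ := exists_derivation_eq_one hx hx'
  obtain ⟨f, hf⟩ := exists_derivation_apply_ne_zero (k := k) (F := F) D (x := x)
    (by rw [hD]; exact one_ne_zero)
  set l := D (algebraMap F E f) with hl
  -- D₀ is d/df with f in F; the normalisation D₀ f = 1 makes it commute with the Galois action.
  -- Since (p x² + q x + r) d/dx = l (p x² + q x + r) D₀, the space `quadraticMultiples M l x`
  -- consists of the coefficients of the global vector fields on the line, and is therefore Galois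
  -- stable.
  let D₀ : Derivation M E E := l⁻¹ • D
  have hD₀ (z : E) : D₀ z = l⁻¹ * D z := rfl
  have hcomm (σ : M ≃ₐ[k] M) (z : E) : pushoutMap F E σ (D₀ z) = D₀ (pushoutMap F E σ z) := by
    rw [← conjDerivation_apply]
    have h1 := derivation_apply_eq_mul hx D (conjDerivation (F := F) σ D₀) hD
    have h2 : conjDerivation (F := F) σ D₀ (algebraMap F E f) = 1 := by
      conv_lhs => rw [← (pushoutMap F E σ).commutes f]
      rw [conjDerivation_apply, hD₀, ← hl, inv_mul_cancel₀ hf, map_one]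
    rw [h1, ← hl] at h2
    rw [h1, hD₀, eq_inv_of_mul_eq_one_left h2]
  -- stability
  have hstable (σ : M ≃ₐ[k] M) (z : E) (hz : z ∈ quadraticMultiples M l x) :
      pushoutMap F E σ z ∈ quadraticMultiples M l x := by
    obtain ⟨p, q, r, rfl⟩ := hz
    obtain ⟨a, b, c, d, hne, hy⟩ := exists_mul_eq_of_adjoin_eq_top hx hx'
      (adjoin_pushoutMap_eq_top (F := F) σ hx)
    set y := pushoutMap F E σ x with hyx
    -- With y = (a x + b) / (c x + d) one has D y = δ / (c x + d)², while commutation with D₀ gives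
    -- σ(l) D y = l. Hence σ(l) δ = l (c x + d)², and this square clears the denominators of a
    -- quadratic polynomial in y.
    obtain ⟨δ, hδ⟩ : ∃ δ, δ = a * d - b * c := ⟨_, rfl⟩
    have h1 : D y * (algebraMap M E c * x + algebraMap M E d) + y * algebraMap M E c =
        algebraMap M E a := by
      have := congrArg D hy
      simp only [D.leibniz, map_add, D.map_algebraMap, hD, smul_eq_mul, mul_one, mul_zero,
        add_zero] at this
      linear_combination this
    have h2 : D y * (algebraMap M E c * x + algebraMap M E d) ^ 2 =
        algebraMap M E δ := by
      simp only [hδ, map_sub, map_mul]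
      linear_combination (algebraMap M E c * x + algebraMap M E d) * h1 - algebraMap M E c * hy
    have h3 : pushoutMap F E σ l * D y = l := by
      have h4 := hcomm σ x
      rw [hD₀, hD₀, hD, mul_one, map_inv₀, ← hyx] at h4
      have h5 : pushoutMap F E σ l ≠ 0 := by
        rw [map_ne_zero_iff _ (pushoutMap F E σ).injective]
        exact hf
      field_simp at h4
      exact h4.symm
    have h4 : algebraMap M E δ ≠ 0 := by
      rw [← h2]
      refine mul_ne_zero ?_ (pow_ne_zero 2 hne)
      intro h
      rw [h, mul_zero] at h3
      exact hf h3.symm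
    have h5 : pushoutMap F E σ l * algebraMap M E δ =
        l * (algebraMap M E c * x + algebraMap M E d) ^ 2 := by
      linear_combination (algebraMap M E c * x + algebraMap M E d) ^ 2 * h3 -
        pushoutMap F E σ l * h2
    refine ⟨δ⁻¹ * (σ p * a ^ 2 + σ q * a * c + σ r * c ^ 2),
      δ⁻¹ * (2 * σ p * a * b + σ q * (a * d + b * c) + 2 * σ r * c * d),
      δ⁻¹ * (σ p * b ^ 2 + σ q * b * d + σ r * d ^ 2), ?_⟩
    simp only [map_mul, map_add, map_pow, map_inv₀, pushoutMap_algebraMap, ← hyx, map_ofNat]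
    rw [← mul_left_inj' h4]
    have h6 : algebraMap M E δ * (algebraMap M E δ)⁻¹ = 1 :=
      mul_inv_cancel₀ h4
    linear_combination (algebraMap M E (σ p) * y ^ 2 + algebraMap M E (σ q) * y +
      algebraMap M E (σ r)) * h5 + l * (algebraMap M E (σ p) * (y * (algebraMap M E c * x +
      algebraMap M E d) + (algebraMap M E a * x + algebraMap M E b)) + algebraMap M E (σ q) *
      (algebraMap M E c * x + algebraMap M E d)) * hy - l *
      ((algebraMap M E (σ p) * algebraMap M E a ^ 2 + algebraMap M E (σ q) * algebraMap M E a *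
        algebraMap M E c + algebraMap M E (σ r) * algebraMap M E c ^ 2) * x ^ 2 +
      (2 * algebraMap M E (σ p) * algebraMap M E a * algebraMap M E b + algebraMap M E (σ q) *
        (algebraMap M E a * algebraMap M E d + algebraMap M E b * algebraMap M E c) +
        2 * algebraMap M E (σ r) * algebraMap M E c * algebraMap M E d) * x +
      (algebraMap M E (σ p) * algebraMap M E b ^ 2 + algebraMap M E (σ q) * algebraMap M E b *
        algebraMap M E d + algebraMap M E (σ r) * algebraMap M E d ^ 2)) * h6
  -- invariants
  have hmem {z : E} (hz : z ∈ quadraticMultiples M l x) := mem_span_of_stable F E hstable hz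
  have hl1 : l ∈ quadraticMultiples M l x := ⟨0, 0, 1, by simp⟩
  have hl2 : l * x ∈ quadraticMultiples M l x := ⟨0, 1, 0, by simp⟩
  have hxM : x ∉ (algebraMap M E).range := by
    rintro ⟨m, rfl⟩
    exact hx' (isAlgebraic_algebraMap m)
  obtain ⟨f₁, hf₁, hf₁0⟩ : ∃ f₁ : F, algebraMap F E f₁ ∈ quadraticMultiples M l x ∧ f₁ ≠ 0 := by
    by_contra! hcon
    refine hf ?_
    have h1 := hmem hl1
    rwa [Submodule.span_eq_bot.mpr, Submodule.mem_bot] at h1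
    rintro _ ⟨hz, f₁, rfl⟩
    rw [hcon f₁ hz, map_zero]
  have hf₁0' : algebraMap F E f₁ ≠ 0 := by rwa [_root_.map_ne_zero]
  obtain ⟨f₂, hf₂, hf₁₂⟩ : ∃ f₂ : F, algebraMap F E f₂ ∈ quadraticMultiples M l x ∧
      algebraMap F E (f₂ / f₁) ∉ (algebraMap M E).range := by
    by_contra! hcon
    have hsub : Submodule.span M ((quadraticMultiples M l x : Set E) ∩ (algebraMap F E).range) ≤
        Submodule.span M {algebraMap F E f₁} := by
      refine Submodule.span_le.mpr ?_
      rintro _ ⟨hz, f₂, rfl⟩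
      obtain ⟨m, hm⟩ := hcon f₂ hz
      refine Submodule.mem_span_singleton.mpr ⟨m, ?_⟩
      rw [Algebra.smul_def, hm, ← map_mul, div_mul_cancel₀ _ hf₁0]
    obtain ⟨m₁, hm₁⟩ := Submodule.mem_span_singleton.mp (hsub (hmem hl1))
    obtain ⟨m₂, hm₂⟩ := Submodule.mem_span_singleton.mp (hsub (hmem hl2))
    refine hxM ⟨m₂ / m₁, ?_⟩
    rw [Algebra.smul_def] at hm₁ hm₂
    have hm₁0 : algebraMap M E m₁ ≠ 0 := by
      intro h
      rw [h, zero_mul] at hm₁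
      exact hf hm₁.symm
    rw [map_div₀, div_eq_iff hm₁0]
    refine mul_right_cancel₀ hf₁0' ?_
    rw [hm₂, mul_assoc, hm₁, mul_comm]
  obtain ⟨p₁, q₁, r₁, h₁⟩ := hf₁
  obtain ⟨p₂, q₂, r₂, h₂⟩ := hf₂
  set v := f₂ / f₁ with hv
  -- Write f₁ = l P₁ and f₂ = l P₂, so that v = P₂ / P₁. Then f₁ D₀ v = P₁ dv/dx = P₂' - v P₁', the
  -- derivative at x of the quadratic polynomial P₂ - v P₁, of which x is a root.
  obtain ⟨w, hw⟩ : algebraMap F E f₁ * D₀ (algebraMap F E v) ∈ (algebraMap F E).range := by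
    refine mem_range_of_pushoutMap_eq (k := k) M fun σ => ?_
    rw [map_mul, hcomm, AlgEquiv.commutes, AlgEquiv.commutes]
  have hvE : algebraMap F E v * (algebraMap M E p₁ * x ^ 2 + algebraMap M E q₁ * x +
      algebraMap M E r₁) = algebraMap M E p₂ * x ^ 2 + algebraMap M E q₂ * x +
      algebraMap M E r₂ := by
    refine mul_left_cancel₀ hf ?_
    rw [← h₂, mul_left_comm, ← h₁, ← map_mul, hv, div_mul_cancel₀ _ hf₁0]
  have hwE : algebraMap F E w = (2 * algebraMap M E p₂ * x + algebraMap M E q₂) -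
      (2 * algebraMap M E p₁ * x + algebraMap M E q₁) * algebraMap F E v := by
    have h3 := congrArg D hvE
    simp only [D.leibniz, map_add, D.map_algebraMap, hD, smul_eq_mul, mul_one, mul_zero,
      add_zero, D.leibniz_pow, nsmul_eq_mul, Nat.cast_ofNat] at h3
    rw [hw, hD₀, h₁]
    field_simp
    linear_combination h3
  -- The squared derivative of a quadratic polynomial at a root is its discriminant. These are the
  -- coefficients of (q₂ - q₁ v)² - 4 (p₂ - p₁ v)(r₂ - r₁ v) as a polynomial in v.
  refine ⟨v, w, q₁ ^ 2 - 4 * p₁ * r₁, -2 * q₁ * q₂ + 4 * p₁ * r₂ + 4 * p₂ * r₁,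
    q₂ ^ 2 - 4 * p₂ * r₂, hf₁₂, ?_, ?_⟩
  · have hle {N : IntermediateField M E} (hxN : x ∈ N) : N = ⊤ :=
      top_le_iff.mp (hx ▸ IntermediateField.adjoin_simple_le_iff.mpr hxN)
    refine hle ?_
    set N := IntermediateField.adjoin M {algebraMap F E v, algebraMap F E w}
    have hvN : algebraMap F E v ∈ N :=
      IntermediateField.subset_adjoin M _ (Set.mem_insert _ _)
    have hwN : algebraMap F E w ∈ N :=
      IntermediateField.subset_adjoin M _ (Set.mem_insert_of_mem _ rfl)
    -- linear relations between `1` and `v` are trivial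
    have hlin (m n : M) (h : algebraMap M E m - algebraMap M E n * algebraMap F E v = 0) :
        m = 0 ∧ n = 0 := by
      have hn : n = 0 := by
        by_contra hn
        refine hf₁₂ ⟨m / n, ?_⟩
        rw [map_div₀, div_eq_iff (by rwa [_root_.map_ne_zero])]
        linear_combination h
      refine ⟨?_, hn⟩
      rw [hn, map_zero, zero_mul, sub_zero] at h
      rwa [_root_.map_eq_zero] at h
    have hMN (m n : M) : algebraMap M E m - algebraMap M E n * algebraMap F E v ∈ N :=
      sub_mem (algebraMap_mem _ _) (mul_mem (algebraMap_mem _ _) hvN)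
    -- The formula for w is linear in x and recovers it unless its leading coefficient vanishes. In
    -- that case p₁ = p₂ = 0 and the relation defining v recovers x, unless everything degenerates
    -- and f₁ = 0.
    by_cases hA : algebraMap M E p₂ - algebraMap M E p₁ * algebraMap F E v = 0
    · obtain ⟨rfl, rfl⟩ := hlin _ _ hA
      by_cases hB : algebraMap M E q₂ - algebraMap M E q₁ * algebraMap F E v = 0
      · obtain ⟨rfl, rfl⟩ := hlin _ _ hB
        obtain ⟨rfl, rfl⟩ := hlin r₂ r₁ (by
          simp only [map_zero] at hvE
          linear_combination -hvE)
        simp only [map_zero] at h₁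
        exact absurd (h₁.trans (by ring)) hf₁0'
      · have : x = -(algebraMap M E r₂ - algebraMap M E r₁ * algebraMap F E v) /
            (algebraMap M E q₂ - algebraMap M E q₁ * algebraMap F E v) := by
          rw [eq_div_iff hB]
          simp only [map_zero] at hvE
          linear_combination -hvE
        rw [this]
        exact div_mem (neg_mem (hMN _ _)) (hMN _ _)
    · have : x = (algebraMap F E w - (algebraMap M E q₂ - algebraMap M E q₁ * algebraMap F E v)) /
          (2 * (algebraMap M E p₂ - algebraMap M E p₁ * algebraMap F E v)) := by
        rw [eq_div_iff (mul_ne_zero two_ne_zero hA), hwE]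
        ring
      rw [this]
      exact div_mem (sub_mem hwN (hMN _ _)) (mul_mem (ofNat_mem N 2) (hMN _ _))
  · simp only [map_sub, map_add, map_mul, map_pow, map_neg, map_ofNat]
    rw [hwE]
    linear_combination (-4 * (algebraMap M E p₂ - algebraMap M E p₁ * algebraMap F E v)) * hvE


end

end

noncomputable section

/-! ### Function fields of conics -/

section

variable {k F M E : Type*} [Field k] [Field F] [Field M] [Field E] [Algebra k F] [Algebra k M]
  [Algebra k E] [Algebra F E] [Algebra M E] [IsScalarTower k F E] [IsScalarTower k M E]
  [Algebra.IsPushout k F M E]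

variable (k M) in
lemma adjoin_image_eq_top [FiniteDimensional k M] {s : Set F}
    (h : IntermediateField.adjoin k s = ⊤) :
    IntermediateField.adjoin M (algebraMap F E '' s) = ⊤ := by
  have h1 (f : F) : algebraMap F E f ∈ IntermediateField.adjoin M (algebraMap F E '' s) := by
    have hf : f ∈ IntermediateField.adjoin k s := h ▸ IntermediateField.mem_top
    induction hf using IntermediateField.adjoin_induction with
    | mem y hy => exact IntermediateField.subset_adjoin M _ ⟨y, hy, rfl⟩
    | algebraMap m =>
      rw [← IsScalarTower.algebraMap_apply, IsScalarTower.algebraMap_apply k M E]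
      exact algebraMap_mem _ _
    | add y z _ _ hy hz =>
      rw [map_add]
      exact add_mem hy hz
    | inv y _ hy =>
      rw [map_inv₀]
      exact inv_mem hy
    | mul y z _ _ hy hz =>
      rw [map_mul]
      exact mul_mem hy hz
  refine eq_top_iff.mpr fun z _ => ?_
  rw [← sum_pushoutBasis_repr (F := F) (Module.finBasis k M) z]
  exact sum_mem fun i _ => mul_mem (h1 _) (algebraMap_mem _ _)

/-- The elements of E with all coordinates in F₀ = k(s) form a ring integral over F₀, hence a field.
It contains M and s, so it is E, and reading off coordinates gives F = F₀. -/
lemma adjoin_eq_top_of_adjoin_image_eq_top [FiniteDimensional k M] {s : Set F}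
    (h : IntermediateField.adjoin M (algebraMap F E '' s) = ⊤) :
    IntermediateField.adjoin k s = ⊤ := by
  let b := Module.finBasis k M
  let F₀ := IntermediateField.adjoin k s
  let N := scalarExtension E b F₀.toSubalgebra
  let N' : Subalgebra F₀ E :=
    { carrier := N
      mul_mem' := mul_mem
      add_mem' := add_mem
      algebraMap_mem' := fun f => (algebraMap_mem_scalarExtension b).mpr f.2 }
  have hN (z : E) (hz : z ∈ N) : z⁻¹ ∈ N := by
    have hint : IsIntegral F₀ z := by
      rw [← sum_pushoutBasis_repr (F := F) b z]
      refine IsIntegral.sum _ fun i _ => IsIntegral.mul ?_ ?_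
      · exact isIntegral_algebraMap (R := F₀) (A := E)
          (x := ⟨(pushoutBasis k F M E b).repr z i, hz i⟩)
      · exact ((Algebra.IsIntegral.isIntegral (R := k) (b i)).algebraMap (B := E)).tower_top
    exact N'.inv_mem_of_algebraic (x := ⟨z, hz⟩) hint.isAlgebraic
  let N'' : IntermediateField M E := { N with inv_mem' := hN }
  have h1 : (⊤ : IntermediateField M E) ≤ N'' := by
    rw [← h, IntermediateField.adjoin_le_iff]
    rintro _ ⟨f, hf, rfl⟩
    exact (algebraMap_mem_scalarExtension b).mpr (IntermediateField.subset_adjoin k s hf)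
  refine eq_top_iff.mpr fun f _ => ?_
  exact (algebraMap_mem_scalarExtension (E := E) b).mp
    (h1 (IntermediateField.mem_top (x := algebraMap F E f)))

lemma mem_range_of_algebraMap_mem_range {f : F} (hf : algebraMap F E f ∈ (algebraMap M E).range) :
    f ∈ (algebraMap k F).range := by
  obtain ⟨m, hm⟩ := hf
  let b := Module.Basis.ofVectorSpace k M
  obtain ⟨i, hi⟩ : ∃ i, b.repr 1 i ≠ 0 := by
    by_contra! h
    exact one_ne_zero (b.repr.map_eq_zero_iff.mp (Finsupp.ext h))
  have h1 := pushoutBasis_repr_algebraMap (F := F) (E := E) b m i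
  rw [hm, pushoutBasis_repr_algebraMap'] at h1
  refine ⟨b.repr m i / b.repr 1 i, ?_⟩
  rw [map_div₀, ← h1, mul_div_cancel_right₀]
  rwa [_root_.map_ne_zero]

variable (F) in
lemma IsSimpleTranscendental.mem_range_of_isIntegral_of_isPushout
    (h : IsSimpleTranscendental M E) {f : F} (hf : IsIntegral k f) :
    f ∈ (algebraMap k F).range :=
  mem_range_of_algebraMap_mem_range (M := M) (E := E)
    (h.mem_range_of_isIntegral (hf.algebraMap (B := E)).tower_top)

/-- The function field of the affine conic `w ^ 2 = a v ^ 2 + b`. -/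
def IsConicFunctionField (k F : Type*) [Field k] [Field F] [Algebra k F] (a b : k) : Prop :=
  ∃ v w : F, Transcendental k v ∧ w ^ 2 = algebraMap k F a * v ^ 2 + algebraMap k F b ∧
    IntermediateField.adjoin k {v, w} = ⊤

/-- A form of a simple transcendental extension is the function field of a conic. -/
theorem isSimpleTranscendental_or_isConicFunctionField [FiniteDimensional k M] [IsGalois k M]
    [CharZero k] (h : IsSimpleTranscendental M E) :
    IsSimpleTranscendental k F ∨ ∃ a b : k, a ≠ 0 ∧ b ≠ 0 ∧ IsConicFunctionField k F a b := by
  have hconst {f : F} (hf : ¬ Transcendental k f) : f ∈ (algebraMap k F).range :=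
    h.mem_range_of_isIntegral_of_isPushout F (not_not.mp hf).isIntegral
  obtain ⟨v, w, α, β, γ, hv, htop, hvw⟩ := exists_sq_eq_of_isSimpleTranscendental (k := k) (F := F) h
  rw [← Set.image_pair] at htop
  have htop' := adjoin_eq_top_of_adjoin_image_eq_top (k := k) htop
  have hvt : Transcendental k v := by
    by_contra hcon
    obtain ⟨c, rfl⟩ := hconst hcon
    refine hv ⟨algebraMap k M c, ?_⟩
    rw [← IsScalarTower.algebraMap_apply, ← IsScalarTower.algebraMap_apply]
  have hchar : CharZero F := charZero_of_injective_algebraMap (algebraMap k F).injective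
  obtain ⟨a, b, c, habc⟩ : ∃ a b c : k, w ^ 2 = algebraMap k F a * v ^ 2 + algebraMap k F b * v +
      algebraMap k F c := by
    -- The relation has coefficients in M. Comparing one coordinate at which 1 is nonzero, and
    -- dividing by that coordinate of 1, gives a relation over k.
    let B := Module.Basis.ofVectorSpace k M
    obtain ⟨i, hi⟩ : ∃ i, B.repr 1 i ≠ 0 := by
      by_contra! h
      exact one_ne_zero (B.repr.map_eq_zero_iff.mp (Finsupp.ext h))
    have hi' : algebraMap k F (B.repr 1 i) ≠ 0 := by rwa [_root_.map_ne_zero]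
    have h1 : (pushoutBasis k F M E B).repr (algebraMap F E (w ^ 2)) i =
        (pushoutBasis k F M E B).repr (algebraMap F E (v ^ 2) * algebraMap M E α +
          algebraMap F E v * algebraMap M E β + algebraMap F E 1 * algebraMap M E γ) i := by
      simp only [map_pow, map_one, one_mul]
      rw [hvw]
      ring_nf
    rw [map_add, map_add, Finsupp.add_apply, Finsupp.add_apply, pushoutBasis_repr_algebraMap',
      pushoutBasis_repr_algebraMap_mul, pushoutBasis_repr_algebraMap_mul,
      pushoutBasis_repr_algebraMap_mul] at h1
    refine ⟨B.repr α i / B.repr 1 i, B.repr β i / B.repr 1 i, B.repr γ i / B.repr 1 i, ?_⟩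
    simp only [map_div₀]
    field_simp
    linear_combination h1
  have hgen {u : F} (hu : Transcendental k u) (hvu : v ∈ IntermediateField.adjoin k {u})
      (hwu : w ∈ IntermediateField.adjoin k {u}) : IsSimpleTranscendental k F := by
    refine ⟨u, top_le_iff.mp ?_, hu⟩
    rw [← htop', IntermediateField.adjoin_le_iff]
    rintro _ (rfl | rfl)
    · exact hvu
    · exact hwu
  have hself (u : F) := IntermediateField.mem_adjoin_simple_self k u
  have hwconst (hw : w ∈ (algebraMap k F).range) : IsSimpleTranscendental k F := by
    obtain ⟨c, rfl⟩ := hw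
    exact hgen hvt (hself _) (algebraMap_mem _ _)
  -- Degenerate cases: w² = c makes w constant; a parabola w² = b v + c is parametrised by w.
  by_cases ha : a = 0
  · left
    subst ha
    by_cases hb : b = 0
    · subst hb
      refine hwconst (hconst fun hw => hw ?_)
      refine IsAlgebraic.of_pow two_pos ?_
      rw [habc, map_zero, zero_mul, zero_mul, zero_add, zero_add]
      exact isAlgebraic_algebraMap c
    · have hb' : algebraMap k F b ≠ 0 := by rwa [_root_.map_ne_zero]
      have hvw' : v = (w ^ 2 - algebraMap k F c) / algebraMap k F b := by
        rw [eq_div_iff hb', habc, map_zero]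
        ring
      refine hgen (u := w) (fun hw => hvt ?_) ?_ (hself _)
      · rw [hvw', div_eq_mul_inv]
        exact ((hw.pow 2).sub (isAlgebraic_algebraMap c)).mul (isAlgebraic_algebraMap b).inv
      · rw [hvw']
        exact div_mem (sub_mem (pow_mem (hself _) 2) (algebraMap_mem _ _)) (algebraMap_mem _ _)
  · have ha' : algebraMap k F a ≠ 0 := by rwa [_root_.map_ne_zero]
    -- Completing the square. If no constant term is left, (w / v')² = a makes w / v' algebraic,
    -- hence constant, and v' alone generates.
    obtain ⟨v', hv'⟩ : ∃ v', v' = v + algebraMap k F (b / (2 * a)) := ⟨_, rfl⟩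
    have hvv' : v = v' - algebraMap k F (b / (2 * a)) := by rw [hv']; ring
    have hv't : Transcendental k v' := by
      intro hcon
      refine hvt ?_
      rw [hvv']
      exact hcon.sub (isAlgebraic_algebraMap _)
    have habc' : w ^ 2 = algebraMap k F a * v' ^ 2 + algebraMap k F (c - b ^ 2 / (4 * a)) := by
      rw [habc, hvv']
      simp only [map_sub, map_div₀, map_mul, map_pow, map_ofNat]
      field_simp
      ring
    by_cases hd : c - b ^ 2 / (4 * a) = 0
    · left
      rw [hd, map_zero, add_zero] at habc'
      have hv'0 : v' ≠ 0 := by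
        rintro rfl
        exact hv't isAlgebraic_zero
      obtain ⟨r, hr⟩ : w / v' ∈ (algebraMap k F).range := by
        refine hconst fun hw => hw (IsAlgebraic.of_pow two_pos ?_)
        rw [div_pow, habc', mul_div_cancel_right₀ _ (pow_ne_zero 2 hv'0)]
        exact isAlgebraic_algebraMap a
      refine hgen hv't ?_ ?_
      · rw [hvv']
        exact sub_mem (hself _) (algebraMap_mem _ _)
      · rw [← div_mul_cancel₀ w hv'0, ← hr]
        exact mul_mem (algebraMap_mem _ _) (hself _)
    · right
      refine ⟨a, _, ha, hd, v', w, hv't, habc', top_le_iff.mp ?_⟩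
      have hv'mem : v' ∈ IntermediateField.adjoin k {v', w} :=
        IntermediateField.subset_adjoin k _ (Set.mem_insert _ _)
      conv_lhs => rw [← htop']
      rw [IntermediateField.adjoin_le_iff]
      rintro _ (rfl | rfl)
      · rw [hvv']
        exact sub_mem hv'mem (algebraMap_mem _ _)
      · exact IntermediateField.subset_adjoin k _ (Set.mem_insert_of_mem _ rfl)

end

end

noncomputable section

/-! ### Rational points on conics -/

/-- The projective conic `r ^ 2 = a p ^ 2 + b q ^ 2` has a rational point. -/
def ConicHasPoint {k : Type*} [Field k] (a b : k) : Prop :=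
  ∃ p q r : k, (p ≠ 0 ∨ q ≠ 0) ∧ r ^ 2 = a * p ^ 2 + b * q ^ 2

section

variable {k F M E : Type*} [Field k] [Field F] [Field M] [Field E] [Algebra k F] [Algebra k M]
  [Algebra k E] [Algebra F E] [Algebra M E] [IsScalarTower k F E] [IsScalarTower k M E]
  [Algebra.IsPushout k F M E]

/-- Projection from the rational point is a parameter: w - c v for a point at infinity, where a =
c², and the slope (w - R) / (v - P) for an affine point (P, R). -/
lemma IsConicFunctionField.isSimpleTranscendental [CharZero k] {a b : k} (ha : a ≠ 0) (hb : b ≠ 0)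
    (h : IsConicFunctionField k F a b) (hp : ConicHasPoint a b) : IsSimpleTranscendental k F := by
  obtain ⟨v, w, hv, hvw, htop⟩ := h
  have ha' : algebraMap k F a ≠ 0 := by rwa [_root_.map_ne_zero]
  have hb' : algebraMap k F b ≠ 0 := by rwa [_root_.map_ne_zero]
  have key (s : F) (hvs : v ∈ IntermediateField.adjoin k {s})
      (hws : w ∈ IntermediateField.adjoin k {s}) : IsSimpleTranscendental k F := by
    refine ⟨s, top_le_iff.mp ?_, fun hs => hv ?_⟩
    · rw [← htop, IntermediateField.adjoin_le_iff]
      rintro _ (rfl | rfl)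
      · exact hvs
      · exact hws
    · have := IntermediateField.isAlgebraic_adjoin_simple hs.isIntegral
      exact (this.isAlgebraic ⟨v, hvs⟩).algebraMap (A := F)
  have hchar : CharZero F := charZero_of_injective_algebraMap (algebraMap k F).injective
  obtain ⟨p, q, r, hpq, hr⟩ := hp
  by_cases hq : q = 0
  · subst hq
    have hp : p ≠ 0 := by simpa using hpq
    have hp' : algebraMap k F p ≠ 0 := by rwa [_root_.map_ne_zero]
    obtain ⟨c, hc⟩ : ∃ c : k, a = c ^ 2 := ⟨r / p, by field_simp; linear_combination -hr⟩
    have hc0 : c ≠ 0 := by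
      rintro rfl
      exact ha (by rw [hc]; ring)
    have hc0' : algebraMap k F c ≠ 0 := by rwa [_root_.map_ne_zero]
    rw [hc, map_pow] at hvw
    set s := w - algebraMap k F c * v with hs
    have h1 : s * (s + 2 * (algebraMap k F c * v)) = algebraMap k F b := by
      rw [hs]
      linear_combination hvw
    have hs0 : s ≠ 0 := by
      intro h
      rw [h, zero_mul] at h1
      exact hb' h1.symm
    have hss := IntermediateField.mem_adjoin_simple_self k s
    have h2 : w + algebraMap k F c * v ∈ IntermediateField.adjoin k {s} := by
      have : w + algebraMap k F c * v = algebraMap k F b / s := by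
        rw [eq_div_iff hs0, ← h1, hs]
        ring
      rw [this]
      exact div_mem (algebraMap_mem _ _) hss
    have hvs : v ∈ IntermediateField.adjoin k {s} := by
      have : v = (w + algebraMap k F c * v - s) / (2 * algebraMap k F c) := by
        rw [eq_div_iff (mul_ne_zero two_ne_zero hc0'), hs]
        ring
      rw [this]
      exact div_mem (sub_mem h2 hss) (mul_mem (ofNat_mem _ 2) (algebraMap_mem _ _))
    refine key s hvs ?_
    have : w = s + algebraMap k F c * v := by rw [hs]; ring
    rw [this]
    exact add_mem hss (mul_mem (algebraMap_mem _ _) hvs)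
  · obtain ⟨p₁, r₁, hr₁⟩ : ∃ p₁ r₁ : k, r₁ ^ 2 = a * p₁ ^ 2 + b :=
      ⟨p / q, r / q, by field_simp; linear_combination hr⟩
    set P := algebraMap k F p₁
    set R := algebraMap k F r₁
    have hR : R ^ 2 = algebraMap k F a * P ^ 2 + algebraMap k F b := by
      simp only [P, R, ← map_pow, ← map_mul, ← map_add, hr₁]
    have hvP : v - P ≠ 0 := by
      intro h
      rw [sub_eq_zero.mp h] at hv
      exact hv (isAlgebraic_algebraMap _)
    set s := (w - R) / (v - P)
    have h1 : s * (v - P) = w - R := div_mul_cancel₀ _ hvP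
    have h2 : s * (w + R) = algebraMap k F a * (v + P) := by
      refine mul_left_cancel₀ hvP ?_
      linear_combination (w + R) * h1 + hvw - hR
    have h3 : v * (s ^ 2 - algebraMap k F a) = algebraMap k F a * P + s ^ 2 * P - 2 * R * s := by
      linear_combination h2 + s * h1
    -- A slope with s² = a would force R s = a P, and squaring this against R² = a P² + b gives a b
    -- = 0.
    have h4 : s ^ 2 - algebraMap k F a ≠ 0 := by
      intro h
      rw [h, mul_zero] at h3
      have h5 : R * s = algebraMap k F a * P := by
        have : (2 : F) * (R * s) = 2 * (algebraMap k F a * P) := by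
          linear_combination h3 + P * h
        exact mul_left_cancel₀ two_ne_zero this
      have h6 : algebraMap k F a * algebraMap k F b = 0 := by
        linear_combination (-(algebraMap k F a)) * hR + (R * s + algebraMap k F a * P) * h5 -
          R ^ 2 * h
      exact mul_ne_zero ha' hb' h6
    have hss := IntermediateField.mem_adjoin_simple_self k s
    have hvs : v ∈ IntermediateField.adjoin k {s} := by
      rw [eq_div_of_mul_eq h4 h3]
      exact div_mem (sub_mem (add_mem (mul_mem (algebraMap_mem _ _) (algebraMap_mem _ _))
        (mul_mem (pow_mem hss 2) (algebraMap_mem _ _)))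
        (mul_mem (mul_mem (ofNat_mem _ 2) (algebraMap_mem _ _)) hss))
        (sub_mem (pow_mem hss 2) (algebraMap_mem _ _))
    refine key s hvs ?_
    have : w = s * (v - P) + R := by rw [h1]; ring
    rw [this]
    exact add_mem (mul_mem hss (sub_mem hvs (algebraMap_mem _ _))) (algebraMap_mem _ _)

variable (M E) in
lemma IsConicFunctionField.baseChange [FiniteDimensional k M] {a b : k}
    (h : IsConicFunctionField k F a b) :
    IsConicFunctionField M E (algebraMap k M a) (algebraMap k M b) := by
  obtain ⟨v, w, hv, hvw, htop⟩ := h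
  refine ⟨algebraMap F E v, algebraMap F E w, fun halg => hv ?_, ?_, ?_⟩
  · have h1 : IsAlgebraic k (algebraMap F E v) := halg.restrictScalars k
    exact (isAlgebraic_algebraMap_iff (algebraMap F E).injective).mp h1
  · rw [← map_pow, hvw]
    simp only [map_add, map_mul, map_pow, ← IsScalarTower.algebraMap_apply]
  · rw [← Set.image_pair]
    exact adjoin_image_eq_top k M htop

end

end

noncomputable section

open Polynomial

/-! ### Maps between conics -/

section

variable {k : Type*} [Field k]

lemma coeff_sq_of_natDegree_le {p : k[X]} {n : ℕ} (hp : p.natDegree ≤ n) :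
    (p ^ 2).coeff (n + n) = p.coeff n ^ 2 := by
  rw [sq, coeff_mul_add_eq_of_natDegree_le hp hp, sq]

/-- The form `⟨a, b, -ab⟩` is anisotropic if the conic has no rational point. -/
lemma eq_zero_of_not_conicHasPoint {a b : k} (ha : a ≠ 0) (hb : b ≠ 0) (hab : ¬ ConicHasPoint a b)
    {x y z : k} (h : a * x ^ 2 + b * y ^ 2 - a * b * z ^ 2 = 0) : x = 0 ∧ y = 0 ∧ z = 0 := by
  by_cases hxy : x = 0 ∧ y = 0
  · obtain ⟨rfl, rfl⟩ := hxy
    simpa [ha, hb] using h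
  -- Multiplying the isotropy relation by ab turns it into (abz)² = a (by)² + b (ax)².
  · refine absurd ⟨b * y, a * x, a * b * z, ?_, by linear_combination (-(a * b)) * h⟩ hab
    simp only [ne_eq, mul_eq_zero, ha, hb, false_or]
    tauto

/-- Leading coefficients cannot cancel: if the largest degree n exceeded m, the coefficients of X^n
in x, y, z would be a nontrivial zero of the anisotropic form. -/
lemma natDegree_le_of_anisotropic {a b : k} (ha : a ≠ 0) (hb : b ≠ 0) (hab : ¬ ConicHasPoint a b)
    {x y z g : k[X]} {m : ℕ} (hg : g.natDegree ≤ m + m)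
    (h : C a * x ^ 2 + C b * y ^ 2 - C (a * b) * z ^ 2 = g) :
    x.natDegree ≤ m ∧ y.natDegree ≤ m ∧ z.natDegree ≤ m := by
  set n := max x.natDegree (max y.natDegree z.natDegree) with hn
  by_contra hcon
  have hmn : m < n := by
    by_contra hmn
    exact hcon ⟨by omega, by omega, by omega⟩
  have h1 := congrArg (coeff · (n + n)) h
  simp only [coeff_sub, coeff_add, coeff_C_mul] at h1
  rw [coeff_sq_of_natDegree_le (n := n) (by omega), coeff_sq_of_natDegree_le (n := n) (by omega),
    coeff_sq_of_natDegree_le (n := n) (by omega),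
    coeff_eq_zero_of_natDegree_lt (p := g) (by omega)] at h1
  obtain ⟨hx, hy, hz⟩ := eq_zero_of_not_conicHasPoint ha hb hab h1
  have key {p : k[X]} (hp : p.natDegree = n) (hp' : p.coeff n = 0) : False := by
    rw [← hp, coeff_natDegree, leadingCoeff_eq_zero] at hp'
    rw [hp', natDegree_zero] at hp
    omega
  rcases (by omega : x.natDegree = n ∨ y.natDegree = n ∨ z.natDegree = n) with h | h | h
  · exact key h hx
  · exact key h hy
  · exact key h hz

lemma polynomial_eq_zero_of_not_conicHasPoint {a b : k} (ha : a ≠ 0) (hb : b ≠ 0)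
    (hab : ¬ ConicHasPoint a b) {x y z : k[X]}
    (h : C a * x ^ 2 + C b * y ^ 2 - C (a * b) * z ^ 2 = 0) : x = 0 ∧ y = 0 ∧ z = 0 := by
  obtain ⟨hx, hy, hz⟩ := natDegree_le_of_anisotropic ha hb hab (m := 0) (by simp) h
  rw [natDegree_le_iff_degree_le] at hx hy hz
  rw [eq_C_of_degree_le_zero hx, eq_C_of_degree_le_zero hy, eq_C_of_degree_le_zero hz] at h ⊢
  simp only [← C_pow, ← C_mul, ← C_add, ← C_sub, C_eq_zero] at h ⊢
  exact eq_zero_of_not_conicHasPoint ha hb hab h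

/-- The Cassels–Pfister theorem for the form `⟨a, b, -ab⟩`. -/
lemma exists_polynomial_eq_of_mul_sq_eq {a b : k} (ha : a ≠ 0) (hb : b ≠ 0)
    (hab : ¬ ConicHasPoint a b) (g : k[X]) : ∀ (n : ℕ) (d x y z : k[X]), d ≠ 0 → d.natDegree = n →
    C a * x ^ 2 + C b * y ^ 2 - C (a * b) * z ^ 2 = g * d ^ 2 →
    ∃ x' y' z' : k[X], C a * x' ^ 2 + C b * y' ^ 2 - C (a * b) * z' ^ 2 = g := by
  intro n
  induction n using Nat.strong_induction_on with
  | _ n ih =>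
    intro d x y z hd hdn h
    have hx := EuclideanDomain.div_add_mod x d
    have hy := EuclideanDomain.div_add_mod y d
    have hz := EuclideanDomain.div_add_mod z d
    set x₁ := x / d
    set y₁ := y / d
    set z₁ := z / d
    set x₂ := x % d with hx₂
    set y₂ := y % d with hy₂
    set z₂ := z % d with hz₂
    set r := C a * x₂ ^ 2 + C b * y₂ ^ 2 - C (a * b) * z₂ ^ 2 with hr
    by_cases hr0 : r = 0
    · obtain ⟨h1, h2, h3⟩ := polynomial_eq_zero_of_not_conicHasPoint ha hb hab hr0
      refine ⟨x₁, y₁, z₁, mul_right_cancel₀ (pow_ne_zero 2 hd) ?_⟩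
      rw [← h, ← hx, ← hy, ← hz, h1, h2, h3]
      ring
    -- The line through the point (x, y, z)/d of the quadric φ = g and its polynomial part (x₁, y₁,
    -- z₁) meets the quadric again at a point with denominator α d + β. Since d (α d + β) is the
    -- value of φ at the remainders, the new denominator has smaller degree.
    · set α := C a * x₁ ^ 2 + C b * y₁ ^ 2 - C (a * b) * z₁ ^ 2 - g with hα
      set β := 2 * (g * d - (C a * x * x₁ + C b * y * y₁ - C (a * b) * z * z₁)) with hβ
      have hdd : d * (α * d + β) = r := by
        rw [hr, hα, hβ, eq_sub_of_add_eq' hx, eq_sub_of_add_eq' hy, eq_sub_of_add_eq' hz]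
        linear_combination -h
      have hd0 : α * d + β ≠ 0 := by
        intro h0
        rw [h0, mul_zero] at hdd
        exact hr0 hdd.symm
      have hdpos : 0 < d.natDegree := by
        by_contra hcon
        have : IsUnit d := by
          rw [Polynomial.isUnit_iff]
          refine ⟨d.coeff 0, IsUnit.mk0 _ ?_, (eq_C_of_natDegree_eq_zero (by omega)).symm⟩
          intro h0
          apply hd
          rw [eq_C_of_natDegree_eq_zero (p := d) (by omega), h0, C_0]
        refine hr0 ?_
        rw [hr, hx₂, hy₂, hz₂, EuclideanDomain.mod_eq_zero.mpr (this.dvd),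
          EuclideanDomain.mod_eq_zero.mpr (this.dvd), EuclideanDomain.mod_eq_zero.mpr (this.dvd)]
        ring
      have hmod (p : k[X]) : (p % d).natDegree ≤ d.natDegree - 1 := by
        have := natDegree_mod_lt p hdpos.ne'
        omega
      have hsq (c : k) (p : k[X]) : (C c * (p % d) ^ 2).natDegree ≤ 2 * (d.natDegree - 1) :=
        (natDegree_C_mul_le _ _).trans (natDegree_pow_le_of_le 2 (hmod p))
      have hrdeg : r.natDegree ≤ 2 * (d.natDegree - 1) :=
        (natDegree_sub_le_of_le (natDegree_add_le_of_degree_le (hsq a x) (hsq b y))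
          (hsq _ z)).trans (max_self _).le
      have hdeg := congrArg natDegree hdd
      rw [natDegree_mul hd hd0] at hdeg
      refine ih _ (by omega) (α * d + β) (α * x + β * x₁) (α * y + β * y₁) (α * z + β * z₁) hd0 rfl
        ?_
      linear_combination α ^ 2 * h - β ^ 2 * hα + α * β * hβ

/-- If a polynomial `a' X ^ 2 + b'` is represented by the form `⟨a, b, -ab⟩`, then the conic attached
to `a'` and `b'` has a point over every field over which the conic attached to `a` and `b` has one. -/
lemma conicHasPoint_of_polynomial_eq [CharZero k] {a b a' b' : k} (ha : a ≠ 0) (hb : b ≠ 0) (ha' : a' ≠ 0)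
    (hb' : b' ≠ 0) (hab : ¬ ConicHasPoint a b) {x y z : k[X]}
    (h : C a * x ^ 2 + C b * y ^ 2 - C (a * b) * z ^ 2 = C a' * X ^ 2 + C b')
    {L : Type*} [Field L] [Algebra k L] (hL : ConicHasPoint (algebraMap k L a) (algebraMap k L b)) :
    ConicHasPoint (algebraMap k L a') (algebraMap k L b') := by
  obtain ⟨hx, hy, hz⟩ := natDegree_le_of_anisotropic ha hb hab (m := 1) (by compute_degree) h
  obtain ⟨x₁, x₀, rfl⟩ := exists_eq_X_add_C_of_natDegree_le_one hx
  obtain ⟨y₁, y₀, rfl⟩ := exists_eq_X_add_C_of_natDegree_le_one hy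
  obtain ⟨z₁, z₀, rfl⟩ := exists_eq_X_add_C_of_natDegree_le_one hz
  have hexp : C (a * x₁ ^ 2 + b * y₁ ^ 2 - a * b * z₁ ^ 2 - a') * X ^ 2 +
      C (2 * (a * x₁ * x₀ + b * y₁ * y₀ - a * b * z₁ * z₀)) * X +
      C (a * x₀ ^ 2 + b * y₀ ^ 2 - a * b * z₀ ^ 2 - b') = 0 := by
    simp only [map_sub, map_add, map_mul, map_pow, map_ofNat] at h ⊢
    linear_combination h
  have h2 := congrArg (coeff · 2) hexp
  have h1 := congrArg (coeff · 1) hexp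
  have h0 := congrArg (coeff · 0) hexp
  simp only [coeff_add, coeff_C_mul, coeff_X_pow, coeff_X, coeff_C, coeff_zero] at h0 h1 h2
  norm_num at h0 h1 h2
  clear h hx hy hz hexp
  obtain ⟨p, q, r, hpq, hr⟩ := hL
  set ι := algebraMap k L
  have hι {c : k} (hc : c ≠ 0) : ι c ≠ 0 := by rwa [_root_.map_ne_zero]
  replace h0 := congrArg ι h0
  replace h1 := congrArg ι h1
  replace h2 := congrArg ι h2
  simp only [map_sub, map_add, map_mul, map_pow, map_zero] at h0 h1 h2
  replace ha' := hι ha'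
  replace hb' := hι hb'
  replace ha := hι ha
  replace hb := hι hb
  have hpqr : ¬ (ι b * q = 0 ∧ ι a * p = 0) := by
    rintro ⟨h3, h4⟩
    rcases hpq with h | h
    · exact mul_ne_zero ha h h4
    · exact mul_ne_zero hb h h3
  have hiso : ι a * (ι b * q) ^ 2 + ι b * (ι a * p) ^ 2 - ι a * ι b * r ^ 2 = 0 := by
    linear_combination (-(ι a * ι b)) * hr
  generalize ι b * q = n₁ at *
  generalize ι a * p = n₂ at *
  generalize ι a = A at *
  generalize ι b = B at *
  generalize ι a' = A' at *
  generalize ι b' = B' at *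
  generalize ι x₁ = x₁ at *
  generalize ι x₀ = x₀ at *
  generalize ι y₁ = y₁ at *
  generalize ι y₀ = y₀ at *
  generalize ι z₁ = z₁ at *
  generalize ι z₀ = z₀ at *
  obtain rfl : A' = A * x₁ ^ 2 + B * y₁ ^ 2 - A * B * z₁ ^ 2 := by linear_combination -h2
  obtain rfl : B' = A * x₀ ^ 2 + B * y₀ ^ 2 - A * B * z₀ ^ 2 := by linear_combination -h0
  clear h0 h2
  -- Gram determinant of n, u₁ = (x₁, y₁, z₁) and u₀ = (x₀, y₀, z₀) for φ = ⟨A, B, -AB⟩, whose own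
  -- determinant is -(AB)². Here n is isotropic by `hiso` and u₁, u₀ are orthogonal by `h1`, which
  -- leaves (AB det)² = φ(u₁) φ(n, u₀)² + φ(u₀) φ(n, u₁)².
  have hid : (A * B * (n₁ * (y₁ * z₀ - z₁ * y₀) + n₂ * (z₁ * x₀ - x₁ * z₀) +
      r * (x₁ * y₀ - y₁ * x₀))) ^ 2 =
      (A * x₁ ^ 2 + B * y₁ ^ 2 - A * B * z₁ ^ 2) *
        (A * n₁ * x₀ + B * n₂ * y₀ - A * B * r * z₀) ^ 2 +
      (A * x₀ ^ 2 + B * y₀ ^ 2 - A * B * z₀ ^ 2) *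
        (A * n₁ * x₁ + B * n₂ * y₁ - A * B * r * z₁) ^ 2 := by
    linear_combination (-2 * (A * n₁ * x₀ + B * n₂ * y₀ - A * B * r * z₀) *
        (A * n₁ * x₁ + B * n₂ * y₁ - A * B * r * z₁)) * h1 -
      ((A * x₁ ^ 2 + B * y₁ ^ 2 - A * B * z₁ ^ 2) * (A * x₀ ^ 2 + B * y₀ ^ 2 - A * B * z₀ ^ 2) -
        (A * x₁ * x₀ + B * y₁ * y₀ - A * B * z₁ * z₀) ^ 2) * hiso
  refine ⟨_, _, _, ?_, hid⟩
  -- If both products vanish, so does the determinant. Then n is orthogonal to u₀ and u₁ and lies in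
  -- their span, on which φ is nondegenerate, so its first two coordinates would be zero.
  by_contra! hcon
  obtain ⟨e0, e1⟩ := hcon
  rw [e0, e1, zero_pow two_ne_zero, mul_zero, mul_zero, add_zero] at hid
  have e2 := (mul_eq_zero.mp (pow_eq_zero_iff two_ne_zero |>.mp hid)).resolve_left
    (mul_ne_zero ha hb)
  refine hpqr ⟨?_, ?_⟩
  · refine (mul_eq_zero.mp ?_).resolve_left (mul_ne_zero ha' hb')
    linear_combination (A * x₀ ^ 2 + B * y₀ ^ 2 - A * B * z₀ ^ 2) * x₁ * e1 +
      (A * x₁ ^ 2 + B * y₁ ^ 2 - A * B * z₁ ^ 2) * x₀ * e0 -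
      A * B ^ 2 * (y₁ * z₀ - z₁ * y₀) * e2 +
      ((A * x₁ * x₀ + B * y₁ * y₀ - A * B * z₁ * z₀) * n₁ -
        (A * n₁ * x₀ + B * n₂ * y₀ - A * B * r * z₀) * x₁ -
        (A * n₁ * x₁ + B * n₂ * y₁ - A * B * r * z₁) * x₀) * h1
  · refine (mul_eq_zero.mp ?_).resolve_left (mul_ne_zero ha' hb')
    linear_combination (A * x₀ ^ 2 + B * y₀ ^ 2 - A * B * z₀ ^ 2) * y₁ * e1 +
      (A * x₁ ^ 2 + B * y₁ ^ 2 - A * B * z₁ ^ 2) * y₀ * e0 -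
      A ^ 2 * B * (z₁ * x₀ - x₁ * z₀) * e2 +
      ((A * x₁ * x₀ + B * y₁ * y₀ - A * B * z₁ * z₀) * n₂ -
        (A * n₁ * x₀ + B * n₂ * y₀ - A * B * r * z₀) * y₁ -
        (A * n₁ * x₁ + B * n₂ * y₁ - A * B * r * z₁) * y₀) * h1

end

end

/-! ### Quadratic extensions of k(s) and the comparison of two conics -/

noncomputable section

open Polynomial

section

variable {k F : Type*} [Field k] [Field F] [Algebra k F]

/-- Linear independence of `1` and `y` over `k(s)`, for `y` not in `k(s)`. -/
lemma eq_zero_of_aeval_add_mul_eq_zero {s y : F} (hs : Transcendental k s)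
    (hys : y ∉ IntermediateField.adjoin k {s}) {p q : k[X]}
    (h : aeval s p + aeval s q * y = 0) : p = 0 ∧ q = 0 := by
  have hmem (r : k[X]) : aeval s r ∈ IntermediateField.adjoin k {s} :=
    IntermediateField.algebra_adjoin_le_adjoin k _ (aeval_mem_adjoin_singleton k s)
  have hq : aeval s q = 0 := by
    by_contra hq
    apply hys
    have : y = -aeval s p / aeval s q := by
      rw [eq_div_iff hq]
      linear_combination h
    rw [this]
    exact div_mem (neg_mem (hmem p)) (hmem q)
  rw [hq, zero_mul, add_zero] at h
  rw [transcendental_iff] at hs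
  exact ⟨hs p h, hs q hq⟩

/-- Elements of a quadratic extension of `k(s)`. -/
lemma exists_mul_aeval_eq_add_mul {s y : F} {g : k[X]} (hs : Transcendental k s)
    (hy : y ^ 2 = aeval s g) (hys : y ∉ IntermediateField.adjoin k {s})
    (htop : IntermediateField.adjoin k {s, y} = ⊤) (z : F) :
    ∃ d p q : k[X], d ≠ 0 ∧ z * aeval s d = aeval s p + aeval s q * y := by
  have hz : z ∈ IntermediateField.adjoin k {s, y} := htop ▸ IntermediateField.mem_top
  induction hz using IntermediateField.adjoin_induction with
  | mem z hz =>
    rcases hz with rfl | rfl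
    · exact ⟨1, X, 0, one_ne_zero, by simp⟩
    · exact ⟨1, 0, 1, one_ne_zero, by simp⟩
  | algebraMap m => exact ⟨1, C m, 0, one_ne_zero, by simp⟩
  | add z z' _ _ hz hz' =>
    obtain ⟨d, p, q, hd, h⟩ := hz
    obtain ⟨d', p', q', hd', h'⟩ := hz'
    refine ⟨d * d', p * d' + p' * d, q * d' + q' * d, mul_ne_zero hd hd', ?_⟩
    simp only [map_add, map_mul]
    linear_combination aeval s d' * h + aeval s d * h'
  | inv z _ hz =>
    by_cases hz0 : z = 0
    · exact ⟨1, 0, 0, one_ne_zero, by simp [hz0]⟩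
    obtain ⟨d, p, q, hd, h⟩ := hz
    refine ⟨p ^ 2 - g * q ^ 2, d * p, -(d * q), fun h0 => hd ?_, ?_⟩
    · have h1 : (aeval s p + aeval s q * y) * (aeval s p + aeval s (-q) * y) = 0 := by
        have := congrArg (aeval s) h0
        simp only [map_sub, map_mul, map_pow, map_zero, map_neg, ← hy] at this ⊢
        linear_combination this
      have h2 : p = 0 ∧ q = 0 := by
        rcases mul_eq_zero.mp h1 with h1 | h1
        · exact eq_zero_of_aeval_add_mul_eq_zero hs hys h1
        · simpa using eq_zero_of_aeval_add_mul_eq_zero hs hys h1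
      rw [h2.1, h2.2, map_zero, zero_mul, add_zero] at h
      exact transcendental_iff.mp hs d ((mul_eq_zero.mp h).resolve_left hz0)
    · refine mul_left_cancel₀ hz0 ?_
      rw [mul_inv_cancel_left₀ hz0]
      simp only [map_sub, map_mul, map_pow, map_neg, ← hy]
      linear_combination -(aeval s p - aeval s q * y) * h
  | mul z z' _ _ hz hz' =>
    obtain ⟨d, p, q, hd, h⟩ := hz
    obtain ⟨d', p', q', hd', h'⟩ := hz'
    refine ⟨d * d', p * p' + q * q' * g, p * q' + q * p', mul_ne_zero hd hd', ?_⟩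
    simp only [map_add, map_mul, ← hy]
    linear_combination z' * aeval s d' * h + (aeval s p + aeval s q * y) * h'

/-- A morphism from an anisotropic conic to another one: over each field over which the first one
has a point, so has the second one. -/
theorem IsConicFunctionField.conicHasPoint_of_algHom [CharZero k] {F' : Type*} [Field F']
    [Algebra k F'] {a b a' b' : k} (ha : a ≠ 0) (hb : b ≠ 0) (ha' : a' ≠ 0) (hb' : b' ≠ 0)
    (hF : IsConicFunctionField k F a b) (hF' : IsConicFunctionField k F' a' b') (φ : F →ₐ[k] F')
    (hab : ¬ ConicHasPoint a b) (hns : ¬ IsSimpleTranscendental k F')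
    {L : Type*} [Field L] [Algebra k L]
    (hL : ConicHasPoint (algebraMap k L a) (algebraMap k L b)) :
    ConicHasPoint (algebraMap k L a') (algebraMap k L b') := by
  obtain ⟨v₀, w₀, -, hvw₀, -⟩ := hF
  obtain ⟨s, y, hs, hsy, htop⟩ := hF'
  have hvw : φ w₀ ^ 2 = algebraMap k F' a * φ v₀ ^ 2 + algebraMap k F' b := by
    rw [← map_pow, hvw₀]
    simp
  generalize φ w₀ = w at hvw
  generalize φ v₀ = v at hvw
  have hys : y ∉ IntermediateField.adjoin k {s} := by
    intro hy
    refine hns ⟨s, top_le_iff.mp ?_, hs⟩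
    rw [← htop, IntermediateField.adjoin_le_iff]
    rintro _ (rfl | rfl)
    · exact IntermediateField.mem_adjoin_simple_self k _
    · exact hy
  set g : k[X] := C a' * X ^ 2 + C b' with hg
  have hy : y ^ 2 = aeval s g := by simpa [hg] using hsy
  obtain ⟨d₁, p₁, q₁, hd₁, h₁⟩ := exists_mul_aeval_eq_add_mul hs hy hys htop v
  obtain ⟨d₂, p₂, q₂, hd₂, h₂⟩ := exists_mul_aeval_eq_add_mul hs hy hys htop w
  obtain ⟨d, P₁, Q₁, P₂, Q₂, hd, hv, hw⟩ : ∃ d P₁ Q₁ P₂ Q₂ : k[X], d ≠ 0 ∧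
      v * aeval s d = aeval s P₁ + aeval s Q₁ * y ∧
      w * aeval s d = aeval s P₂ + aeval s Q₂ * y := by
    refine ⟨d₁ * d₂, p₁ * d₂, q₁ * d₂, p₂ * d₁, q₂ * d₁, mul_ne_zero hd₁ hd₂, ?_, ?_⟩
    · simp only [map_mul]
      linear_combination aeval s d₂ * h₁
    · simp only [map_mul]
      linear_combination aeval s d₁ * h₂
  -- The equation of the first conic, multiplied by d², splits into its components along 1 and y,
  -- where y² = g(s).
  obtain ⟨e₁, e₂⟩ : P₂ ^ 2 + g * Q₂ ^ 2 - C a * P₁ ^ 2 - C a * g * Q₁ ^ 2 - C b * d ^ 2 = 0 ∧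
      2 * (P₂ * Q₂ - C a * P₁ * Q₁) = 0 := by
    refine eq_zero_of_aeval_add_mul_eq_zero hs hys ?_
    simp only [map_sub, map_add, map_mul, map_pow, ← hy, map_ofNat, aeval_C]
    linear_combination aeval s d ^ 2 * hvw - (w * aeval s d + (aeval s P₂ + aeval s Q₂ * y)) * hw +
      algebraMap k F' a * (v * aeval s d + (aeval s P₁ + aeval s Q₁ * y)) * hv
  replace e₂ := (mul_eq_zero.mp e₂).resolve_left two_ne_zero
  have aniso {p q r : k[X]} (h : r ^ 2 = C a * p ^ 2 + C b * q ^ 2) : p = 0 ∧ q = 0 := by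
    obtain ⟨h1, h2, -⟩ := polynomial_eq_zero_of_not_conicHasPoint ha hb hab (x := C b * q)
      (y := C a * p) (z := r) (by simp only [C_mul]; linear_combination -C a * C b * h)
    exact ⟨by simpa [ha] using h2, by simpa [hb] using h1⟩
  -- Otherwise anisotropy gives Q₁ = Q₂ = 0, and then P₂² = a P₁² + b d² gives d = 0.
  have hΔ : C a * Q₁ ^ 2 - Q₂ ^ 2 ≠ 0 := by
    intro h
    obtain ⟨rfl, -⟩ := aniso (p := Q₁) (q := 0) (r := Q₂) (by linear_combination -h)
    have h2 : Q₂ = 0 := by simpa using h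
    rw [h2] at e₁
    exact hd (aniso (p := P₁) (q := d) (r := P₂) (by linear_combination e₁)).2
  -- A point of the conic (a, b) over k(s)(√g) makes g a value of the pure quaternion form over
  -- k(s). By e₁ and e₂ the listed vector has value g (a Q₁² - Q₂²)², so Cassels–Pfister removes the
  -- denominator.
  obtain ⟨x, y', z, h⟩ := exists_polynomial_eq_of_mul_sq_eq ha hb hab g _ _ (P₂ * Q₁ - P₁ * Q₂)
    (d * Q₂) (d * Q₁) hΔ rfl (by
      simp only [C_mul]
      linear_combination (C a * Q₁ ^ 2 - Q₂ ^ 2) * e₁ + (P₂ * Q₂ - C a * P₁ * Q₁) * e₂)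
  exact conicHasPoint_of_polynomial_eq ha hb ha' hb' hab h hL

end

end

noncomputable section

/-! ### Quadratic fields over which a conic has a point -/

section

open NumberField IsDedekindDomain

variable {k : Type*} [Field k] [NumberField k]

/-- For large j the element exceeds 1 in absolute value at every infinite place. The inverse of such
a unit would be a nonzero integer of absolute value below 1 at all of them, which is impossible. The
bound 2 absorbs the summand 1. -/
lemma exists_not_isUnit_one_add_mul_sq {m : 𝓞 k} (hm : m ≠ 0) :
    ∃ j : ℕ, ¬ IsUnit (1 + m * (j : 𝓞 k) ^ 2) := by
  have hev : ∀ᶠ j : ℕ in Filter.atTop, ∀ w : InfinitePlace k,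
      2 < ‖w.embedding (m : k)‖ * (j : ℝ) ^ 2 := by
    refine Filter.eventually_all.mpr fun w => ?_
    have hpos : 0 < ‖w.embedding (m : k)‖ := by
      rw [norm_pos_iff, _root_.map_ne_zero]
      exact RingOfIntegers.coe_ne_zero_iff.mpr hm
    exact (Filter.Tendsto.const_mul_atTop hpos ((Filter.tendsto_pow_atTop two_ne_zero).comp
      tendsto_natCast_atTop_atTop)).eventually_gt_atTop 2
  obtain ⟨j, hj⟩ := hev.exists
  refine ⟨j, fun ⟨u, hu⟩ => ?_⟩
  have hlt (w : InfinitePlace k) : w ((u⁻¹ : (𝓞 k)ˣ) : k) < 1 := by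
    have h1 : w ((u : 𝓞 k) : k) * w ((u⁻¹ : (𝓞 k)ˣ) : k) = 1 := by
      rw [← map_mul, ← map_mul, Units.mul_inv, map_one, map_one]
    have h2 : 1 < w ((u : 𝓞 k) : k) := by
      rw [hu, ← InfinitePlace.norm_embedding_eq]
      have h3 : w.embedding ((1 + m * (j : 𝓞 k) ^ 2 : 𝓞 k) : k) =
        1 + w.embedding (m : k) * (j : ℂ) ^ 2 := by simp
      rw [h3]
      have h4 := norm_sub_norm_le (w.embedding (m : k) * (j : ℂ) ^ 2) (-1)
      have h5 : ‖w.embedding (m : k) * (j : ℂ) ^ 2‖ = ‖w.embedding (m : k)‖ * (j : ℝ) ^ 2 := by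
        rw [norm_mul, norm_pow, Complex.norm_natCast]
      rw [norm_neg, norm_one, sub_neg_eq_add, add_comm _ (1 : ℂ), h5] at h4
      linarith [hj w]
    by_contra! h3
    nlinarith
  obtain ⟨w⟩ : Nonempty (InfinitePlace k) := inferInstance
  exact (InfinitePlace.one_le_of_lt_one (u⁻¹).ne_zero fun z _ => hlt z).not_gt (hlt w)

/-- Euclid's argument. Let s clear the denominators of a, b, the elements of C and their inverses,
with a' = s a and b' = s b. For t = b' s j one gets a t² + b = b (1 + a' b' s² j²). A prime
containing the bracket cannot contain s, so the nonzero elements of C are units at it. -/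
lemma exists_heightOneSpectrum_valuation_lt_one {a b : k} (ha : a ≠ 0) (hb : b ≠ 0) (C : Finset k) :
    ∃ (P : HeightOneSpectrum (𝓞 k)) (t : k), P.valuation k t ≤ 1 ∧
      P.valuation k (a * t ^ 2 + b) < 1 ∧ ∀ c ∈ C, c ≠ 0 → P.valuation k c = 1 := by
  classical
  obtain ⟨⟨s, hs⟩, hint⟩ := IsLocalization.exist_integer_multiples_of_finset
    (nonZeroDivisors (𝓞 k)) ({a, b} ∪ C ∪ C.image (·⁻¹))
  have hs0 : s ≠ 0 := nonZeroDivisors.ne_zero hs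
  have hs0' : algebraMap (𝓞 k) k s ≠ 0 := by
    rw [Ne, FaithfulSMul.algebraMap_eq_zero_iff]
    exact hs0
  obtain ⟨a', ha'⟩ := hint a (by simp)
  obtain ⟨b', hb'⟩ := hint b (by simp)
  rw [Algebra.smul_def] at ha' hb'
  have hne {x : k} {x' : 𝓞 k} (hx : x ≠ 0) (h : algebraMap (𝓞 k) k x' = algebraMap (𝓞 k) k s * x) :
      x' ≠ 0 := by
    rintro rfl
    rw [map_zero] at h
    exact mul_ne_zero hs0' hx h.symm
  obtain ⟨j, hj⟩ := exists_not_isUnit_one_add_mul_sq (mul_ne_zero (mul_ne_zero (hne ha ha')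
    (hne hb hb')) (pow_ne_zero 2 hs0))
  set u := 1 + a' * b' * s ^ 2 * (j : 𝓞 k) ^ 2 with hu
  obtain ⟨P, hP⟩ : ∃ P : HeightOneSpectrum (𝓞 k), u ∈ P.asIdeal := by
    by_cases hu0 : u = 0
    · obtain ⟨P⟩ : Nonempty (HeightOneSpectrum (𝓞 k)) := by
        obtain ⟨M, hM⟩ := Ideal.exists_maximal (𝓞 k)
        exact ⟨⟨M, hM.isPrime, Ring.ne_bot_of_isMaximal_of_not_isField hM
          (RingOfIntegers.not_isField k)⟩⟩
      exact ⟨P, by rw [hu0]; exact zero_mem _⟩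
    · obtain ⟨M, hM, huM⟩ := exists_max_ideal_of_mem_nonunits hj
      exact ⟨⟨M, hM.isPrime, Ring.ne_bot_of_isMaximal_of_not_isField hM
          (RingOfIntegers.not_isField k)⟩, huM⟩
  have hsP : s ∉ P.asIdeal := by
    intro h
    refine P.isPrime.ne_top ((Ideal.eq_top_iff_one _).mpr ?_)
    have : (1 : 𝓞 k) = u - s * (a' * b' * s * (j : 𝓞 k) ^ 2) := by rw [hu]; ring
    rw [this]
    exact sub_mem hP (Ideal.mul_mem_right _ _ h)
  have hvs : P.valuation k (algebraMap (𝓞 k) k s) = 1 :=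
    (HeightOneSpectrum.valuation_eq_one_iff_notMem P).mpr hsP
  have hle {x : k} (hx : x ∈ ({a, b} ∪ C ∪ C.image (·⁻¹) : Finset k)) : P.valuation k x ≤ 1 := by
    obtain ⟨x', hx'⟩ := hint x hx
    rw [Algebra.smul_def] at hx'
    have := congrArg (P.valuation k) hx'
    rw [map_mul, hvs, one_mul] at this
    rw [← this]
    exact P.valuation_le_one x'
  refine ⟨P, algebraMap (𝓞 k) k (b' * s * j), P.valuation_le_one _, ?_, ?_⟩
  · have : a * algebraMap (𝓞 k) k (b' * s * j) ^ 2 + b = b * algebraMap (𝓞 k) k u := by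
      simp only [hu, map_add, map_mul, map_pow, map_one, ha', hb']
      ring
    rw [this, map_mul]
    exact mul_lt_one_of_nonneg_of_lt_one_right (hle (by simp)) zero_le
      ((P.valuation_lt_one_iff_mem u).mpr hP)
  · intro c hc hc0
    refine le_antisymm (hle (by simp [hc])) ?_
    have h1 : P.valuation k c⁻¹ ≤ 1 := hle (by simp [hc])
    rw [map_inv₀] at h1
    exact (inv_le_one₀ (zero_lt_iff.mpr ((Valuation.ne_zero_iff _).mpr hc0))).mp h1

/-- The values of `a t ^ 2 + b` meet infinitely many classes modulo squares. -/
lemma exists_mul_sq_add_ne_mul_sq {a b : k} (ha : a ≠ 0) (hb : b ≠ 0) (C : Finset k)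
    (hC : ∀ c ∈ C, c ≠ 0) : ∃ t : k, ∀ c ∈ C, ∀ y, a * t ^ 2 + b ≠ c * y ^ 2 := by
  classical
  obtain ⟨P, t, ht, hx, hv⟩ := exists_heightOneSpectrum_valuation_lt_one ha hb ({a, b, 2} ∪ C)
  set v := P.valuation k
  have hva : v a = 1 := hv a (by simp) ha
  have hvb : v b = 1 := hv b (by simp) hb
  have hv2 : v 2 = 1 := hv 2 (by simp) two_ne_zero
  -- Odd valuation suffices: every c in C is a unit at P, so c y² has even valuation.
  suffices h : ∃ t, v (a * t ^ 2 + b) = WithZero.exp (-1) by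
    obtain ⟨t, ht⟩ := h
    refine ⟨t, fun c hc y hy => ?_⟩
    rw [hy, map_mul, hv c (by simp [hc]) (hC c hc), one_mul, map_pow] at ht
    have hy0 : v y ≠ 0 := by
      intro h
      rw [h, zero_pow two_ne_zero] at ht
      exact WithZero.exp_ne_zero ht.symm
    rw [← WithZero.exp_log hy0, ← WithZero.exp_nsmul, WithZero.exp_inj] at ht
    simp only [nsmul_eq_mul, Nat.cast_ofNat] at ht
    omega
  by_cases h1 : v (a * t ^ 2 + b) = WithZero.exp (-1)
  · exact ⟨t, h1⟩
  have hle : v (a * t ^ 2 + b) < WithZero.exp (-1) := by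
    by_cases h0 : v (a * t ^ 2 + b) = 0
    · rw [h0]
      exact WithZero.exp_pos
    · rw [← WithZero.exp_log h0] at h1 hx ⊢
      rw [← WithZero.exp_zero, WithZero.exp_lt_exp] at hx
      rw [WithZero.exp_lt_exp]
      rw [WithZero.exp_inj] at h1
      omega
  -- If the value is divisible by P², moving t to t + π changes it by 2atπ + aπ². This has valuation
  -- exactly one because 2, a and t are units at P.
  obtain ⟨π, hπ⟩ := P.valuation_exists_uniformizer k
  have hvt : v t = 1 := by
    have h2 : v (a * t ^ 2) = 1 := by
      have : a * t ^ 2 = (a * t ^ 2 + b) - b := by ring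
      rw [this, Valuation.map_sub_eq_of_lt_right, hvb]
      rwa [hvb]
    rw [map_mul, hva, one_mul, map_pow] at h2
    rw [sq] at h2
    exact ht.eq_of_not_lt fun h => (mul_lt_one_of_nonneg_of_lt_one_right ht zero_le h).ne h2
  refine ⟨t + π, ?_⟩
  have hexp : a * (t + π) ^ 2 + b = 2 * a * t * π + (a * π ^ 2 + (a * t ^ 2 + b)) := by ring
  have h3 : v (2 * a * t * π) = WithZero.exp (-1) := by
    simp only [map_mul, hv2, hva, hvt, one_mul]
    exact hπ
  rw [hexp, Valuation.map_add_eq_of_lt_left, h3]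
  rw [h3]
  refine Valuation.map_add_lt _ ?_ hle
  rw [map_mul, hva, one_mul, map_pow, hπ, ← WithZero.exp_nsmul, WithZero.exp_lt_exp]
  decide

open Polynomial in
/-- The adjunction of a square root. -/
lemma finrank_adjoin_sqrt {k A : Type*} [Field k] [CharZero k] [Field A] [Algebra k A] {x : k} {y : A}
    (hy : y ^ 2 = algebraMap k A x) (hx : ∀ z : k, z ^ 2 ≠ x) :
    Module.finrank k (IntermediateField.adjoin k {y}) = 2 ∧
      ∀ c : k, ∀ z ∈ IntermediateField.adjoin k {y}, z ^ 2 = algebraMap k A c → (∀ z, z ^ 2 ≠ c) →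
        ∃ q : k, x = c * q ^ 2 := by
  have hirr := X_pow_sub_C_irreducible_of_prime Nat.prime_two hx
  have hmonic : (X ^ 2 - C x).Monic := monic_X_pow_sub_C x two_ne_zero
  have hmin : X ^ 2 - C x = minpoly k y :=
    minpoly.eq_of_irreducible_of_monic hirr (by simp [hy]) hmonic
  have hint : IsIntegral k y := by
    by_contra h
    rw [minpoly.eq_zero h] at hmin
    exact hmonic.ne_zero hmin
  refine ⟨by rw [IntermediateField.adjoin.finrank hint, ← hmin, natDegree_X_pow_sub_C], ?_⟩
  intro c z hz hzc hc
  rw [← IntermediateField.mem_toSubalgebra,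
    IntermediateField.adjoin_simple_toSubalgebra_of_isAlgebraic hint.isAlgebraic,
    Algebra.adjoin_singleton_eq_range_aeval] at hz
  obtain ⟨f, rfl⟩ := hz
  have hdeg : (f %ₘ (X ^ 2 - C x)).natDegree ≤ 1 := by
    have := natDegree_modByMonic_lt f hmonic (by
      intro h
      have := congrArg natDegree h
      rw [natDegree_X_pow_sub_C, natDegree_one] at this
      omega)
    rw [natDegree_X_pow_sub_C] at this
    omega
  obtain ⟨q, p, hqp⟩ := exists_eq_X_add_C_of_natDegree_le_one hdeg
  have hf : aeval y f = algebraMap k A q * y + algebraMap k A p := by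
    rw [← modByMonic_add_div f (X ^ 2 - C x), hqp]
    simp [hy]
  change aeval y f ^ 2 = _ at hzc
  rw [hf] at hzc
  -- For z = q y + p, the equation z² = c reads 2pq = 0 and p² + q² x = c. As c is not a square in
  -- k, q ≠ 0, so p = 0 and x and c agree up to squares.
  have hqp0 : C (2 * p * q) * X + C (p ^ 2 + q ^ 2 * x - c) = (0 : k[X]) := by
    refine eq_zero_of_dvd_of_natDegree_lt (p := X ^ 2 - C x) ?_ ?_
    · rw [hmin]
      refine minpoly.dvd k y ?_
      simp only [map_add, map_mul, aeval_C, aeval_X, map_sub, map_pow, map_ofNat]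
      linear_combination hzc - algebraMap k A q ^ 2 * hy
    · rw [natDegree_X_pow_sub_C]
      exact Nat.lt_succ_of_le natDegree_linear_le
  have key {u v : k} (h : C u * X + C v = 0) : u = 0 ∧ v = 0 :=
    ⟨by simpa using congrArg (coeff · 1) h, by simpa using congrArg (coeff · 0) h⟩
  obtain ⟨h1, h0⟩ := key hqp0
  have hq : q ≠ 0 := by
    rintro rfl
    exact hc p (by linear_combination h0)
  have hp : p = 0 := by simpa [hq] using h1
  refine ⟨q⁻¹, ?_⟩
  field_simp
  rw [hp] at h0
  linear_combination h0

/-- A conic has points over infinitely many quadratic extensions. -/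
theorem infinite_setOf_conicHasPoint {a b : k} (ha : a ≠ 0) (hb : b ≠ 0) :
    {L : IntermediateField k (AlgebraicClosure k) | Module.finrank k L = 2 ∧
      ConicHasPoint (algebraMap k L a) (algebraMap k L b)}.Infinite := by
  classical
  intro hfin
  -- Each L is generated by square roots from at most one nontrivial square class, represented by c.
  -- A finite set of fields therefore accounts for finitely many classes.
  have hex (L : IntermediateField k (AlgebraicClosure k)) : ∃ c : k, c ≠ 0 ∧
      ∀ x : k, (∃ z ∈ L, z ^ 2 = algebraMap k _ x ∧ IntermediateField.adjoin k {z} = L) →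
        (∀ z : k, z ^ 2 ≠ x) → ∃ q, x = c * q ^ 2 := by
    by_cases h : ∃ c, (∃ z ∈ L, z ^ 2 = algebraMap k _ c) ∧ ∀ z : k, z ^ 2 ≠ c
    · obtain ⟨c, ⟨z, hz, hzc⟩, hc⟩ := h
      refine ⟨c, fun h => hc 0 (by rw [h, zero_pow two_ne_zero]), ?_⟩
      rintro x ⟨y, hy, hyx, rfl⟩ hx
      exact (finrank_adjoin_sqrt hyx hx).2 c z hz hzc hc
    · push Not at h
      refine ⟨1, one_ne_zero, ?_⟩
      rintro x ⟨y, hy, hyx, -⟩ hx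
      obtain ⟨z, hz⟩ := h x ⟨y, hy, hyx⟩
      exact absurd hz (hx z)
  choose c hc0 hc using hex
  -- Avoiding the class of 1 makes a t² + b a nonsquare, so its square root generates a quadratic
  -- field; avoiding the other classes makes that field new.
  obtain ⟨t, ht⟩ := exists_mul_sq_add_ne_mul_sq ha hb (insert 1 (hfin.toFinset.image c)) (by
    intro d hd
    rw [Finset.mem_insert, Finset.mem_image] at hd
    rcases hd with rfl | ⟨L, -, rfl⟩
    · exact one_ne_zero
    · exact hc0 L)
  have hsq (z : k) : z ^ 2 ≠ a * t ^ 2 + b := by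
    intro h
    exact ht 1 (by simp) z (by rw [one_mul, h])
  obtain ⟨y, hy⟩ := IsAlgClosed.exists_pow_nat_eq
    (algebraMap k (AlgebraicClosure k) (a * t ^ 2 + b)) two_pos
  have hyL := IntermediateField.mem_adjoin_simple_self k y
  set L := IntermediateField.adjoin k {y} with hL
  have hmem : L ∈ hfin.toFinset := by
    rw [Set.Finite.mem_toFinset]
    refine ⟨(finrank_adjoin_sqrt hy hsq).1, algebraMap k L t, 1, ⟨y, hyL⟩, Or.inr one_ne_zero, ?_⟩
    apply Subtype.ext
    change y ^ 2 = _
    rw [hy]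
    simp only [map_add, map_mul, map_pow, one_pow, mul_one]
    rfl
  obtain ⟨q, hq⟩ := hc L (a * t ^ 2 + b) ⟨y, hyL, hy, hL.symm⟩ hsq
  exact ht (c L) (Finset.mem_insert_of_mem (Finset.mem_image_of_mem c hmem)) q hq

end

end

noncomputable section

/-! ### Function fields of curves of genus zero -/

section

variable {k F F' : Type*} [Field k] [Field F] [Field F'] [Algebra k F] [Algebra k F']

/-- Lüroth's theorem. -/
lemma IsSimpleTranscendental.of_algHom (h : IsSimpleTranscendental k F') (φ : F →ₐ[k] F') {f : F}
    (hf : f ∉ (algebraMap k F).range) : IsSimpleTranscendental k F := by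
  obtain ⟨e⟩ := isSimpleTranscendental_iff.mp h
  let ψ : F →ₐ[k] RatFunc k := e.symm.toAlgHom.comp φ
  have hne : ψ.fieldRange ≠ ⊥ := by
    intro hbot
    have h1 : ψ f ∈ (⊥ : IntermediateField k (RatFunc k)) := hbot ▸ ⟨f, rfl⟩
    obtain ⟨c, hc⟩ := IntermediateField.mem_bot.mp h1
    exact hf ⟨c, ψ.injective ((ψ.commutes c).trans hc)⟩
  exact isSimpleTranscendental_iff.mpr ⟨(RatFunc.Luroth.algEquiv hne).trans
    (AlgEquiv.ofInjectiveField ψ).symm⟩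

variable {M E : Type*} [Field M] [Field E] [Algebra k M]
  [Algebra k E] [Algebra F E] [Algebra M E] [IsScalarTower k F E] [IsScalarTower k M E]
  [Algebra.IsPushout k F M E]

variable (M E) in
lemma IsSimpleTranscendental.baseChange [FiniteDimensional k M] (h : IsSimpleTranscendental k F) :
    IsSimpleTranscendental M E := by
  obtain ⟨x, htop, hx⟩ := h
  refine ⟨algebraMap F E x, ?_, fun halg => hx ?_⟩
  · rw [← Set.image_singleton]
    exact adjoin_image_eq_top k M htop
  · have h1 : IsAlgebraic k (algebraMap F E x) := halg.restrictScalars k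
    exact (isAlgebraic_algebraMap_iff (algebraMap F E).injective).mp h1

end

section

open TensorProduct Polynomial

variable {k : Type u} [Field k] [CharZero k] (X : Over (Spec (.of k))) [IsProperCurve X]

instance (L : Type u) [Field L] [Algebra k L] : IsProperCurve (baseChangeObj L X) := by
  unfold baseChangeObj
  infer_instance

/-- The function field of the base change of a curve, as an extension of scalars. -/
lemma exists_isPushout_functionField (L : Type u) [Field L] [CharZero L] [Algebra k L]
    [FiniteDimensional k L] :
    ∃ (_ : Algebra k (baseChangeObj L X).left.functionField)
      (_ : Algebra X.left.functionField (baseChangeObj L X).left.functionField)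
      (_ : IsScalarTower k X.left.functionField (baseChangeObj L X).left.functionField)
      (_ : IsScalarTower k L (baseChangeObj L X).left.functionField),
      Algebra.IsPushout k X.left.functionField L (baseChangeObj L X).left.functionField := by
  obtain ⟨e⟩ := nonempty_algEquiv_functionField_baseChange (L := L) X
  let a₁ : Algebra k (baseChangeObj L X).left.functionField :=
    ((algebraMap L _).comp (algebraMap k L)).toAlgebra
  have t₁ : IsScalarTower k L (baseChangeObj L X).left.functionField :=
    .of_algebraMap_eq fun _ => rfl
  let j : X.left.functionField →ₐ[k] (baseChangeObj L X).left.functionField :=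
    (e.toAlgHom.restrictScalars k).comp Algebra.TensorProduct.includeRight
  let a₂ : Algebra X.left.functionField (baseChangeObj L X).left.functionField :=
    j.toRingHom.toAlgebra
  have t₂ : IsScalarTower k X.left.functionField (baseChangeObj L X).left.functionField :=
    .of_algebraMap_eq fun x => (j.commutes x).symm
  refine ⟨a₁, a₂, t₂, t₁, ?_⟩
  let _ : Algebra X.left.functionField (L ⊗[k] X.left.functionField) :=
    Algebra.TensorProduct.rightAlgebra
  have : Algebra.IsPushout k L X.left.functionField (baseChangeObj L X).left.functionField :=
    Algebra.IsPushout.of_equiv (S' := L ⊗[k] X.left.functionField) e rfl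
  exact this.symm

variable {X}

/-- Curves of genus zero are conics. -/
theorem isSimpleTranscendental_or_isConicFunctionField_of_curveGenus_eq_zero [Nontrivial X.left]
    (hX : curveGenus X = 0) : IsSimpleTranscendental k X.left.functionField ∨
      ∃ a b : k, a ≠ 0 ∧ b ≠ 0 ∧ IsConicFunctionField k X.left.functionField a b := by
  obtain ⟨S, O, t, θ, g, h⟩ := exists_isGenusZeroPair_of_nontrivial hX
  have : Normal k g.SplittingField := Normal.of_isSplittingField g
  have : IsGalois k g.SplittingField := ⟨⟩
  have : CharZero g.SplittingField := charZero_of_injective_algebraMap (algebraMap k _).injective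
  -- Passing to the splitting field of g makes all points over p rational, and this field is Galois
  -- over k in characteristic zero, as the descent requires.
  obtain ⟨_, _, _, _, _⟩ := exists_isPushout_functionField X g.SplittingField
  exact isSimpleTranscendental_or_isConicFunctionField (M := g.SplittingField)
    (h.isSimpleTranscendental (E := (baseChangeObj g.SplittingField X).left.functionField)
      (SplittingField.splits g) (Module.finBasis k g.SplittingField))

/-- At a rational point g is linear and splits over k itself, so the generation criterion applies
with no extension of scalars. -/
theorem isSimpleTranscendental_of_rationalPoint [Nontrivial X.left]
    (hX : curveGenus X = 0) (Q : Over.mk (𝟙 (Spec (.of k))) ⟶ X) :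
    IsSimpleTranscendental k X.left.functionField := by
  obtain ⟨S, O, t, θ, g, h, hg⟩ := exists_isGenusZeroPair_of_rationalPoint hX Q
  exact h.isSimpleTranscendental (M := k) (Splits.of_natDegree_le_one (by rw [natDegree_map, hg]))
    (Module.finBasis k k)

end

end

noncomputable section

/-! ### Towers of curves with rational function fields -/

/-- Inverse systems of curves with surjective transition maps which are not isomorphisms. -/
structure IsCurveSystem {k : Type u} [Field k] (S : ℕᵒᵖ ⥤ Over (Spec (.of k))) : Prop where
  isProperCurve : ∀ n, IsProperCurve (S.obj (op n))
  nontrivial : ∀ n, Nontrivial (S.obj (op n)).left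
  surjective : ∀ n : ℕ, Surjective (S.map (homOfLE (n.le_add_right 1)).op).left
  not_isIso : ∀ n : ℕ, ¬ IsIso (S.map (homOfLE (n.le_add_right 1)).op)

section

variable {k : Type u} [Field k]

lemma map_genericPoint_eq_of_surjective {X Y : Over (Spec (.of k))} [IrreducibleSpace X.left]
    [IrreducibleSpace Y.left] (φ : X ⟶ Y) [Surjective φ.left] :
    φ.left (genericPoint X.left) = genericPoint Y.left :=
  genericPoint_map_eq_of_denseRange _ φ.left.continuous φ.left.surjective.denseRange

lemma IsCurveSystem.baseChange {S : ℕᵒᵖ ⥤ Over (Spec (.of k))} (hS : IsCurveSystem S)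
    (L : Type u) [Field L] [Algebra k L] :
    IsCurveSystem (S ⋙ Over.pullback (Spec.map (CommRingCat.ofHom (algebraMap k L)))) where
  isProperCurve n := by
    have := hS.isProperCurve n
    exact inferInstanceAs (IsProperCurve (baseChangeObj L (S.obj (op n))))
  nontrivial n := by
    have := hS.nontrivial n
    have h : Surjective (baseChangeFst (L := L) (S.obj (op n))).left :=
      MorphismProperty.of_isPullback (P := @Surjective)
        (isPullback_baseChange (L := L) (S.obj (op n))).flip inferInstance
    exact h.surj.nontrivial
  surjective n := by
    have := hS.surjective n
    exact surjective_baseChange_map (S.map (homOfLE (n.le_add_right 1)).op)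
  not_isIso n h := by
    have : IsIso ((Over.pullback (Spec.map (CommRingCat.ofHom (algebraMap k L)))).map
      (S.map (homOfLE (n.le_add_right 1)).op)) := h
    exact hS.not_isIso n (isIso_of_isIso_baseChange_map (L := L) _)

variable [CharZero k]

lemma valuationRing_stalk (X : Over (Spec (.of k))) [IsProperCurve X] (x : X.left) :
    ValuationRing (X.left.presheaf.stalk x) :=
  inferInstance

lemma IsSimpleTranscendental.of_surjective {X Y : Over (Spec (.of k))} [IsProperCurve X]
    [IsProperCurve Y] [Nontrivial Y.left] (φ : X ⟶ Y) [Surjective φ.left]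
    (h : IsSimpleTranscendental k X.left.functionField) :
    IsSimpleTranscendental k Y.left.functionField := by
  obtain ⟨p, hp⟩ := exists_ne (genericPoint Y.left)
  obtain ⟨f, hf⟩ := exists_mem_functionField_notMem_range (k := k) hp
  exact h.of_algHom (functionFieldMap φ (map_genericPoint_eq_of_surjective φ)) hf

lemma IsSimpleTranscendental.nonempty_iso {X : Over (Spec (.of k))} [IsProperCurve X]
    (h : IsSimpleTranscendental k X.left.functionField) : Nonempty (X ≅ projSpace k 1) := by
  obtain ⟨e⟩ := isSimpleTranscendental_iff.mp h
  obtain ⟨e', -⟩ := exists_algEquiv_functionField_projSpace k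
  obtain ⟨φ, -, -⟩ := exists_iso_of_functionField_algEquiv (X := X) (Y := projSpace k 1)
    (valuationRing_stalk X) (valuationRing_stalk_projSpace k) (e'.trans e)
  exact ⟨φ⟩

/-- Lüroth carries rationality from the levels above m₀ to those below. Isomorphisms with ℙ¹ may be
chosen independently at each level, since the maps g are obtained by conjugating with them. -/
theorem IsCurveSystem.exists_isIsoToRationalTower {S : ℕᵒᵖ ⥤ Over (Spec (.of k))}
    (hS : IsCurveSystem S) (m₀ : ℕ)
    (h : ∀ m ≥ m₀, have := hS.isProperCurve m
      IsSimpleTranscendental k (S.obj (op m)).left.functionField) :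
    ∃ f : ℕ → RatFunc k, IsIsoToRationalTower S f := by
  have := hS.isProperCurve
  have := hS.nontrivial
  have := hS.surjective
  have hall (n : ℕ) : IsSimpleTranscendental k (S.obj (op n)).left.functionField := by
    rcases le_total m₀ n with hn | hn
    · exact h n hn
    · induction hn using Nat.decreasingInduction with
      | self => exact h m₀ le_rfl
      | of_succ n _ ih => exact ih.of_surjective (S.map (homOfLE (n.le_add_right 1)).op)
  let α (n : ℕ) : S.obj (op n) ≅ projSpace k 1 := (hall n).nonempty_iso.some
  let g (n : ℕ) : projSpace k 1 ⟶ projSpace k 1 :=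
    (α (n + 1)).inv ≫ S.map (homOfLE (n.le_add_right 1)).op ≫ (α n).hom
  have hg (n : ℕ) : S.map (homOfLE (n.le_add_right 1)).op ≫ (α n).hom = (α (n + 1)).hom ≫ g n := by
    simp [g]
  have hf (n : ℕ) : ∃ f : RatFunc k, IsGivenBy (g n) f ∧ 1 < ratFuncDegree f := by
    have h1 : Surjective (g n).left := by
      have i1 : IsIso (α (n + 1)).inv.left :=
        inferInstanceAs (IsIso ((Over.forget _).map (α (n + 1)).inv))
      have i2 : IsIso (α n).hom.left := inferInstanceAs (IsIso ((Over.forget _).map (α n).hom))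
      have := this n
      change Surjective ((α (n + 1)).inv.left ≫ (S.map (homOfLE (n.le_add_right 1)).op).left ≫
        (α n).hom.left)
      infer_instance
    refine exists_isGivenBy (g n) (map_genericPoint_eq_of_surjective (g n)) fun hsurj => ?_
    have := isIso_of_surjective_functionFieldMap (valuationRing_stalk_projSpace k)
      (valuationRing_stalk_projSpace k) (g n) _ hsurj
    refine hS.not_isIso n ?_
    rw [(Iso.eq_comp_inv _).mpr (hg n)]
    infer_instance
  choose f hf using hf
  refine ⟨f, fun n => (hf n).2, g, fun n => (hf n).1, ?_⟩
  let β : S ⟶ Functor.ofOpSequence (X := fun _ => projSpace k 1) g :=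
    NatTrans.ofOpSequence (fun n => (α n).hom) fun n => by
      rw [Functor.ofOpSequence_map_homOfLE_succ]
      exact hg n
  have (n : ℕᵒᵖ) : IsIso (β.app n) := inferInstanceAs (IsIso (α n.unop).hom)
  have := NatIso.isIso_of_isIso_app β
  exact ⟨asIso β⟩

lemma IsCurveSystem.nonempty_algHom {S : ℕᵒᵖ ⥤ Over (Spec (.of k))} (hS : IsCurveSystem S)
    {n m : ℕ} (h : n ≤ m) :
    have := hS.isProperCurve
    Nonempty ((S.obj (op n)).left.functionField →ₐ[k] (S.obj (op m)).left.functionField) := by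
  have := hS.isProperCurve
  have := hS.surjective
  induction m, h using Nat.le_induction with
  | base => exact ⟨AlgHom.id k _⟩
  | succ m _ ih =>
    obtain ⟨φ⟩ := ih
    exact ⟨(functionFieldMap (S.map (homOfLE (m.le_add_right 1)).op)
      (map_genericPoint_eq_of_surjective _)).comp φ⟩

lemma TowerOfCurves.isCurveSystem (T : TowerOfCurves k) : IsCurveSystem T.toFunctor := by
  have hc (n : ℕ) : IsProperCurve (T.C n) := (T.isCurve n).isProperCurve
  refine ⟨hc, fun n => ?_, fun n => ?_, fun n h => ?_⟩
  · have h := T.nonconstant n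
    rw [Set.not_subsingleton_iff] at h
    obtain ⟨x, -, y, -, hxy⟩ := h
    exact ⟨x, y, hxy⟩
  · rw [TowerOfCurves.toFunctor, Functor.ofOpSequence_map_homOfLE_succ]
    exact surjective_of_map_genericPoint_eq (T.φ n)
      (map_genericPoint_eq_of_nonconstant (T.φ n) (T.nonconstant n))
  · rw [TowerOfCurves.toFunctor, Functor.ofOpSequence_map_homOfLE_succ] at h
    have : IsIso (T.φ n) := h
    have : IsIso (T.φ n).left := inferInstanceAs (IsIso ((Over.forget _).map (T.φ n)))
    have h1 := T.one_lt_degree n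
    rw [morphismDegree_eq_one_of_isIso] at h1
    exact h1.false

end

end

/-! ### One conic for all large levels, and the conclusion -/

noncomputable section

section

variable {k : Type u} [Field k]

lemma TowerOfCurves.exists_forall_curveGenus_eq_zero {T : TowerOfCurves k} (hT : T.genus = 0) :
    ∃ m₀, ∀ m ≥ m₀, curveGenus (T.C m) = 0 := by
  have h : Filter.limsup (fun n => curveGenus (T.C n)) Filter.atTop < 1 := by
    change T.genus < 1
    rw [hT]
    exact zero_lt_one
  obtain ⟨m₀, hm₀⟩ := Filter.eventually_atTop.mp (Filter.eventually_lt_of_limsup_lt h)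
  exact ⟨m₀, fun m hm => Order.lt_one_iff.mp (hm₀ m hm)⟩

lemma IsSimpleTranscendental.baseChangeObj [CharZero k] {X : Over (Spec (.of k))} [IsProperCurve X]
    (h : IsSimpleTranscendental k X.left.functionField) (L : Type u) [Field L] [CharZero L]
    [Algebra k L] [FiniteDimensional k L] :
    IsSimpleTranscendental L (baseChangeObj L X).left.functionField := by
  obtain ⟨_, _, _, _, _⟩ := exists_isPushout_functionField X L
  exact h.baseChange L _

lemma IsConicFunctionField.isSimpleTranscendental_baseChangeObj [CharZero k]
    {X : Over (Spec (.of k))} [IsProperCurve X] {a b : k} (ha : a ≠ 0) (hb : b ≠ 0)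
    (h : IsConicFunctionField k X.left.functionField a b) (L : Type u) [Field L] [CharZero L]
    [Algebra k L] [FiniteDimensional k L]
    (hL : ConicHasPoint (algebraMap k L a) (algebraMap k L b)) :
    IsSimpleTranscendental L (baseChangeObj L X).left.functionField := by
  obtain ⟨_, _, _, _, _⟩ := exists_isPushout_functionField X L
  exact (h.baseChange L _).isSimpleTranscendental (by rwa [_root_.map_ne_zero])
    (by rwa [_root_.map_ne_zero]) hL

/-- In a system of curves of genus zero, a single conic governs the splitting of all curves from some
level on. -/
lemma IsCurveSystem.exists_conic [CharZero k] {S : ℕᵒᵖ ⥤ Over (Spec (.of k))} (hS : IsCurveSystem S)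
    (m₀ : ℕ) (hgenus : ∀ m ≥ m₀, curveGenus (S.obj (op m)) = 0) :
    ∃ (a b : k) (_ : a ≠ 0) (_ : b ≠ 0) (m₁ : ℕ), ∀ (L : Type u) [Field L] [CharZero L] [Algebra k L]
      [FiniteDimensional k L], ConicHasPoint (algebraMap k L a) (algebraMap k L b) →
      ∀ m ≥ m₁, have := hS.isProperCurve m
        IsSimpleTranscendental L (baseChangeObj L (S.obj (op m))).left.functionField := by
  have := hS.isProperCurve
  have := hS.nontrivial
  have := hS.surjective
  by_cases hall : ∀ m ≥ m₀, IsSimpleTranscendental k (S.obj (op m)).left.functionField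
  · exact ⟨1, 1, one_ne_zero, one_ne_zero, m₀, fun L _ _ _ _ _ m hm => (hall m hm).baseChangeObj L⟩
  push Not at hall
  obtain ⟨m₁, hm₁, hns⟩ := hall
  -- Contrapositive of Lüroth: failure of rationality at level m₁ persists upwards, so all higher
  -- levels are conics without a rational point and can be compared with the one at m₁.
  have hns' (m : ℕ) (hm : m₁ ≤ m) :
      ¬ IsSimpleTranscendental k (S.obj (op m)).left.functionField := by
    induction m, hm using Nat.le_induction with
    | base => exact hns
    | succ m _ ih => exact fun h => ih (h.of_surjective (S.map (homOfLE (m.le_add_right 1)).op))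
  have hconic (m : ℕ) (hm : m₁ ≤ m) : ∃ a b : k, a ≠ 0 ∧ b ≠ 0 ∧
      IsConicFunctionField k (S.obj (op m)).left.functionField a b :=
    (isSimpleTranscendental_or_isConicFunctionField_of_curveGenus_eq_zero
      (hgenus m (hm₁.le.trans hm))).resolve_left (hns' m hm)
  obtain ⟨a, b, ha, hb, hab⟩ := hconic m₁ le_rfl
  refine ⟨a, b, ha, hb, m₁, fun L _ _ _ _ hL m hm => ?_⟩
  obtain ⟨a', b', ha', hb', hab'⟩ := hconic m hm
  obtain ⟨φ⟩ := hS.nonempty_algHom hm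
  exact hab'.isSimpleTranscendental_baseChangeObj ha' hb' L
    (hab.conicHasPoint_of_algHom ha hb ha' hb' hab' φ
      (fun hp => hns (hab.isSimpleTranscendental ha hb hp)) (hns' m hm) hL)

end

end

theorem mainTheorem11 {K : Type u} [Field K] [NumberField K] (T : TowerOfCurves K)
    (hT : T.genus = 0) :
    ((T.trivialPoints 0).Nonempty →
      ∃ f : ℕ → RatFunc K, IsIsoToRationalTower T.toFunctor f) ∧
    {L : IntermediateField K (AlgebraicClosure K) | Module.finrank K L = 2 ∧
      ∃ f : ℕ → RatFunc L, IsIsoToRationalTower (T.baseChange L) f}.Infinite := by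
  obtain ⟨m₀, hm₀⟩ := TowerOfCurves.exists_forall_curveGenus_eq_zero hT
  have hS := T.isCurveSystem
  refine ⟨fun ⟨P, hP⟩ => hS.exists_isIsoToRationalTower m₀ fun m hm => ?_, ?_⟩
  · obtain ⟨Q, -⟩ := hP m (Nat.zero_le m)
    have := hS.isProperCurve m
    have := hS.nontrivial m
    exact isSimpleTranscendental_of_rationalPoint (hm₀ m hm) Q
  · obtain ⟨a, b, ha, hb, m₁, h⟩ := hS.exists_conic m₀ hm₀
    refine (infinite_setOf_conicHasPoint ha hb).mono ?_
    rintro L ⟨hL, hp⟩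
    refine ⟨hL, ?_⟩
    have : FiniteDimensional K L := .of_finrank_pos (by rw [hL]; exact two_pos)
    exact (hS.baseChange L).exists_isIsoToRationalTower m₁ (h L hp)
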